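/- Theorem. Let $k$ be an algebraically closed field of characteristic different from $2$, and let $\alpha_2,\alpha_3,\beta_2,\beta_3\in k\smallsetminus\{0\}$ be pairwise distinct. Let $E_1: y_1^2=x(x-\alpha_2)(x-\alpha_3)$ and $E_2: y_2^2=x(x-\beta_2)(x-\beta_3)$ be the corresponding (complete) genus-one curves over $k$, each with its double cover $(x,y)\mapsto x$ of $\mathbb{P}^1$, and let $C$ be the normalization of the fiber product $E_1\times_{\mathbb{P}^1}E_2$. Put $\tau_1=\alpha_2+\alpha_3$, $\tau_2=\alpha_2\alpha_3$, $\rho_1=\beta_2+\beta_3$, $\rho_2=\beta_2\beta_3$, and assume $\alpha_2\alpha_3\neq\beta_2\beta_3$. (By a criterion of Oort this is the case in which $C$ is non-hyperelliptic.) Let $$f=\mathrm{Res}_x\bigl(x^2-(\tau_1+Y^2)x+\tau_2,\ x^2-(\rho_1+Z^2)x+\rho_2\bigr)\in k[Y,Z].$$ Then $$\begin{aligned} f&=\rho_2Y^4+(-\tau_2-\rho_2)Y^2Z^2+\tau_2Z^4+(2\tau_1\rho_2-\tau_2\rho_1-\rho_1\rho_2)Y^2+(-\tau_1\tau_2-\tau_1\rho_2+2\tau_2\rho_1)Z^2\\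 &\quad+\tau_1^2\rho_2-\tau_1\tau_2\rho_1-\tau_1\rho_1\rho_2+\tau_2^2+\tau_2\rho_1^2-2\tau_2\rho_2+\rho_2^2,\end{aligned}$$ the projective closure $\tilde C$ in $\mathbb{P}^2$ of the affine curve $f(Y,Z)=0$ is non-singular (smooth of relative dimension $1$ over $k$), and $C$ is isomorphic to $\tilde C$ over $k$. -/

import Mathlib

open AlgebraicGeometry CategoryTheory CategoryTheory.Limits Polynomial

namespace HoweCurve

universe u

noncomputable section

/-! ### The projective line, glued from two affine lines by `x ↦ 1 / x` -/

section ProjectiveLine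

variable (k : Type u) [Field k]

/-- `k[x] → k[x, 1/x]`, `x ↦ x`. -/
def lineGlue₀ : k[X] →+* LaurentPolynomial k :=
  algebraMap k[X] (LaurentPolynomial k)

/-- `k[x] → k[x, 1/x]`, `x ↦ 1/x`. -/
def lineGlue₁ : k[X] →+* LaurentPolynomial k :=
  (LaurentPolynomial.invert (R := k)).toRingEquiv.toRingHom.comp (lineGlue₀ k)

instance isOpenImmersion_lineGlue₀ :
    IsOpenImmersion (Spec.map (CommRingCat.ofHom (lineGlue₀ k))) :=
  IsOpenImmersion.of_isLocalization (X : k[X])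

instance isOpenImmersion_lineGlue₁ :
    IsOpenImmersion (Spec.map (CommRingCat.ofHom (lineGlue₁ k))) := by
  have h : Spec.map (CommRingCat.ofHom (lineGlue₁ k)) =
      Spec.map ((LaurentPolynomial.invert (R := k)).toRingEquiv.toCommRingCatIso.hom) ≫
        Spec.map (CommRingCat.ofHom (lineGlue₀ k)) := by
    rw [← Spec.map_comp]
    rfl
  rw [h]
  infer_instance

/-- The projective line over `k`. -/
def P1 : Scheme.{u} :=
  pushout (Spec.map (CommRingCat.ofHom (lineGlue₀ k))) (Spec.map (CommRingCat.ofHom (lineGlue₁ k)))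

/-- The chart with coordinate `x`. -/
def P1.ι₀ : Spec (.of k[X]) ⟶ P1 k := pushout.inl _ _

/-- The chart with coordinate `1 / x`. -/
def P1.ι₁ : Spec (.of k[X]) ⟶ P1 k := pushout.inr _ _

/-- The structure morphism of the projective line. -/
def P1.toSpec : P1 k ⟶ Spec (.of k) :=
  pushout.desc (Spec.map (CommRingCat.ofHom (algebraMap k k[X])))
    (Spec.map (CommRingCat.ofHom (algebraMap k k[X]))) (by
      rw [← Spec.map_comp, ← Spec.map_comp, ← CommRingCat.ofHom_comp, ← CommRingCat.ofHom_comp]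
      congr 2
      ext r
      simp [lineGlue₀, lineGlue₁])

lemma P1.ι₀_toSpec :
    P1.ι₀ k ≫ P1.toSpec k = Spec.map (CommRingCat.ofHom (algebraMap k k[X])) :=
  pushout.inl_desc _ _ _

lemma P1.ι₁_toSpec :
    P1.ι₁ k ≫ P1.toSpec k = Spec.map (CommRingCat.ofHom (algebraMap k k[X])) :=
  pushout.inr_desc _ _ _

end ProjectiveLine

/-! ### Double covers `y² = f(x)` of the projective line -/

section DoubleCover

variable {k : Type u} [Field k]

/-- The ring `k[x, y] / (y² - f(x))`. -/
abbrev ChartRing (f : k[X]) : Type u :=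
  AdjoinRoot (X ^ 2 - C f : k[X][X])

/-- The function `x` on `y² = f(x)`. -/
def xFun (f : k[X]) : ChartRing f := AdjoinRoot.of _ X

/-- The function `y` on `y² = f(x)`. -/
def yFun (f : k[X]) : ChartRing f := AdjoinRoot.root _

/-- The ring of the open part `x ≠ 0` of `y² = f(x)`. -/
abbrev OverlapRing (f : k[X]) : Type u := Localization.Away (xFun f)

/-- For `deg f ≤ 2g + 2`, this is `x ^ (2g + 2) * f(1 / x)`. -/
def flipPoly (g : ℕ) (f : k[X]) : k[X] := f.reflect (2 * g + 2)

lemma yFun_sq (f : k[X]) : yFun f ^ 2 = AdjoinRoot.of _ f := by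
  have h := AdjoinRoot.eval₂_root (X ^ 2 - C f : k[X][X])
  simp only [eval₂_sub, eval₂_X_pow, eval₂_C] at h
  exact sub_eq_zero.mp h

lemma of_eq_eval₂ (f p : k[X]) :
    (AdjoinRoot.of (X ^ 2 - C f : k[X][X])) p = eval₂ (algebraMap k (ChartRing f)) (xFun f) p := by
  have : AdjoinRoot.of (X ^ 2 - C f : k[X][X]) =
      eval₂RingHom (algebraMap k (ChartRing f)) (xFun f) := by
    apply Polynomial.ringHom_ext
    · intro a
      simp only [coe_eval₂RingHom, eval₂_C]
      rfl
    · simp [xFun]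
  rw [this]
  rfl

/-- A ring homomorphism out of `k[x, y] / (y² - f(x))` over `k` is a choice of images of `x`, `y`
that satisfy the equation. -/
def chartLift {S : Type u} [CommRing S] [Algebra k S] (f : k[X]) (a b : S)
    (h : b ^ 2 = eval₂ (algebraMap k S) a f) : ChartRing f →+* S :=
  AdjoinRoot.lift (eval₂RingHom (algebraMap k S) a) b (by simp [h])

@[simp] lemma chartLift_x {S : Type u} [CommRing S] [Algebra k S] (f : k[X]) (a b : S)
    (h : b ^ 2 = eval₂ (algebraMap k S) a f) : chartLift f a b h (xFun f) = a := by
  simp [chartLift, xFun]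

@[simp] lemma chartLift_y {S : Type u} [CommRing S] [Algebra k S] (f : k[X]) (a b : S)
    (h : b ^ 2 = eval₂ (algebraMap k S) a f) : chartLift f a b h (yFun f) = b := by
  simp [chartLift, yFun]

lemma chartLift_algebraMap {S : Type u} [CommRing S] [Algebra k S] (f : k[X]) (a b : S)
    (h : b ^ 2 = eval₂ (algebraMap k S) a f) (r : k) :
    chartLift f a b h (algebraMap k _ r) = algebraMap k S r := by
  have : algebraMap k (ChartRing f) r = AdjoinRoot.of _ (C r) := rfl
  rw [this]
  simp [chartLift]

lemma chart_ext {S : Type u} [CommRing S] {f : k[X]} {φ ψ : ChartRing f →+* S}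
    (hk : ∀ r : k, φ (algebraMap k _ r) = ψ (algebraMap k _ r))
    (hx : φ (xFun f) = ψ (xFun f)) (hy : φ (yFun f) = ψ (yFun f)) : φ = ψ := by
  refine AdjoinRoot.ringHom_ext ?_ hy
  refine Polynomial.ringHom_ext (fun a => ?_) hx
  exact hk a

/-- The inverse of `x` on the part `x ≠ 0`. -/
def xInv (f : k[X]) : OverlapRing f := IsLocalization.Away.invSelf (xFun f)

lemma x_mul_xInv (f : k[X]) : algebraMap _ (OverlapRing f) (xFun f) * xInv f = 1 :=
  IsLocalization.Away.mul_invSelf _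

lemma eval₂_algebraMap (f p : k[X]) :
    algebraMap (ChartRing f) (OverlapRing f) (AdjoinRoot.of _ p) =
      eval₂ (algebraMap k (OverlapRing f)) (algebraMap _ _ (xFun f)) p := by
  rw [of_eq_eval₂, hom_eval₂]
  rfl

lemma flip_relation (g : ℕ) (f : k[X]) (hf : f.natDegree ≤ 2 * g + 2) :
    (algebraMap _ (OverlapRing f) (yFun f) * xInv f ^ (g + 1)) ^ 2 =
      eval₂ (algebraMap k (OverlapRing f)) (xInv f) (flipPoly g f) := by
  let _ : Invertible (algebraMap _ (OverlapRing f) (xFun f)) :=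
    ⟨xInv f, by rw [mul_comm, x_mul_xInv], x_mul_xInv f⟩
  have h := eval₂_reflect_mul_pow (algebraMap k (OverlapRing f))
    (algebraMap _ (OverlapRing f) (xFun f)) (2 * g + 2) f hf
  have h1 : algebraMap _ (OverlapRing f) (yFun f) ^ 2 =
      eval₂ (algebraMap k (OverlapRing f)) (algebraMap _ _ (xFun f)) f := by
    rw [← map_pow, yFun_sq, eval₂_algebraMap]
  have h2 : (⅟(algebraMap _ (OverlapRing f) (xFun f))) = xInv f := rfl
  have h3 := x_mul_xInv f
  rw [mul_pow, h1, ← h, h2, flipPoly, mul_assoc, ← pow_mul, ← mul_comm 2 (g + 1),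
    show 2 * (g + 1) = 2 * g + 2 by ring, ← mul_pow, h3, one_pow, mul_one]

lemma flip_relation' (g : ℕ) (f : k[X]) (hf : f.natDegree ≤ 2 * g + 2) :
    (algebraMap _ (OverlapRing (flipPoly g f)) (yFun (flipPoly g f)) *
        xInv (flipPoly g f) ^ (g + 1)) ^ 2 =
      eval₂ (algebraMap k (OverlapRing (flipPoly g f))) (xInv (flipPoly g f)) f := by
  set F := flipPoly g f with hF
  let _ : Invertible (xInv F) :=
    ⟨algebraMap _ (OverlapRing F) (xFun F), x_mul_xInv F, by rw [mul_comm, x_mul_xInv]⟩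
  have h := eval₂_reflect_mul_pow (algebraMap k (OverlapRing F)) (xInv F) (2 * g + 2) f hf
  have h1 : algebraMap _ (OverlapRing F) (yFun F) ^ 2 =
      eval₂ (algebraMap k (OverlapRing F)) (algebraMap _ _ (xFun F)) F := by
    rw [← map_pow, yFun_sq, eval₂_algebraMap]
  have h2 : (⅟(xInv F)) = algebraMap _ (OverlapRing F) (xFun F) := rfl
  rw [mul_pow, h1, ← h, h2, ← pow_mul]
  congr 2
  ring

/-- The inclusion of `x ≠ 0` into the chart `y² = f(x)`. -/
def coverGlue₀ (f : k[X]) : ChartRing f →+* OverlapRing f :=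
  algebraMap _ _

/-- The inclusion of `x ≠ 0` into the chart at infinity, `(x, y) ↦ (1 / x, y / x ^ (g + 1))`. -/
def coverGlue₁ (g : ℕ) (f : k[X]) (hf : f.natDegree ≤ 2 * g + 2) :
    ChartRing (flipPoly g f) →+* OverlapRing f :=
  chartLift (flipPoly g f) (xInv f) (algebraMap _ _ (yFun f) * xInv f ^ (g + 1))
    (flip_relation g f hf)

/-- The same map as `coverGlue₁` with the roles of the two charts exchanged. -/
def coverGlue₁' (g : ℕ) (f : k[X]) (hf : f.natDegree ≤ 2 * g + 2) :
    ChartRing f →+* OverlapRing (flipPoly g f) :=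
  chartLift f (xInv (flipPoly g f))
    (algebraMap _ _ (yFun (flipPoly g f)) * xInv (flipPoly g f) ^ (g + 1)) (flip_relation' g f hf)

lemma isUnit_xInv (f : k[X]) : IsUnit (xInv f) :=
  IsUnit.of_mul_eq_one _ (by rw [mul_comm]; exact x_mul_xInv f)

/-- `coverGlue₁` extended to the open part `1 / x ≠ 0` of the chart at infinity. -/
def overlapMap (g : ℕ) (f : k[X]) (hf : f.natDegree ≤ 2 * g + 2) :
    OverlapRing (flipPoly g f) →+* OverlapRing f :=
  IsLocalization.Away.lift (xFun (flipPoly g f)) (g := coverGlue₁ g f hf)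
    (by rw [coverGlue₁, chartLift_x]; exact isUnit_xInv f)

/-- The inverse of `overlapMap`. -/
def overlapMap' (g : ℕ) (f : k[X]) (hf : f.natDegree ≤ 2 * g + 2) :
    OverlapRing f →+* OverlapRing (flipPoly g f) :=
  IsLocalization.Away.lift (xFun f) (g := coverGlue₁' g f hf)
    (by rw [coverGlue₁', chartLift_x]; exact isUnit_xInv _)

lemma overlapMap_algebraMap (g : ℕ) (f : k[X]) (hf : f.natDegree ≤ 2 * g + 2)
    (z : ChartRing (flipPoly g f)) :
    overlapMap g f hf (algebraMap _ _ z) = coverGlue₁ g f hf z :=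
  IsLocalization.Away.lift_eq _ _ _

lemma overlapMap'_algebraMap (g : ℕ) (f : k[X]) (hf : f.natDegree ≤ 2 * g + 2)
    (z : ChartRing f) :
    overlapMap' g f hf (algebraMap _ _ z) = coverGlue₁' g f hf z :=
  IsLocalization.Away.lift_eq _ _ _

lemma overlapMap_xInv (g : ℕ) (f : k[X]) (hf : f.natDegree ≤ 2 * g + 2) :
    overlapMap g f hf (xInv _) = algebraMap _ _ (xFun f) := by
  have h := congrArg (overlapMap g f hf) (x_mul_xInv (flipPoly g f))
  rw [map_mul, map_one, overlapMap_algebraMap, coverGlue₁, chartLift_x] at h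
  refine (isUnit_xInv f).mul_left_cancel (h.trans ?_)
  rw [mul_comm, x_mul_xInv]

lemma overlapMap'_xInv (g : ℕ) (f : k[X]) (hf : f.natDegree ≤ 2 * g + 2) :
    overlapMap' g f hf (xInv _) = algebraMap _ _ (xFun (flipPoly g f)) := by
  have h := congrArg (overlapMap' g f hf) (x_mul_xInv f)
  rw [map_mul, map_one, overlapMap'_algebraMap, coverGlue₁', chartLift_x] at h
  refine (isUnit_xInv (flipPoly g f)).mul_left_cancel (h.trans ?_)
  rw [mul_comm, x_mul_xInv]

lemma overlap_comp (g : ℕ) (f : k[X]) (hf : f.natDegree ≤ 2 * g + 2) :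
    (overlapMap g f hf).comp (overlapMap' g f hf) = RingHom.id _ := by
  refine IsLocalization.ringHom_ext (Submonoid.powers (xFun f)) (chart_ext ?_ ?_ ?_)
  · intro r
    simp only [RingHom.comp_apply, overlapMap'_algebraMap, coverGlue₁', chartLift_algebraMap]
    rw [IsScalarTower.algebraMap_apply k (ChartRing (flipPoly g f)), overlapMap_algebraMap,
      coverGlue₁, chartLift_algebraMap]
    rfl
  · simp only [RingHom.comp_apply, overlapMap'_algebraMap, coverGlue₁', chartLift_x,
      overlapMap_xInv, RingHom.id_apply]
  · simp only [RingHom.comp_apply, overlapMap'_algebraMap, coverGlue₁', chartLift_y, map_mul,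
      map_pow, overlapMap_xInv, RingHom.id_apply, overlapMap_algebraMap, coverGlue₁]
    rw [mul_assoc, ← mul_pow, mul_comm (xInv f), x_mul_xInv, one_pow, mul_one]

lemma overlap_comp' (g : ℕ) (f : k[X]) (hf : f.natDegree ≤ 2 * g + 2) :
    (overlapMap' g f hf).comp (overlapMap g f hf) = RingHom.id _ := by
  refine IsLocalization.ringHom_ext (Submonoid.powers (xFun (flipPoly g f))) (chart_ext ?_ ?_ ?_)
  · intro r
    simp only [RingHom.comp_apply, overlapMap_algebraMap, coverGlue₁, chartLift_algebraMap]
    rw [IsScalarTower.algebraMap_apply k (ChartRing f), overlapMap'_algebraMap,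
      coverGlue₁', chartLift_algebraMap]
    rfl
  · simp only [RingHom.comp_apply, overlapMap_algebraMap, coverGlue₁, chartLift_x,
      overlapMap'_xInv, RingHom.id_apply]
  · simp only [RingHom.comp_apply, overlapMap_algebraMap, coverGlue₁, chartLift_y, map_mul,
      map_pow, overlapMap'_xInv, RingHom.id_apply, overlapMap'_algebraMap, coverGlue₁']
    rw [mul_assoc, ← mul_pow, mul_comm (xInv (flipPoly g f)), x_mul_xInv, one_pow, mul_one]

/-- The part `x ≠ 0` of the first chart is the part `1 / x ≠ 0` of the chart at infinity. -/
def overlapEquiv (g : ℕ) (f : k[X]) (hf : f.natDegree ≤ 2 * g + 2) :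
    OverlapRing (flipPoly g f) ≃+* OverlapRing f :=
  RingEquiv.ofRingHom (overlapMap g f hf) (overlapMap' g f hf)
    (overlap_comp g f hf) (overlap_comp' g f hf)

instance isOpenImmersion_coverGlue₀ (f : k[X]) :
    IsOpenImmersion (Spec.map (CommRingCat.ofHom (coverGlue₀ f))) :=
  IsOpenImmersion.of_isLocalization (xFun f)

instance isOpenImmersion_coverGlue₁ (g : ℕ) (f : k[X]) (hf : f.natDegree ≤ 2 * g + 2) :
    IsOpenImmersion (Spec.map (CommRingCat.ofHom (coverGlue₁ g f hf))) := by
  have h : Spec.map (CommRingCat.ofHom (coverGlue₁ g f hf)) =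
      Spec.map ((overlapEquiv g f hf).toCommRingCatIso.hom) ≫
        Spec.map (CommRingCat.ofHom (algebraMap (ChartRing (flipPoly g f))
          (OverlapRing (flipPoly g f)))) := by
    rw [← Spec.map_comp]
    congr 1
    exact CommRingCat.hom_ext (RingHom.ext fun z => (overlapMap_algebraMap g f hf z).symm)
  have : IsOpenImmersion (Spec.map (CommRingCat.ofHom (algebraMap (ChartRing (flipPoly g f))
          (OverlapRing (flipPoly g f))))) :=
    IsOpenImmersion.of_isLocalization (xFun (flipPoly g f))
  rw [h]
  infer_instance

/-- For `deg f ∈ {2g + 1, 2g + 2}`, the curve `y² = f(x)`: the affine curves `y² = f(x)` and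
`y² = x ^ (2g + 2) * f(1 / x)`, glued by `(x, y) ↦ (1 / x, y / x ^ (g + 1))`. -/
def DoubleCover (g : ℕ) (f : k[X]) (hf : f.natDegree ≤ 2 * g + 2) : Scheme.{u} :=
  pushout (Spec.map (CommRingCat.ofHom (coverGlue₀ f)))
    (Spec.map (CommRingCat.ofHom (coverGlue₁ g f hf)))

/-- The chart `y² = f(x)`. -/
def DoubleCover.ι₀ (g : ℕ) (f : k[X]) (hf : f.natDegree ≤ 2 * g + 2) :
    Spec (.of (ChartRing f)) ⟶ DoubleCover g f hf := pushout.inl _ _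

/-- The chart at infinity. -/
def DoubleCover.ι₁ (g : ℕ) (f : k[X]) (hf : f.natDegree ≤ 2 * g + 2) :
    Spec (.of (ChartRing (flipPoly g f))) ⟶ DoubleCover g f hf := pushout.inr _ _

/-- The map `k[x, 1/x] → k[x, y, 1/x] / (y² - f(x))`. -/
def overlapProj (f : k[X]) : LaurentPolynomial k →+* OverlapRing f :=
  IsLocalization.Away.lift (X : k[X])
    (g := (coverGlue₀ f).comp (AdjoinRoot.of (X ^ 2 - C f : k[X][X])))
    (IsUnit.of_mul_eq_one _ (x_mul_xInv f))

lemma overlapProj_comp_lineGlue₀ (f : k[X]) :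
    (overlapProj f).comp (lineGlue₀ k) = (coverGlue₀ f).comp (AdjoinRoot.of _) :=
  IsLocalization.Away.lift_comp _ _

lemma overlapProj_comp_lineGlue₁ (g : ℕ) (f : k[X]) (hf : f.natDegree ≤ 2 * g + 2) :
    (overlapProj f).comp (lineGlue₁ k) = (coverGlue₁ g f hf).comp (AdjoinRoot.of _) := by
  have hX : overlapProj f (LaurentPolynomial.T 1) = algebraMap _ _ (xFun f) := by
    have := congrArg (fun φ : k[X] →+* OverlapRing f => φ X) (overlapProj_comp_lineGlue₀ f)
    simpa [lineGlue₀, coverGlue₀, xFun] using this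
  have hC (a : k) : overlapProj f (LaurentPolynomial.C a) = algebraMap k _ a := by
    have := congrArg (fun φ : k[X] →+* OverlapRing f => φ (C a)) (overlapProj_comp_lineGlue₀ f)
    simp only [RingHom.comp_apply, lineGlue₀, LaurentPolynomial.algebraMap_eq_toLaurent,
      Polynomial.toLaurent_C] at this
    exact this
  refine Polynomial.ringHom_ext (fun a => ?_) ?_
  · have h1 : lineGlue₁ k (C a) = LaurentPolynomial.C a := by simp [lineGlue₁, lineGlue₀]
    rw [RingHom.comp_apply, h1, hC]
    exact (chartLift_algebraMap _ _ _ (flip_relation g f hf) a).symm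
  · have h1 : lineGlue₁ k X = LaurentPolynomial.T (-1) := by simp [lineGlue₁, lineGlue₀]
    have h2 : coverGlue₁ g f hf (AdjoinRoot.of _ X) = xInv f := chartLift_x ..
    rw [RingHom.comp_apply, h1, RingHom.comp_apply, h2]
    have h3 : overlapProj f (LaurentPolynomial.T 1) * overlapProj f (LaurentPolynomial.T (-1)) =
        1 := by
      rw [← map_mul, ← LaurentPolynomial.T_add]
      simp
    rw [hX] at h3
    have hu : IsUnit (algebraMap _ (OverlapRing f) (xFun f)) :=
      IsUnit.of_mul_eq_one _ (x_mul_xInv f)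
    exact hu.mul_left_cancel (h3.trans (x_mul_xInv f).symm)

/-- The double cover `(x, y) ↦ x` of the projective line. -/
def DoubleCover.toP1 (g : ℕ) (f : k[X]) (hf : f.natDegree ≤ 2 * g + 2) : DoubleCover g f hf ⟶ P1 k :=
  pushout.map _ _ _ _
    (Spec.map (CommRingCat.ofHom (AdjoinRoot.of (X ^ 2 - C f : k[X][X]))))
    (Spec.map (CommRingCat.ofHom (AdjoinRoot.of (X ^ 2 - C (flipPoly g f) : k[X][X]))))
    (Spec.map (CommRingCat.ofHom (overlapProj f)))
    (by
      rw [← Spec.map_comp, ← Spec.map_comp, ← CommRingCat.ofHom_comp, ← CommRingCat.ofHom_comp,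
        overlapProj_comp_lineGlue₀])
    (by
      rw [← Spec.map_comp, ← Spec.map_comp, ← CommRingCat.ofHom_comp, ← CommRingCat.ofHom_comp,
        overlapProj_comp_lineGlue₁ g f hf])

lemma DoubleCover.ι₀_toP1 (g : ℕ) (f : k[X]) (hf : f.natDegree ≤ 2 * g + 2) :
    DoubleCover.ι₀ g f hf ≫ DoubleCover.toP1 g f hf =
      Spec.map (CommRingCat.ofHom (AdjoinRoot.of (X ^ 2 - C f : k[X][X]))) ≫ P1.ι₀ k :=
  pushout.inl_desc _ _ _

lemma DoubleCover.ι₁_toP1 (g : ℕ) (f : k[X]) (hf : f.natDegree ≤ 2 * g + 2) :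
    DoubleCover.ι₁ g f hf ≫ DoubleCover.toP1 g f hf =
      Spec.map (CommRingCat.ofHom (AdjoinRoot.of (X ^ 2 - C (flipPoly g f) : k[X][X]))) ≫
        P1.ι₁ k :=
  pushout.inr_desc _ _ _

/-- The structure morphism of the curve `y² = f(x)`. -/
def DoubleCover.toSpec (g : ℕ) (f : k[X]) (hf : f.natDegree ≤ 2 * g + 2) :
    DoubleCover g f hf ⟶ Spec (.of k) :=
  DoubleCover.toP1 g f hf ≫ P1.toSpec k

instance (f : k[X]) : IsNoetherianRing (ChartRing f) :=
  inferInstanceAs (IsNoetherianRing (k[X][X] ⧸ _))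

instance (f : k[X]) : Algebra.FiniteType k (ChartRing f) :=
  inferInstanceAs (Algebra.FiniteType k (k[X][X] ⧸ Ideal.span {(X ^ 2 - C f : k[X][X])}))

instance isNoetherian_doubleCover (g : ℕ) (f : k[X]) (hf : f.natDegree ≤ 2 * g + 2) :
    IsNoetherian (DoubleCover g f hf) := by
  let 𝒰 := Scheme.IsLocallyDirected.openCover (span
    (Spec.map (CommRingCat.ofHom (coverGlue₀ f)))
    (Spec.map (CommRingCat.ofHom (coverGlue₁ g f hf))))
  have hX (i : WalkingSpan) : IsNoetherian ((span
      (Spec.map (CommRingCat.ofHom (coverGlue₀ f)))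
      (Spec.map (CommRingCat.ofHom (coverGlue₁ g f hf)))).obj i) := by
    obtain (_ | _ | _) := i
    · exact inferInstanceAs (IsNoetherian (Spec (.of (OverlapRing f))))
    · exact inferInstanceAs (IsNoetherian (Spec (.of (ChartRing f))))
    · exact inferInstanceAs (IsNoetherian (Spec (.of (ChartRing (flipPoly g f)))))
  have hX' (i : 𝒰.I₀) : IsNoetherian (𝒰.X i) := hX i
  have : Finite 𝒰.I₀ := inferInstanceAs (Finite WalkingSpan)
  have h1 : IsLocallyNoetherian (DoubleCover g f hf) :=
    (isLocallyNoetherian_iff_openCover 𝒰).mpr fun i => inferInstance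
  have h2 : CompactSpace (DoubleCover g f hf) := 𝒰.compactSpace
  exact { h1, h2 with }

instance locallyOfFiniteType_toSpec (g : ℕ) (f : k[X]) (hf : f.natDegree ≤ 2 * g + 2) :
    LocallyOfFiniteType (DoubleCover.toSpec g f hf) := by
  have h0 : LocallyOfFiniteType (DoubleCover.ι₀ g f hf ≫ DoubleCover.toSpec g f hf) := by
    rw [DoubleCover.toSpec, ← Category.assoc, DoubleCover.ι₀_toP1, Category.assoc, P1.ι₀_toSpec,
      ← Spec.map_comp]
    refine (HasRingHomProperty.Spec_iff (P := @LocallyOfFiniteType)).mpr ?_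
    exact RingHom.finiteType_algebraMap.mpr (inferInstance : Algebra.FiniteType k (ChartRing f))
  have h1 : LocallyOfFiniteType (DoubleCover.ι₁ g f hf ≫ DoubleCover.toSpec g f hf) := by
    rw [DoubleCover.toSpec, ← Category.assoc, DoubleCover.ι₁_toP1, Category.assoc, P1.ι₁_toSpec,
      ← Spec.map_comp]
    refine (HasRingHomProperty.Spec_iff (P := @LocallyOfFiniteType)).mpr ?_
    exact RingHom.finiteType_algebraMap.mpr
      (inferInstance : Algebra.FiniteType k (ChartRing (flipPoly g f)))
  let z : Spec (.of (OverlapRing f)) ⟶ DoubleCover g f hf :=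
    colimit.ι (span (Spec.map (CommRingCat.ofHom (coverGlue₀ f)))
      (Spec.map (CommRingCat.ofHom (coverGlue₁ g f hf)))) WalkingSpan.zero
  have hz : z = Spec.map (CommRingCat.ofHom (coverGlue₀ f)) ≫ DoubleCover.ι₀ g f hf :=
    (colimit.w (span (Spec.map (CommRingCat.ofHom (coverGlue₀ f)))
      (Spec.map (CommRingCat.ofHom (coverGlue₁ g f hf)))) WalkingSpan.Hom.fst).symm
  have h2 : LocallyOfFiniteType (z ≫ DoubleCover.toSpec g f hf) := by
    rw [hz, Category.assoc]
    exact locallyOfFiniteType_comp (Spec.map (CommRingCat.ofHom (coverGlue₀ f)))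
      (DoubleCover.ι₀ g f hf ≫ DoubleCover.toSpec g f hf)
  have hloc : IsZariskiLocalAtSource @LocallyOfFiniteType.{u} :=
    @HasRingHomProperty.instIsZariskiLocalAtSource @LocallyOfFiniteType.{u} RingHom.FiniteType
      inferInstance
  refine (@IsZariskiLocalAtSource.iff_of_openCover @LocallyOfFiniteType.{u} hloc _ _
    (DoubleCover.toSpec g f hf)
    (Scheme.IsLocallyDirected.openCover (span (Spec.map (CommRingCat.ofHom (coverGlue₀ f)))
    (Spec.map (CommRingCat.ofHom (coverGlue₁ g f hf)))))).mpr ?_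
  rintro (_ | _ | _)
  · exact h2
  · exact h0
  · exact h1

instance locallyOfFiniteType_toP1 (g : ℕ) (f : k[X]) (hf : f.natDegree ≤ 2 * g + 2) :
    LocallyOfFiniteType (DoubleCover.toP1 g f hf) :=
  have : LocallyOfFiniteType (DoubleCover.toP1 g f hf ≫ P1.toSpec k) :=
    locallyOfFiniteType_toSpec g f hf
  locallyOfFiniteType_of_comp _ (P1.toSpec k)

end DoubleCover

/-! ### Normalization -/

section Normalization

/-- The generic points of the irreducible components of a scheme. -/
def GenericPoints (X : Scheme.{u}) : Type u :=
  {x : X // closure {x} ∈ irreducibleComponents X}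

/-- The morphism to `X` from the disjoint union of the spectra of the residue fields of the generic
points of the irreducible components of `X`. -/
def fromGenericPoints (X : Scheme.{u}) :
    (∐ fun x : GenericPoints X => Spec (X.residueField x.1)) ⟶ X :=
  Sigma.desc fun x => X.fromSpecResidueField x.1

instance (X : Scheme.{u}) [IsNoetherian X] : Finite (GenericPoints X) := by
  have : Finite (irreducibleComponents X) :=
    TopologicalSpace.NoetherianSpace.finite_irreducibleComponents
  refine Finite.of_injective (β := irreducibleComponents X) (fun x => ⟨_, x.2⟩) fun x y h => ?_
  have h' : closure {x.1} = closure {y.1} := congrArg Subtype.val h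
  exact Subtype.ext (Inseparable.eq (inseparable_iff_closure_eq.mpr h'))

/-- The normalization of a Noetherian scheme: the relative normalization of `X` in the disjoint
union of the spectra of the residue fields of its generic points. -/
def Normalization (X : Scheme.{u}) [IsNoetherian X] : Scheme.{u} :=
  (fromGenericPoints X).normalization

/-- The canonical morphism from the normalization of `X` to `X`. -/
def Normalization.toBase (X : Scheme.{u}) [IsNoetherian X] : Normalization X ⟶ X :=
  (fromGenericPoints X).fromNormalization

end Normalization

/-! ### Plane projective curves -/

section Plane

variable (k : Type u) [Field k]

attribute [local instance] MvPolynomial.gradedAlgebra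

/-- The projective plane over `k`, with homogeneous coordinates `X₀, X₁, X₂`. -/
def P2 : Scheme.{u} :=
  Proj (MvPolynomial.homogeneousSubmodule (Fin 3) k)

/-- The structure morphism of the projective plane. -/
def P2.toSpec : P2 k ⟶ Spec (.of k) :=
  Proj.toSpecZero (MvPolynomial.homogeneousSubmodule (Fin 3) k) ≫
    Spec.map (CommRingCat.ofHom (algebraMap k (MvPolynomial.homogeneousSubmodule (Fin 3) k 0)))

/-- The ring homomorphism `k[X₀, X₁, X₂] → k[Y, Z]` given by `X₀ ↦ Y`, `X₁ ↦ Z`, `X₂ ↦ 1`, as a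
map to the global functions on the affine plane. -/
def planeCoordinates :
    MvPolynomial (Fin 3) k →+* Γ(Spec (.of (MvPolynomial (Fin 2) k)), ⊤) :=
  (Scheme.ΓSpecIso (.of (MvPolynomial (Fin 2) k))).inv.hom.comp
    (MvPolynomial.aeval (R := k) ![MvPolynomial.X 0, MvPolynomial.X 1,
      (1 : MvPolynomial (Fin 2) k)]).toRingHom

lemma map_irrelevant_planeCoordinates :
    (HomogeneousIdeal.irrelevant
      (MvPolynomial.homogeneousSubmodule (Fin 3) k)).toIdeal.map (planeCoordinates k) = ⊤ := by
  rw [Ideal.eq_top_iff_one]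
  have h : planeCoordinates k (MvPolynomial.X 2) = 1 := by
    simp [planeCoordinates]
  rw [← h]
  refine Ideal.mem_map_of_mem _ ?_
  rw [HomogeneousIdeal.mem_iff, HomogeneousIdeal.mem_irrelevant_iff, GradedRing.proj_apply]
  exact DirectSum.decompose_of_mem_ne _ (MvPolynomial.isHomogeneous_X k (2 : Fin 3)) one_ne_zero

/-- The inclusion of the affine plane into the projective plane, `(Y, Z) ↦ (Y : Z : 1)`. -/
def planeInclusion : Spec (.of (MvPolynomial (Fin 2) k)) ⟶ P2 k :=
  Proj.fromOfGlobalSections _ (planeCoordinates k) (map_irrelevant_planeCoordinates k)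

variable {k}

/-- The affine plane curve `f(Y, Z) = 0`. -/
def AffineCurve (f : MvPolynomial (Fin 2) k) : Scheme.{u} :=
  Spec (.of (MvPolynomial (Fin 2) k ⧸ Ideal.span {f}))

/-- The inclusion of the affine curve `f(Y, Z) = 0` into the projective plane. -/
def AffineCurve.toP2 (f : MvPolynomial (Fin 2) k) : AffineCurve f ⟶ P2 k :=
  Spec.map (CommRingCat.ofHom (Ideal.Quotient.mk (Ideal.span {f}))) ≫ planeInclusion k

/-- The projective closure of the affine curve `f(Y, Z) = 0`: the (scheme-theoretic) closure of its
image in the projective plane. -/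
def ProjectiveClosure (f : MvPolynomial (Fin 2) k) : Scheme.{u} :=
  (AffineCurve.toP2 f).image

/-- The structure morphism of the projective closure. -/
def ProjectiveClosure.toSpec (f : MvPolynomial (Fin 2) k) :
    ProjectiveClosure f ⟶ Spec (.of k) :=
  (AffineCurve.toP2 f).imageι ≫ P2.toSpec k

end Plane

/-! ### The curves of the theorem -/

section Howe

variable {k : Type u} [Field k]

/-- The cubic `x (x - a) (x - b)`. -/
def cubic (a b : k) : k[X] := X * (X - C a) * (X - C b)

lemma natDegree_cubic_le (a b : k) : (cubic a b).natDegree ≤ 2 * 1 + 2 := by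
  have : (cubic a b).natDegree ≤ 3 := by
    unfold cubic
    compute_degree
  omega

/-- The genus-one curve `y² = x (x - a) (x - b)`. -/
def E (a b : k) : Scheme.{u} := DoubleCover 1 (cubic a b) (natDegree_cubic_le a b)

/-- The double cover `(x, y) ↦ x`. -/
def E.toP1 (a b : k) : E a b ⟶ P1 k := DoubleCover.toP1 1 (cubic a b) (natDegree_cubic_le a b)

instance (a b : k) : IsNoetherian (E a b) := isNoetherian_doubleCover ..

instance (a b : k) : LocallyOfFiniteType (E.toP1 a b) := locallyOfFiniteType_toP1 ..

/-- The fiber product `E₁ ×_{P¹} E₂` of `y² = x (x - α₂) (x - α₃)` and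
`y² = x (x - β₂) (x - β₃)`. -/
def FiberProduct (α₂ α₃ β₂ β₃ : k) : Scheme.{u} :=
  pullback (E.toP1 α₂ α₃) (E.toP1 β₂ β₃)

/-- The projection of the fiber product to the projective line. -/
def FiberProduct.toP1 (α₂ α₃ β₂ β₃ : k) : FiberProduct α₂ α₃ β₂ β₃ ⟶ P1 k :=
  pullback.fst (E.toP1 α₂ α₃) (E.toP1 β₂ β₃) ≫ E.toP1 α₂ α₃

instance isNoetherian_fiberProduct (α₂ α₃ β₂ β₃ : k) :
    IsNoetherian (FiberProduct α₂ α₃ β₂ β₃) := by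
  have h1 : IsLocallyNoetherian (FiberProduct α₂ α₃ β₂ β₃) :=
    inferInstanceAs (IsLocallyNoetherian (pullback (E.toP1 α₂ α₃) (E.toP1 β₂ β₃)))
  have h2 : CompactSpace (FiberProduct α₂ α₃ β₂ β₃) :=
    inferInstanceAs (CompactSpace ↥(pullback (E.toP1 α₂ α₃) (E.toP1 β₂ β₃)))
  exact { h1, h2 with }

/-- The Howe curve of `E₁` and `E₂`: the normalization of `E₁ ×_{P¹} E₂`. -/
def Curve (α₂ α₃ β₂ β₃ : k) : Scheme.{u} := Normalization (FiberProduct α₂ α₃ β₂ β₃)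

/-- The structure morphism of the Howe curve. -/
def Curve.toSpec (α₂ α₃ β₂ β₃ : k) : Curve α₂ α₃ β₂ β₃ ⟶ Spec (.of k) :=
  Normalization.toBase (FiberProduct α₂ α₃ β₂ β₃) ≫ FiberProduct.toP1 α₂ α₃ β₂ β₃ ≫ P1.toSpec k

/-- The polynomial `x² - (s + W²) x + t` in `x` over `k[Y, Z]`, where `W` is an element of
`k[Y, Z]`. -/
def quadratic (s t : k) (W : MvPolynomial (Fin 2) k) : (MvPolynomial (Fin 2) k)[X] :=
  X ^ 2 - C (MvPolynomial.C s + W ^ 2) * X + C (MvPolynomial.C t)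

/-- The resultant with respect to `x` of `x² - (τ₁ + Y²) x + τ₂` and `x² - (ρ₁ + Z²) x + ρ₂`, where
`Y`, `Z` are the variables `MvPolynomial.X 0`, `MvPolynomial.X 1`. -/
def resultantQuartic (τ₁ τ₂ ρ₁ ρ₂ : k) : MvPolynomial (Fin 2) k :=
  resultant (quadratic τ₁ τ₂ (MvPolynomial.X 0)) (quadratic ρ₁ ρ₂ (MvPolynomial.X 1))

/-- The explicit quartic in `Y = MvPolynomial.X 0` and `Z = MvPolynomial.X 1`. -/
def explicitQuartic (τ₁ τ₂ ρ₁ ρ₂ : k) : MvPolynomial (Fin 2) k :=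
  let Y : MvPolynomial (Fin 2) k := MvPolynomial.X 0
  let Z : MvPolynomial (Fin 2) k := MvPolynomial.X 1
  MvPolynomial.C ρ₂ * Y ^ 4 + MvPolynomial.C (-τ₂ - ρ₂) * Y ^ 2 * Z ^ 2 + MvPolynomial.C τ₂ * Z ^ 4
    + MvPolynomial.C (2 * τ₁ * ρ₂ - τ₂ * ρ₁ - ρ₁ * ρ₂) * Y ^ 2
    + MvPolynomial.C (-(τ₁ * τ₂) - τ₁ * ρ₂ + 2 * τ₂ * ρ₁) * Z ^ 2
    + MvPolynomial.C (τ₁ ^ 2 * ρ₂ - τ₁ * τ₂ * ρ₁ - τ₁ * ρ₁ * ρ₂ + τ₂ ^ 2 + τ₂ * ρ₁ ^ 2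
        - 2 * τ₂ * ρ₂ + ρ₂ ^ 2)

end Howe

end

end HoweCurve

/-! On the fiber product put Y = y₁/x and Z = y₂/x. Then Y² = x - τ₁ + τ₂/x and Z² = x - ρ₁ + ρ₂/x,
so x is a common root of the two quadratics and f vanishes at (Y, Z). Eliminating x or 1/x from
these two equations gives N = (ρ₂ - τ₂) x and D = (ρ₂ - τ₂)/x for the conics N = ρ₂Y² - τ₂Z² + ρ₂τ₁
- τ₂ρ₁ and D = Z² - Y² + ρ₁ - τ₁, and f = (ρ₂ - τ₂)² - N D. Since τ₂ ≠ ρ₂, both x and 1/x are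
polynomials in Y, Z on the curve, and y₁ = xY, y₂ = xZ are recovered as well.

Everything is compared inside the function field K = k(t)(e₁, e₂), where t, e₁, e₂ are the values of
x, y₁, y₂; the structure `Biquadratic` records it. With e₃ = e₁e₂/t, the integral closure of k[t] in
K is the span of 1, e₁, e₂, e₃ over k[t] (`isIntegralElem_iff`): an integral element has integral
conjugates, and the polynomials t p, t q, p q under the roots are squarefree. The values at (e₁/t :
e₂/t : 1) of the homogeneous fractions with denominator D form exactly this ring (`range_evalAway`),
since the products of two coordinates, times t, include t, e₁, e₂, e₃. Hence the closure of this
point in the plane has the spectrum of the integral closure of k[t] as its chart D ≠ 0 and, by the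
symmetry t ↦ 1/t, that of the integral closure of k[1/t] as its chart N ≠ 0. The homogenized
equation shows that these charts cover (`mem_or_mem`).

The fiber product is flat over the line and has only one generic point, with residue field K.
Normalization in a fixed scheme does not change when the base is replaced by one integral over it
(`exists_normalization_comp_iso`), so C is the normalization of the projective line in Spec K, and
so is the closure of the point, whose charts are integrally closed in K. Finally, f generates all
relations between e₁/t and e₂/t (`exists_injective`), so the closure of the point is the projective
closure of f = 0. It is smooth because its charts are Dedekind domains of finite type over an
algebraically closed field: a local parameter gives an étale map to the affine line. -/

namespace HoweCurve

universe u

noncomputable section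

/-! ### The resultant of the two quadratics -/

section Resultant

variable {k : Type u} [Field k]

lemma natDegree_quadratic (s t : k) (W : MvPolynomial (Fin 2) k) :
    (quadratic s t W).natDegree = 2 := by
  unfold quadratic
  compute_degree!

/-- The Sylvester determinant, kept in factored form: for the two quadratics of the theorem it is
(τ₂ - ρ₂)² minus a product of two conics in Y, Z, which is what makes x and 1/x polynomial on the
curve. -/
lemma resultant_quadratic {R : Type*} [CommRing R] (f g : R[X]) (a b c d : R)
    (hf : f = X ^ 2 - C a * X + C b) (hg : g = X ^ 2 - C c * X + C d) :
    resultant f g 2 2 = (b - d) ^ 2 + (a - c) * (a * d - b * c) := by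
  have f0 : f.coeff 0 = b := by simp [hf]
  have f1 : f.coeff 1 = -a := by simp [hf]
  have f2 : f.coeff 2 = 1 := by simp [hf]
  have g0 : g.coeff 0 = d := by simp [hg]
  have g1 : g.coeff 1 = -c := by simp [hg]
  have g2 : g.coeff 2 = 1 := by simp [hg]
  have h : sylvester f g 2 2 = !![d, 0, b, 0; -c, d, -a, b; 1, -c, 1, -a; 0, 1, 0, 1] := by
    ext i j
    fin_cases i <;> fin_cases j <;>
      simp [sylvester, Fin.addCases, f0, f1, f2, g0, g1, g2]
  rw [resultant, h]
  simp [Matrix.det_succ_row_zero, Fin.sum_univ_succ, Fin.succAbove]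
  ring

theorem resultantQuartic_eq (τ₁ τ₂ ρ₁ ρ₂ : k) :
    resultantQuartic τ₁ τ₂ ρ₁ ρ₂ = explicitQuartic τ₁ τ₂ ρ₁ ρ₂ := by
  rw [resultantQuartic, natDegree_quadratic, natDegree_quadratic,
    resultant_quadratic (quadratic τ₁ τ₂ _) (quadratic ρ₁ ρ₂ _) _ _ _ _ rfl rfl]
  simp only [explicitQuartic, map_add, map_sub, map_mul, map_neg, map_pow, map_ofNat]
  ring

end Resultant

/-! ### Relative normalization and change of base -/

section Normalization

variable {Y T P : Scheme.{u}} (φ : Y ⟶ T) (h : T ⟶ P) [QuasiCompact φ] [QuasiSeparated φ]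
  [IsIntegralHom h]

/-- Relative normalization in `Y` does not change under replacing the base by an integral scheme
over it. -/
theorem exists_normalization_comp_iso [QuasiCompact (φ ≫ h)] [QuasiSeparated (φ ≫ h)] :
    ∃ e : φ.normalization ≅ (φ ≫ h).normalization,
      e.hom ≫ (φ ≫ h).fromNormalization = φ.fromNormalization ≫ h := by
  -- The normalization maps to every factorization of `Y ⟶ P` whose second map is integral. `T` is
  -- one, which gives `g`; then `g` is integral too, and each of the two normalizations maps to the
  -- other.
  let g : (φ ≫ h).normalization ⟶ T := (φ ≫ h).normalizationDesc φ h rfl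
  have hg : (φ ≫ h).toNormalization ≫ g = φ := by simp [g]
  have hg' : g ≫ h = (φ ≫ h).fromNormalization := by simp [g]
  let a : φ.normalization ⟶ (φ ≫ h).normalization :=
    φ.normalizationDesc (φ ≫ h).toNormalization g hg.symm
  let b : (φ ≫ h).normalization ⟶ φ.normalization :=
    (φ ≫ h).normalizationDesc φ.toNormalization (φ.fromNormalization ≫ h) (by simp)
  have ha : a ≫ g = φ.fromNormalization := by simp [a]
  have ha' : φ.toNormalization ≫ a = (φ ≫ h).toNormalization := by simp [a]
  have hb : b ≫ φ.fromNormalization ≫ h = (φ ≫ h).fromNormalization := by simp [b]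
  have hb' : (φ ≫ h).toNormalization ≫ b = φ.toNormalization := by simp [b]
  have hba : b ≫ a = 𝟙 _ := by
    refine Scheme.Hom.normalization.hom_ext _ _ _ (g ≫ h) ?_ ?_ ?_
    · rw [reassoc_of% hb', ha', Category.comp_id]
    · rw [Category.assoc, reassoc_of% ha, hb]
    · rw [Category.id_comp, hg']
  have hbg : b ≫ φ.fromNormalization = g := by
    rw [← ha, reassoc_of% hba]
  refine ⟨⟨a, b, ?_, hba⟩, ?_⟩
  · refine Scheme.Hom.normalization.hom_ext _ _ _ φ.fromNormalization ?_ ?_ ?_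
    · rw [reassoc_of% ha', hb', Category.comp_id]
    · rw [Category.assoc, hbg, ha]
    · simp
  · rw [← hg', reassoc_of% ha]

/-- A scheme that is integrally closed in `Y` on an affine open cover is its own normalization
in `Y`. -/
theorem isIso_fromNormalization {ι : Type*} (U : ι → T.Opens) (hU : ∀ i, IsAffineOpen (U i))
    (hcov : iSup U = ⊤) (hinj : ∀ i, Function.Injective (φ.app (U i)).hom)
    (hint : ∀ i z, (φ.app (U i)).hom.IsIntegralElem z → z ∈ (φ.app (U i)).hom.range) :
    IsIso φ.fromNormalization := by
  -- Over an affine open the normalization is the spectrum of the integral closure in the sections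
  -- of `Y`, so it suffices that nothing new is integral there.
  refine (IsZariskiLocalAtTarget.iff_of_iSup_eq_top (P := .isomorphisms _) U hcov).mpr fun i ↦ ?_
  refine (isIso_morphismRestrict_iff_isIso_app _ (hU i)).mpr ?_
  rw [φ.fromNormalization_app (hU i)]
  let := (φ.app (U i)).hom.toAlgebra
  have hb : Function.Bijective
      (algebraMap Γ(T, U i) (integralClosure Γ(T, U i) Γ(Y, φ ⁻¹ᵁ U i))) := by
    refine ⟨fun a b hab ↦ hinj i congr($(hab).1), fun z ↦ ?_⟩
    obtain ⟨a, ha⟩ := hint i z.1 z.2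
    exact ⟨a, Subtype.ext ha⟩
  have : IsIso (CommRingCat.ofHom
      (algebraMap Γ(T, U i) (integralClosure Γ(T, U i) Γ(Y, φ ⁻¹ᵁ U i)))) :=
    (ConcreteCategory.isIso_iff_bijective _).mpr hb
  infer_instance

end Normalization

/-! ### Schemes glued from two charts -/

section Glue

variable {Z U V : Scheme.{u}} (f : Z ⟶ U) (g : Z ⟶ V) [IsOpenImmersion f] [IsOpenImmersion g]

instance isOpenImmersion_pushout_inl : IsOpenImmersion (pushout.inl f g) :=
  inferInstanceAs (IsOpenImmersion (colimit.ι (span f g) _))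

instance isOpenImmersion_pushout_inr : IsOpenImmersion (pushout.inr f g) :=
  inferInstanceAs (IsOpenImmersion (colimit.ι (span f g) _))

lemma pushout_jointly_surjective (z : ↥(pushout f g)) :
    (∃ x, pushout.inl f g x = z) ∨ ∃ y, pushout.inr f g y = z := by
  obtain ⟨i, x, hx⟩ := Scheme.IsLocallyDirected.ι_jointly_surjective (span f g) z
  obtain (_ | _ | _) := i
  · left
    refine ⟨f x, ?_⟩
    rw [← hx, ← colimit.w (span f g) WalkingSpan.Hom.fst]
    rfl
  · exact .inl ⟨x, hx⟩
  · exact .inr ⟨x, hx⟩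

lemma pushout_inl_eq_inr_iff (x : U) (y : V) :
    pushout.inl f g x = pushout.inr f g y ↔ ∃ z, f z = x ∧ g z = y := by
  constructor
  · intro h
    obtain ⟨i, a, b, z, hz⟩ := (Scheme.IsLocallyDirected.ι_eq_ι_iff (span f g)
      (i := WalkingSpan.left) (j := WalkingSpan.right)).mp h
    obtain (_ | _ | _) := i
    · obtain rfl := Subsingleton.elim a WalkingSpan.Hom.fst
      obtain rfl := Subsingleton.elim b WalkingSpan.Hom.snd
      exact ⟨z, hz⟩
    -- No arrow joins the two ends of the span, so a common preimage can only come from the vertex.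
    · have b' : WidePushoutShape.Hom _ _ := b
      cases b'
    · have a' : WidePushoutShape.Hom _ _ := a
      cases a'
  · rintro ⟨z, rfl, rfl⟩
    rw [← Scheme.Hom.comp_apply, pushout.condition, Scheme.Hom.comp_apply]

section Charts

/-- If the second chart of `T` meets the preimage of the first chart of `P` only inside the first
chart of `T`, then that preimage is the first chart of `T`. -/
lemma preimage_opensRange_of_charts {T P U₀ U₁ Q₀ Q₁ : Scheme.{u}} (i₀ : U₀ ⟶ T) (i₁ : U₁ ⟶ T)
    (h : T ⟶ P) (q₀ : Q₀ ⟶ P) (q₁ : Q₁ ⟶ P) [IsOpenImmersion i₀] [IsOpenImmersion q₀]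
    (h₀ : U₀ ⟶ Q₀) (h₁ : U₁ ⟶ Q₁) (c₀ : i₀ ≫ h = h₀ ≫ q₀) (c₁ : i₁ ≫ h = h₁ ≫ q₁)
    (hcov : ∀ z : T, (∃ x, i₀ x = z) ∨ ∃ y, i₁ y = z)
    (hle : ∀ y a, q₁ (h₁ y) = q₀ a → ∃ x, i₀ x = i₁ y) :
    h ⁻¹ᵁ q₀.opensRange = i₀.opensRange := by
  ext z
  constructor
  · rintro ⟨a, ha⟩
    obtain hz | ⟨y, rfl⟩ := hcov z
    · exact hz
    · refine hle y a ?_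
      rw [← Scheme.Hom.comp_apply, ← c₁, Scheme.Hom.comp_apply]
      exact ha.symm
  · rintro ⟨x, rfl⟩
    refine ⟨h₀ x, ?_⟩
    rw [← Scheme.Hom.comp_apply, ← c₀, Scheme.Hom.comp_apply]

/-- A property that is local at the target can be checked on two charts. -/
lemma of_charts (W : MorphismProperty Scheme.{u}) [IsZariskiLocalAtTarget W]
    {T P U₀ U₁ Q₀ Q₁ : Scheme.{u}} (i₀ : U₀ ⟶ T) (i₁ : U₁ ⟶ T)
    (h : T ⟶ P) (q₀ : Q₀ ⟶ P) (q₁ : Q₁ ⟶ P) [IsOpenImmersion i₀] [IsOpenImmersion q₀]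
    [IsOpenImmersion i₁] [IsOpenImmersion q₁]
    (h₀ : U₀ ⟶ Q₀) (h₁ : U₁ ⟶ Q₁) (c₀ : i₀ ≫ h = h₀ ≫ q₀) (c₁ : i₁ ≫ h = h₁ ≫ q₁)
    (hP : ∀ z : P, (∃ x, q₀ x = z) ∨ ∃ y, q₁ y = z)
    (r₀ : h ⁻¹ᵁ q₀.opensRange = i₀.opensRange) (r₁ : h ⁻¹ᵁ q₁.opensRange = i₁.opensRange)
    (w₀ : W h₀) (w₁ : W h₁) : W h := by
  have key {U Q : Scheme.{u}} (i : U ⟶ T) (q : Q ⟶ P) [IsOpenImmersion i] [IsOpenImmersion q]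
      (h' : U ⟶ Q) (c : i ≫ h = h' ≫ q) (r : h ⁻¹ᵁ q.opensRange = i.opensRange) (w : W h') :
      W (h ∣_ q.opensRange) := by
    -- Because the preimage of the chart of `P` is exactly the chart of `T`, the map `h'` is the
    -- base change of `h` along `q`.
    refine (W.arrow_mk_iso_iff (morphismRestrictOpensRange h q)).mpr ?_
    have sq := (IsOpenImmersion.isPullback h' i q h c r).flip
    rw [← sq.isoPullback_inv_snd]
    exact MorphismProperty.RespectsIso.precomp W _ _ w
  refine IsZariskiLocalAtTarget.of_iSup_eq_top
    (fun b : Bool ↦ if b then q₀.opensRange else q₁.opensRange) ?_ ?_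
  · rw [eq_top_iff]
    intro z _
    obtain hz | hz := hP z
    · exact TopologicalSpace.Opens.mem_iSup.mpr ⟨true, hz⟩
    · exact TopologicalSpace.Opens.mem_iSup.mpr ⟨false, hz⟩
  · rintro (_ | _)
    · exact key i₁ q₁ h₁ c₁ r₁ w₁
    · exact key i₀ q₀ h₀ c₀ r₀ w₀

end Charts

end Glue

/-! ### The overlap of the two charts of the projective line -/

section ProjectiveLine

variable (k : Type u) [Field k]

instance : IsOpenImmersion (P1.ι₀ k) := isOpenImmersion_pushout_inl _ _

instance : IsOpenImmersion (P1.ι₁ k) := isOpenImmersion_pushout_inr _ _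

lemma P1.jointly_surjective (z : P1 k) : (∃ x, P1.ι₀ k x = z) ∨ ∃ y, P1.ι₁ k y = z :=
  pushout_jointly_surjective _ _ z

lemma lineGlue₀_X : lineGlue₀ k X = LaurentPolynomial.T 1 := by simp [lineGlue₀]

lemma lineGlue₁_X : lineGlue₁ k X = LaurentPolynomial.T (-1) := by simp [lineGlue₁, lineGlue₀]

lemma lineGlue₀_C (a : k) : lineGlue₀ k (C a) = LaurentPolynomial.C a := by simp [lineGlue₀]

lemma lineGlue₁_C (a : k) : lineGlue₁ k (C a) = LaurentPolynomial.C a := by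
  simp [lineGlue₁, lineGlue₀]

/-- Both gluing maps send the coordinate to a unit of k[x, 1/x], so no prime of the overlap contains
it. -/
lemma P1.X_notMem_of_ι₀_eq_ι₁ {a b : Spec (.of k[X])} (h : P1.ι₀ k a = P1.ι₁ k b) :
    X ∉ a.asIdeal ∧ X ∉ b.asIdeal := by
  obtain ⟨z, rfl, rfl⟩ := (pushout_inl_eq_inr_iff _ _ _ _).mp h
  refine ⟨fun hx ↦ z.2.ne_top (Ideal.eq_top_of_isUnit_mem _ (x := lineGlue₀ k X) hx ?_),
    fun hx ↦ z.2.ne_top (Ideal.eq_top_of_isUnit_mem _ (x := lineGlue₁ k X) hx ?_)⟩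
  · rw [lineGlue₀_X]
    exact LaurentPolynomial.isUnit_T 1
  · rw [lineGlue₁_X]
    exact LaurentPolynomial.isUnit_T (-1)

/-- The second gluing map is the localization at the coordinate followed by an automorphism, so the
overlap is the whole locus where the coordinate does not vanish. -/
lemma P1.exists_ι₀_eq_ι₁ {b : Spec (.of k[X])} (h : X ∉ b.asIdeal) :
    ∃ a, P1.ι₀ k a = P1.ι₁ k b := by
  have hr : b ∈ (Spec.map (CommRingCat.ofHom (lineGlue₁ k))).opensRange := by
    have : Spec.map (CommRingCat.ofHom (lineGlue₁ k)) =
        Spec.map ((LaurentPolynomial.invert (R := k)).toRingEquiv.toCommRingCatIso.hom) ≫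
          Spec.map (CommRingCat.ofHom (algebraMap k[X] (LaurentPolynomial k))) := by
      rw [← Spec.map_comp]
      rfl
    obtain ⟨w, hw⟩ : b ∈ Set.range (PrimeSpectrum.comap (algebraMap k[X] (LaurentPolynomial k))) := by
      rw [PrimeSpectrum.localization_away_comap_range (LaurentPolynomial k) (X : k[X])]
      exact h
    simp only [this]
    obtain ⟨v, rfl⟩ := (Spec.map ((LaurentPolynomial.invert
      (R := k)).toRingEquiv.toCommRingCatIso.hom)).surjective w
    exact ⟨v, hw⟩
  obtain ⟨z, rfl⟩ := hr
  exact ⟨_, (pushout_inl_eq_inr_iff _ _ _ _).mpr ⟨z, rfl, rfl⟩⟩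

end ProjectiveLine

lemma isZariskiLocalAtTarget_isIntegralHom : IsZariskiLocalAtTarget @IsIntegralHom.{u} :=
  @HasAffineProperty.instIsZariskiLocalAtTarget @IsIntegralHom.{u} _ IsIntegralHom.hasAffineProperty

lemma isZariskiLocalAtTarget_flat : IsZariskiLocalAtTarget @Flat.{u} :=
  @HasRingHomProperty.instIsZariskiLocalAtTarget @Flat.{u} _ inferInstance

/-! ### The double covers are integral and flat -/

section DoubleCover

variable {k : Type u} [Field k] (g : ℕ) (f : k[X]) (hf : f.natDegree ≤ 2 * g + 2)

instance : IsOpenImmersion (DoubleCover.ι₀ g f hf) := isOpenImmersion_pushout_inl _ _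

instance : IsOpenImmersion (DoubleCover.ι₁ g f hf) := isOpenImmersion_pushout_inr _ _

lemma DoubleCover.jointly_surjective (z : DoubleCover g f hf) :
    (∃ x, DoubleCover.ι₀ g f hf x = z) ∨ ∃ y, DoubleCover.ι₁ g f hf y = z :=
  pushout_jointly_surjective _ _ z

lemma mem_range_coverGlue₀ {a : Spec (.of (ChartRing f))} (h : xFun f ∉ a.asIdeal) :
    ∃ z, Spec.map (CommRingCat.ofHom (coverGlue₀ f)) z = a := by
  have : a ∈ Set.range (PrimeSpectrum.comap (algebraMap (ChartRing f) (OverlapRing f))) := by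
    rw [PrimeSpectrum.localization_away_comap_range (OverlapRing f) (xFun f)]
    exact h
  exact this

lemma mem_range_coverGlue₁ {a : Spec (.of (ChartRing (flipPoly g f)))}
    (h : xFun (flipPoly g f) ∉ a.asIdeal) :
    ∃ z, Spec.map (CommRingCat.ofHom (coverGlue₁ g f hf)) z = a := by
  have e : Spec.map (CommRingCat.ofHom (coverGlue₁ g f hf)) =
      Spec.map ((overlapEquiv g f hf).toCommRingCatIso.hom) ≫
        Spec.map (CommRingCat.ofHom (coverGlue₀ (flipPoly g f))) := by
    rw [← Spec.map_comp]
    congr 1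
    exact CommRingCat.hom_ext (RingHom.ext fun z => (overlapMap_algebraMap g f hf z).symm)
  obtain ⟨w, hw⟩ := mem_range_coverGlue₀ _ h
  obtain ⟨v, rfl⟩ := (Spec.map ((overlapEquiv g f hf).toCommRingCatIso.hom)).surjective w
  exact ⟨v, by rw [e]; exact hw⟩

/-- A point of the chart at infinity that lies over the first chart of the line has nonzero
coordinate, so it already belongs to the glued part. Thus the cover restricts, over a chart of the
line, to an affine curve. -/
lemma DoubleCover.preimage_opensRange_ι₀ :
    DoubleCover.toP1 g f hf ⁻¹ᵁ (P1.ι₀ k).opensRange = (DoubleCover.ι₀ g f hf).opensRange := by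
  refine preimage_opensRange_of_charts _ _ _ _ _ _ _ (DoubleCover.ι₀_toP1 g f hf)
    (DoubleCover.ι₁_toP1 g f hf) (DoubleCover.jointly_surjective g f hf) fun y a h ↦ ?_
  obtain ⟨z, rfl⟩ := mem_range_coverGlue₁ g f hf (a := y) (P1.X_notMem_of_ι₀_eq_ι₁ k h.symm).2
  exact ⟨_, (pushout_inl_eq_inr_iff _ _ _ _).mpr ⟨z, rfl, rfl⟩⟩

lemma DoubleCover.preimage_opensRange_ι₁ :
    DoubleCover.toP1 g f hf ⁻¹ᵁ (P1.ι₁ k).opensRange = (DoubleCover.ι₁ g f hf).opensRange := by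
  refine preimage_opensRange_of_charts _ _ _ _ _ _ _ (DoubleCover.ι₁_toP1 g f hf)
    (DoubleCover.ι₀_toP1 g f hf) (fun z ↦ (DoubleCover.jointly_surjective g f hf z).symm)
    fun y a h ↦ ?_
  obtain ⟨z, rfl⟩ := mem_range_coverGlue₀ f (a := y) (P1.X_notMem_of_ι₀_eq_ι₁ k h).1
  exact ⟨_, ((pushout_inl_eq_inr_iff _ _ _ _).mpr ⟨z, rfl, rfl⟩).symm⟩

lemma monic_X_sq_sub_C {R : Type*} [CommRing R] (a : R) : (X ^ 2 - C a : R[X]).Monic :=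
  monic_X_pow_sub_C a two_ne_zero

/-- The two charts have the same shape, for `f` and for its reversal, so a property that is local on
the target only has to be known for these affine curves. -/
lemma DoubleCover.toP1_of_charts (W : MorphismProperty Scheme.{u}) [IsZariskiLocalAtTarget W]
    (h : ∀ f : k[X], W (Spec.map (CommRingCat.ofHom (AdjoinRoot.of (X ^ 2 - C f : k[X][X]))))) :
    W (DoubleCover.toP1 g f hf) :=
  of_charts W _ _ _ _ _ _ _ (DoubleCover.ι₀_toP1 g f hf) (DoubleCover.ι₁_toP1 g f hf)
    (P1.jointly_surjective k) (DoubleCover.preimage_opensRange_ι₀ g f hf)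
    (DoubleCover.preimage_opensRange_ι₁ g f hf) (h _) (h _)

instance : IsIntegralHom (DoubleCover.toP1 g f hf) := by
  have := isZariskiLocalAtTarget_isIntegralHom.{u}
  refine DoubleCover.toP1_of_charts g f hf @IsIntegralHom.{u} fun f ↦ ?_
  have : Module.Finite k[X] (ChartRing f) := (monic_X_sq_sub_C f).finite_adjoinRoot
  exact IsIntegralHom.SpecMap_iff.mpr (algebraMap_isIntegral_iff.mpr
    (inferInstance : Algebra.IsIntegral k[X] (ChartRing f)))

/-- Each chart is free over the polynomial ring. Flatness is needed for going down, which places the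
generic points of the fiber product over the first chart of the line. -/
instance : Flat (DoubleCover.toP1 g f hf) := by
  have := isZariskiLocalAtTarget_flat.{u}
  refine DoubleCover.toP1_of_charts g f hf @Flat.{u} fun f ↦ ?_
  have : Module.Free k[X] (ChartRing f) := (monic_X_sq_sub_C f).free_adjoinRoot
  exact Flat.SpecMap_iff.mpr (RingHom.flat_algebraMap_iff.mpr
    (inferInstance : Module.Flat k[X] (ChartRing f)))

end DoubleCover

/-! ### Squarefree polynomials and squares in k(x) -/

section Squarefree

variable {k : Type u} [Field k]

lemma exists_isCoprime_mul {R : Type*} [EuclideanDomain R] (r : R) {s : R} (hs : s ≠ 0) :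
    ∃ d r' s' : R, IsCoprime r' s' ∧ r = d * r' ∧ s = d * s' := by
  classical
  have hd : EuclideanDomain.gcd r s ≠ 0 := fun h ↦ hs (EuclideanDomain.gcd_eq_zero_iff.mp h).2
  obtain ⟨r', hr'⟩ := EuclideanDomain.gcd_dvd_left r s
  obtain ⟨s', hs'⟩ := EuclideanDomain.gcd_dvd_right r s
  refine ⟨_, r', s', ⟨EuclideanDomain.gcdA r s, EuclideanDomain.gcdB r s, ?_⟩, hr', hs'⟩
  refine mul_left_cancel₀ hd ?_
  linear_combination -EuclideanDomain.gcdA r s * hr' - EuclideanDomain.gcdB r s * hs' -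
    EuclideanDomain.gcd_eq_gcd_ab r s

/-- After division by the gcd of `r` and `s`, the square of the new denominator divides `G`, so this
denominator is a unit. In other words, if (r/s)² G is a polynomial then so is r/s. -/
lemma dvd_of_sq_mul_eq {G r s h : k[X]} (hG : Squarefree G) (hs : s ≠ 0)
    (e : r ^ 2 * G = h * s ^ 2) : s ∣ r := by
  obtain ⟨d, r', s', hco, rfl, rfl⟩ := exists_isCoprime_mul r hs
  have hd : d ≠ 0 := left_ne_zero_of_mul hs
  have e' : r' ^ 2 * G = h * s' ^ 2 := by
    refine mul_left_cancel₀ (pow_ne_zero 2 hd) ?_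
    linear_combination e
  have : s' * s' ∣ G := by
    rw [← sq]
    exact (hco.pow (m := 2) (n := 2)).symm.dvd_of_dvd_mul_left ⟨h, by rw [e']; ring⟩
  exact mul_dvd_mul_left d ((hG s' this).dvd)

lemma not_isSquare_algebraMap {F : Type*} [Field F] [Algebra k[X] F] [IsFractionRing k[X] F]
    {G : k[X]} (hG : Squarefree G) (hu : ¬ IsUnit G) (b : F) : b ^ 2 ≠ algebraMap k[X] F G := by
  intro hb
  obtain ⟨r, s, hs, rfl⟩ := IsFractionRing.div_surjective (A := k[X]) b
  have hs0 : s ≠ 0 := nonZeroDivisors.ne_zero hs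
  have hs' : algebraMap k[X] F s ≠ 0 := by
    simpa using hs0
  have e : r ^ 2 = G * s ^ 2 := by
    apply IsFractionRing.injective k[X] F
    field_simp at hb
    simpa [mul_comm] using hb
  -- Multiplying r² = G s² by `G` gives the required shape with `h = G ^ 2`. So r/s is a polynomial
  -- `m` with m² = G; then `m` is a unit, and with it `G`.
  obtain ⟨m, rfl⟩ := dvd_of_sq_mul_eq (h := G ^ 2) hG hs0 (by rw [e]; ring)
  have : m * m = G := by
    refine mul_left_cancel₀ (pow_ne_zero 2 hs0) ?_
    linear_combination e
  have hm := hG m this.dvd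
  exact hu (this ▸ hm.mul hm)

end Squarefree

/-! ### Quadratic extensions R[y]/(y² - a) -/

section QuadraticExtension

variable {R S : Type*} [CommRing R] [CommRing S]

lemma root_sq (a : R) :
    AdjoinRoot.root (X ^ 2 - C a : R[X]) ^ 2 = AdjoinRoot.of _ a := by
  have h := AdjoinRoot.eval₂_root (X ^ 2 - C a : R[X])
  simpa [sub_eq_zero] using h

lemma exists_eq_add_mul_root (a : R) (z : AdjoinRoot (X ^ 2 - C a : R[X])) :
    ∃ b c : R, z = AdjoinRoot.of _ b + AdjoinRoot.of _ c * AdjoinRoot.root _ := by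
  induction z using AdjoinRoot.induction_on with
  | ih p =>
    induction p using Polynomial.induction_on with
    | C b => exact ⟨b, 0, by simp⟩
    | add p q hp hq =>
      obtain ⟨b, c, h⟩ := hp
      obtain ⟨b', c', h'⟩ := hq
      exact ⟨b + b', c + c', by rw [map_add, h, h']; simp only [map_add]; ring⟩
    | monomial n b h =>
      obtain ⟨c, d, h⟩ := h
      refine ⟨d * a, c, ?_⟩
      have e : (C b * X ^ (n + 1) : R[X]) = C b * X ^ n * X := by ring
      rw [e, map_mul, h, AdjoinRoot.mk_X, map_mul, ← root_sq]
      ring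

lemma exists_eq_of_biquadratic (a : R) (b : AdjoinRoot (X ^ 2 - C a : R[X]))
    (z : AdjoinRoot (X ^ 2 - C b : (AdjoinRoot (X ^ 2 - C a : R[X]))[X])) :
    ∃ c d e f : R, z = AdjoinRoot.of _ (AdjoinRoot.of _ c) +
      AdjoinRoot.of _ (AdjoinRoot.of _ d) * AdjoinRoot.of _ (AdjoinRoot.root _) +
      AdjoinRoot.of _ (AdjoinRoot.of _ e) * AdjoinRoot.root _ +
      AdjoinRoot.of _ (AdjoinRoot.of _ f) *
        (AdjoinRoot.of _ (AdjoinRoot.root _) * AdjoinRoot.root _) := by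
  obtain ⟨u, v, rfl⟩ := exists_eq_add_mul_root _ z
  obtain ⟨c, d, rfl⟩ := exists_eq_add_mul_root _ u
  obtain ⟨e, f, rfl⟩ := exists_eq_add_mul_root _ v
  refine ⟨c, d, e, f, ?_⟩
  simp only [map_add, map_mul]
  ring

/-- A ring homomorphism out of a quadratic extension. -/
def quadraticLift (a : R) (φ : R →+* S) (s : S) (h : s ^ 2 = φ a) :
    AdjoinRoot (X ^ 2 - C a : R[X]) →+* S :=
  AdjoinRoot.lift φ s (by simp [h])

@[simp] lemma quadraticLift_of (a : R) (φ : R →+* S) (s : S) (h : s ^ 2 = φ a) (r : R) :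
    quadraticLift a φ s h (AdjoinRoot.of _ r) = φ r := by simp [quadraticLift]

@[simp] lemma quadraticLift_root (a : R) (φ : R →+* S) (s : S) (h : s ^ 2 = φ a) :
    quadraticLift a φ s h (AdjoinRoot.root _) = s := by simp [quadraticLift]

end QuadraticExtension

/-- A presentation of the field `K` as the biquadratic extension of the rational function field
`k(t)` generated by square roots `e₁`, `e₂` of `t p(t)` and `t q(t)`. -/
structure Biquadratic (k K : Type*) [Field k] [Field K] [Algebra k K] (p q : k[X]) where
  /-- the variable -/
  t : K
  /-- the square root of `t p(t)` -/
  e₁ : K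
  /-- the square root of `t q(t)` -/
  e₂ : K
  /-- the square root of `p(t) q(t)` -/
  e₃ : K
  transcendental : Transcendental k t
  sq₁ : e₁ ^ 2 = t * aeval t p
  sq₂ : e₂ ^ 2 = t * aeval t q
  mul₁₂ : e₁ * e₂ = t * e₃
  /-- the automorphism that changes the sign of `e₁` -/
  σ₁ : K →ₐ[k] K
  /-- the automorphism that changes the sign of `e₂` -/
  σ₂ : K →ₐ[k] K
  σ₁_t : σ₁ t = t
  σ₁_e₁ : σ₁ e₁ = -e₁
  σ₁_e₂ : σ₁ e₂ = e₂
  σ₂_t : σ₂ t = t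
  σ₂_e₁ : σ₂ e₁ = e₁
  σ₂_e₂ : σ₂ e₂ = -e₂
  span : ∀ z : K, ∃ a ∈ IntermediateField.adjoin k {t}, ∃ b ∈ IntermediateField.adjoin k {t},
    ∃ c ∈ IntermediateField.adjoin k {t}, ∃ d ∈ IntermediateField.adjoin k {t},
      z = a + b * e₁ + c * e₂ + d * e₃

/-! ### Construction of the function field -/

section Existence

variable {k : Type u} [Field k]

/-- Two square roots are adjoined to k(t), one after the other. The second step is again a field
extension: conjugation shows that a square root a + b e₁ of t q would have a = 0 or b = 0, which
would make p q or t q a square in k(t). -/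
theorem exists_biquadratic (h2 : (2 : k) ≠ 0) (p q : k[X]) (hp : Squarefree (X * p))
    (hq : Squarefree (X * q)) (hpq : Squarefree (p * q)) (hu : ¬ IsUnit (p * q)) :
    ∃ (K : Type u) (_ : Field K) (_ : Algebra k K), Nonempty (Biquadratic k K p q) := by
  let F := RatFunc k
  let P : F := algebraMap k[X] F (X * p)
  let Q : F := algebraMap k[X] F (X * q)
  have hX : ∀ r : k[X], ¬ IsUnit (X * r) := fun r h ↦ not_isUnit_X (isUnit_of_mul_isUnit_left h)
  have h2F : (2 : F) ≠ 0 := by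
    have := (map_ne_zero (algebraMap k F)).mpr h2
    rwa [map_ofNat] at this
  let K₁ := AdjoinRoot (X ^ 2 - C P : F[X])
  have i₁ : Fact (Irreducible (X ^ 2 - C P : F[X])) :=
    ⟨X_pow_sub_C_irreducible_of_prime Nat.prime_two (not_isSquare_algebraMap hp (hX p))⟩
  let r₁ : K₁ := AdjoinRoot.root _
  have hr₁ : r₁ ^ 2 = AdjoinRoot.of _ P := root_sq P
  have hP : P ≠ 0 := by
    simpa [P] using right_ne_zero_of_mul hp.ne_zero
  have h2K₁ : (2 : K₁) ≠ 0 := by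
    have := (map_ne_zero (AdjoinRoot.of (X ^ 2 - C P : F[X]))).mpr h2F
    rwa [map_ofNat] at this
  have hr₁0 : r₁ ≠ 0 := by
    rintro h
    rw [h, zero_pow two_ne_zero] at hr₁
    exact hP ((map_eq_zero _).mp hr₁.symm)
  let s₁ : K₁ →+* K₁ := quadraticLift P (AdjoinRoot.of _) (-r₁) (by rw [neg_sq, hr₁])
  have hs₁ : s₁ r₁ = -r₁ := quadraticLift_root ..
  have hs₁' (a : F) : s₁ (AdjoinRoot.of _ a) = AdjoinRoot.of _ a := quadraticLift_of ..
  have hQ : ∀ b : K₁, b ^ 2 ≠ AdjoinRoot.of _ Q := by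
    intro z hz
    obtain ⟨a, b, rfl⟩ := exists_eq_add_mul_root P z
    change (AdjoinRoot.of _ a + AdjoinRoot.of _ b * r₁) ^ 2 = _ at hz
    have hz' := congrArg s₁ hz
    rw [map_pow, map_add, map_mul, hs₁', hs₁', hs₁', hs₁] at hz'
    -- Subtracting the conjugate equation leaves 4 a b r₁ = 0, which is where 2 ≠ 0 enters.
    have h0 : (AdjoinRoot.of (X ^ 2 - C P : F[X])) a * (AdjoinRoot.of _ b) = 0 := by
      have : (2 : K₁) * 2 * r₁ * ((AdjoinRoot.of _ a) * (AdjoinRoot.of _ b)) = 0 := by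
        linear_combination hz - hz'
      exact (mul_eq_zero.mp this).resolve_left (mul_ne_zero (mul_ne_zero h2K₁ h2K₁) hr₁0)
    rcases mul_eq_zero.mp h0 with h | h
    · rw [h, zero_add, mul_pow, hr₁, ← map_pow, ← map_mul] at hz
      have hz2 : b ^ 2 * P = Q := (AdjoinRoot.of (X ^ 2 - C P : F[X])).injective hz
      -- From b² t p = t q follows (b p)² = p q.
      refine not_isSquare_algebraMap (F := F) hpq hu (b * algebraMap k[X] F p) ?_
      have hx : algebraMap k[X] F X ≠ 0 := by simp
      refine mul_left_cancel₀ hx ?_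
      simp only [P, Q, map_mul] at hz2 ⊢
      linear_combination algebraMap k[X] F p * hz2
    · rw [h, zero_mul, add_zero, ← map_pow] at hz
      exact not_isSquare_algebraMap hq (hX q) a ((AdjoinRoot.of (X ^ 2 - C P : F[X])).injective hz)
  let K := AdjoinRoot (X ^ 2 - C (AdjoinRoot.of _ Q) : K₁[X])
  have i₂ : Fact (Irreducible (X ^ 2 - C (AdjoinRoot.of _ Q) : K₁[X])) :=
    ⟨X_pow_sub_C_irreducible_of_prime Nat.prime_two hQ⟩
  let j : F →+* K := (AdjoinRoot.of _).comp (AdjoinRoot.of _)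
  let e₁ : K := AdjoinRoot.of _ r₁
  let e₂ : K := AdjoinRoot.root _
  have he₁ : e₁ ^ 2 = j P := by
    rw [← map_pow, hr₁]; rfl
  have he₂ : e₂ ^ 2 = j Q := root_sq _
  let s₂ : K →+* K := quadraticLift _ (AdjoinRoot.of _) (-e₂) (by rw [neg_sq, he₂]; rfl)
  let s₁' : K →+* K := quadraticLift _ ((AdjoinRoot.of _).comp s₁) e₂
    (he₂.trans (congrArg (AdjoinRoot.of _) (hs₁' Q)).symm)
  have hs₂j (a : F) : s₂ (j a) = j a := quadraticLift_of ..
  have hs₁j (a : F) : s₁' (j a) = j a := by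
    refine (quadraticLift_of _ _ _ _ _).trans ?_
    rw [RingHom.comp_apply, hs₁']
    rfl
  have hs₁e₁ : s₁' e₁ = -e₁ := by
    have h₁ : s₁' e₁ = AdjoinRoot.of _ (s₁ r₁) := quadraticLift_of _ _ _ _ _
    rw [h₁, hs₁, map_neg]
  have hs₁e₂ : s₁' e₂ = e₂ := quadraticLift_root _ _ _ _
  have hs₂e₁ : s₂ e₁ = e₁ := quadraticLift_of _ _ _ _ _
  have hs₂e₂ : s₂ e₂ = -e₂ := quadraticLift_root _ _ _ _
  let t : K := j (algebraMap k[X] F X)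
  have ht0 : t ≠ 0 := by simp [t]
  have hj (r : k[X]) : j (algebraMap k[X] F r) = aeval t r := by
    have : j.comp (algebraMap k[X] F) = (aeval t : k[X] →ₐ[k] K).toRingHom := by
      refine Polynomial.ringHom_ext (fun a ↦ ?_) ?_
      · simp only [RingHom.comp_apply, AlgHom.toRingHom_eq_coe, RingHom.coe_coe, aeval_C]
        change j (algebraMap k[X] F (algebraMap k k[X] a)) = _
        rw [← IsScalarTower.algebraMap_apply k k[X] F]
        rfl
      · simp [t]
    exact congr($this r)
  have hjmem (a : F) : j a ∈ IntermediateField.adjoin k {t} := by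
    obtain ⟨r, s, -, rfl⟩ := IsFractionRing.div_surjective (A := k[X]) a
    rw [map_div₀, hj, hj]
    exact (IntermediateField.mem_adjoin_simple_iff k _).mpr ⟨r, s, rfl⟩
  refine ⟨K, inferInstance, inferInstance, ⟨{
    t := t
    e₁ := e₁
    e₂ := e₂
    e₃ := e₁ * e₂ / t
    transcendental := ?_
    sq₁ := he₁.trans (by rw [← hj p, ← map_mul, ← map_mul])
    sq₂ := he₂.trans (by rw [← hj q, ← map_mul, ← map_mul])
    mul₁₂ := (mul_div_cancel₀ _ ht0).symm
    σ₁ := { s₁' with commutes' := fun r ↦ hs₁j (algebraMap k F r) }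
    σ₂ := { s₂ with commutes' := fun r ↦ hs₂j (algebraMap k F r) }
    σ₁_t := hs₁j _
    σ₁_e₁ := hs₁e₁
    σ₁_e₂ := hs₁e₂
    σ₂_t := hs₂j _
    σ₂_e₁ := hs₂e₁
    σ₂_e₂ := hs₂e₂
    span := ?_ }⟩⟩
  · rw [transcendental_iff]
    intro r hr
    rw [← hj, map_eq_zero] at hr
    simpa using hr
  · intro z
    obtain ⟨a, b, c, d, hz⟩ := exists_eq_of_biquadratic _ _ z
    -- The coefficient of e₁e₂ acquires a factor t because e₃ = e₁e₂/t.
    refine ⟨j a, hjmem a, j b, hjmem b, j c, hjmem c, j (d * algebraMap k[X] F X), hjmem _, ?_⟩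
    have h₃ : j (d * algebraMap k[X] F X) * (e₁ * e₂ / t) = j d * (e₁ * e₂) := by
      rw [map_mul, mul_assoc]
      exact congrArg _ (mul_div_cancel₀ _ ht0)
    rw [h₃]
    exact hz

end Existence

lemma four_ne_zero_of_two_ne_zero {k : Type*} (K : Type*) [Field k] [Field K] [Algebra k K]
    (h2 : (2 : k) ≠ 0) : (4 : K) ≠ 0 := by
  have := (map_ne_zero (algebraMap k K)).mpr (mul_ne_zero h2 h2)
  rw [map_mul, map_ofNat] at this
  convert! this using 1
  norm_num

/-! ### Conjugates, and the integral closure of k[t] -/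

namespace Biquadratic

variable {k K : Type*} [Field k] [Field K] [Algebra k K] {p q : k[X]} (h : Biquadratic k K p q)

lemma injective_aeval : Function.Injective (aeval h.t : k[X] →ₐ[k] K) :=
  transcendental_iff_injective.mp h.transcendental

lemma aeval_ne_zero {r : k[X]} (hr : r ≠ 0) : aeval h.t r ≠ 0 := by
  rwa [ne_eq, map_eq_zero_iff _ h.injective_aeval]

lemma t_ne_zero : h.t ≠ 0 := by
  simpa using h.aeval_ne_zero X_ne_zero

lemma sq₃ : h.e₃ ^ 2 = aeval h.t p * aeval h.t q := by
  refine mul_left_cancel₀ (pow_ne_zero 2 h.t_ne_zero) ?_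
  rw [← mul_pow, ← h.mul₁₂, mul_pow, h.sq₁, h.sq₂]
  ring

lemma σ₁_e₃ : h.σ₁ h.e₃ = -h.e₃ := by
  have := congrArg h.σ₁ h.mul₁₂
  rw [map_mul, map_mul, h.σ₁_e₁, h.σ₁_e₂, h.σ₁_t] at this
  refine mul_left_cancel₀ h.t_ne_zero ?_
  linear_combination -this - h.mul₁₂

lemma σ₂_e₃ : h.σ₂ h.e₃ = -h.e₃ := by
  have := congrArg h.σ₂ h.mul₁₂
  rw [map_mul, map_mul, h.σ₂_e₁, h.σ₂_e₂, h.σ₂_t] at this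
  refine mul_left_cancel₀ h.t_ne_zero ?_
  linear_combination -this - h.mul₁₂

lemma σ₁_aeval (r : k[X]) : h.σ₁ (aeval h.t r) = aeval h.t r := by
  rw [← Polynomial.aeval_algHom_apply, h.σ₁_t]

lemma σ₂_aeval (r : k[X]) : h.σ₂ (aeval h.t r) = aeval h.t r := by
  rw [← Polynomial.aeval_algHom_apply, h.σ₂_t]

lemma exists_div {a : K} (ha : a ∈ IntermediateField.adjoin k {h.t}) :
    ∃ r s : k[X], s ≠ 0 ∧ a = aeval h.t r / aeval h.t s := by
  obtain ⟨r, s, rfl⟩ := (IntermediateField.mem_adjoin_simple_iff k a).mp ha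
  -- The denominator may be zero here; the quotient is then 0 by convention and is rewritten as 0/1.
  by_cases hs : s = 0
  · exact ⟨0, 1, one_ne_zero, by simp [hs]⟩
  · exact ⟨r, s, hs, rfl⟩

lemma σ₁_of_mem {a : K} (ha : a ∈ IntermediateField.adjoin k {h.t}) : h.σ₁ a = a := by
  obtain ⟨r, s, -, rfl⟩ := h.exists_div ha
  rw [map_div₀, h.σ₁_aeval, h.σ₁_aeval]

lemma σ₂_of_mem {a : K} (ha : a ∈ IntermediateField.adjoin k {h.t}) : h.σ₂ a = a := by
  obtain ⟨r, s, -, rfl⟩ := h.exists_div ha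
  rw [map_div₀, h.σ₂_aeval, h.σ₂_aeval]

lemma e₁_ne_zero (hp : p ≠ 0) : h.e₁ ≠ 0 := by
  intro h0
  have := h.sq₁
  rw [h0, zero_pow two_ne_zero] at this
  exact mul_ne_zero h.t_ne_zero (h.aeval_ne_zero hp) this.symm

lemma e₂_ne_zero (hq : q ≠ 0) : h.e₂ ≠ 0 := by
  intro h0
  have := h.sq₂
  rw [h0, zero_pow two_ne_zero] at this
  exact mul_ne_zero h.t_ne_zero (h.aeval_ne_zero hq) this.symm

lemma e₃_ne_zero (hp : p ≠ 0) (hq : q ≠ 0) : h.e₃ ≠ 0 := by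
  intro h0
  have := h.sq₃
  rw [h0, zero_pow two_ne_zero] at this
  exact mul_ne_zero (h.aeval_ne_zero hp) (h.aeval_ne_zero hq) this.symm

/-- The components of an element in the basis `1, e₁, e₂, e₃` are combinations of its conjugates. -/
lemma components {a b c d : K} (ha : a ∈ IntermediateField.adjoin k {h.t})
    (hb : b ∈ IntermediateField.adjoin k {h.t}) (hc : c ∈ IntermediateField.adjoin k {h.t})
    (hd : d ∈ IntermediateField.adjoin k {h.t}) (z : K)
    (hz : z = a + b * h.e₁ + c * h.e₂ + d * h.e₃) :
    4 * a = z + h.σ₁ z + h.σ₂ z + h.σ₁ (h.σ₂ z) ∧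
    4 * (b * h.e₁) = z - h.σ₁ z + h.σ₂ z - h.σ₁ (h.σ₂ z) ∧
    4 * (c * h.e₂) = z + h.σ₁ z - h.σ₂ z - h.σ₁ (h.σ₂ z) ∧
    4 * (d * h.e₃) = z - h.σ₁ z - h.σ₂ z + h.σ₁ (h.σ₂ z) := by
  subst hz
  simp only [map_add, map_mul, h.σ₁_of_mem ha, h.σ₁_of_mem hb, h.σ₁_of_mem hc, h.σ₁_of_mem hd,
    h.σ₂_of_mem ha, h.σ₂_of_mem hb, h.σ₂_of_mem hc, h.σ₂_of_mem hd, h.σ₁_e₁, h.σ₁_e₂, h.σ₁_e₃,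
    h.σ₂_e₁, h.σ₂_e₂, h.σ₂_e₃, map_neg]
  refine ⟨?_, ?_, ?_, ?_⟩ <;> ring

/-- Linear independence of 1, e₁, e₂, e₃ over k(t): four times each term is a signed sum of
conjugates of 0. -/
lemma eq_zero_of_combination (h2 : (2 : k) ≠ 0) (hp : p ≠ 0) (hq : q ≠ 0) {a b c d : K}
    (ha : a ∈ IntermediateField.adjoin k {h.t})
    (hb : b ∈ IntermediateField.adjoin k {h.t}) (hc : c ∈ IntermediateField.adjoin k {h.t})
    (hd : d ∈ IntermediateField.adjoin k {h.t})
    (hz : a + b * h.e₁ + c * h.e₂ + d * h.e₃ = 0) : a = 0 ∧ b = 0 ∧ c = 0 ∧ d = 0 := by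
  obtain ⟨h₁, h₂, h₃, h₄⟩ := h.components ha hb hc hd 0 hz.symm
  simpa [four_ne_zero_of_two_ne_zero K h2, h.e₁_ne_zero hp, h.e₂_ne_zero hq, h.e₃_ne_zero hp hq] using
    And.intro h₁ (And.intro h₂ (And.intro h₃ h₄))

lemma aeval_mem (r : k[X]) : aeval h.t r ∈ IntermediateField.adjoin k {h.t} :=
  (IntermediateField.mem_adjoin_simple_iff k _).mpr ⟨r, 1, by simp⟩

/-- Being integral over `k[t]`. -/
lemma mem_range_aeval_of_isIntegralElem {G : k[X]} (hG : Squarefree G) {b : K}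
    (hb : b ∈ IntermediateField.adjoin k {h.t})
    (hi : (aeval h.t : k[X] →ₐ[k] K).toRingHom.IsIntegralElem (b ^ 2 * aeval h.t G)) :
    ∃ r : k[X], b = aeval h.t r := by
  obtain ⟨r, s, hs, rfl⟩ := h.exists_div hb
  let _ : Algebra k[X] K := (aeval h.t : k[X] →ₐ[k] K).toRingHom.toAlgebra
  have : FaithfulSMul k[X] K := (faithfulSMul_iff_algebraMap_injective _ _).mpr h.injective_aeval
  let F := FractionRing k[X]
  let _ : Algebra F K := FractionRing.liftAlgebra k[X] K
  have hs' := h.aeval_ne_zero hs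
  -- `w` is b² G as an element of k(t). It is integral over the integrally closed ring k[t], hence a
  -- polynomial `m`, and r² G = m s² forces `s` to divide `r`.
  let w : F := algebraMap k[X] F (r ^ 2 * G) / algebraMap k[X] F (s ^ 2)
  have hw : algebraMap F K w = (aeval h.t r / aeval h.t s) ^ 2 * aeval h.t G := by
    rw [map_div₀, ← IsScalarTower.algebraMap_apply, ← IsScalarTower.algebraMap_apply]
    change aeval h.t _ / aeval h.t _ = _
    rw [map_mul, map_pow, map_pow]
    ring
  have hiw : IsIntegral k[X] w := by
    refine (isIntegral_algebraMap_iff (algebraMap F K).injective).mp ?_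
    rw [hw]
    exact hi
  obtain ⟨m, hm⟩ := IsIntegrallyClosed.isIntegral_iff.mp hiw
  have e : r ^ 2 * G = m * s ^ 2 := by
    apply IsFractionRing.injective k[X] F
    rw [map_mul _ m, hm, div_mul_cancel₀]
    simpa using hs
  obtain ⟨n, rfl⟩ := dvd_of_sq_mul_eq hG hs e
  exact ⟨n, by rw [map_mul]; field_simp⟩

/-- The integral closure of `k[t]` in `K` is the `k[t]`-span of `1, e₁, e₂, e₃`. -/
theorem isIntegralElem_iff (h2 : (2 : k) ≠ 0) (hp : Squarefree (X * p)) (hq : Squarefree (X * q))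
    (hpq : Squarefree (p * q)) (z : K) :
    (aeval h.t : k[X] →ₐ[k] K).toRingHom.IsIntegralElem z ↔
      ∃ a b c d : k[X], z = aeval h.t a + aeval h.t b * h.e₁ + aeval h.t c * h.e₂ +
        aeval h.t d * h.e₃ := by
  let φ := (aeval h.t : k[X] →ₐ[k] K).toRingHom
  have hφ (r : k[X]) : φ.IsIntegralElem (aeval h.t r) := φ.isIntegralElem_map
  have hsq (e : K) (r : k[X]) (he : e ^ 2 = aeval h.t r) : φ.IsIntegralElem e :=
    ⟨X ^ 2 - C r, monic_X_pow_sub_C r two_ne_zero, by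
      simp only [eval₂_sub, eval₂_X_pow, eval₂_C, he]; exact sub_self _⟩
  constructor
  · intro hz
    obtain ⟨a, ha, b, hb, c, hc, d, hd, e⟩ := h.span z
    obtain ⟨h₁, h₂, h₃, h₄⟩ := h.components ha hb hc hd z e
    -- The automorphisms fix k[t] and so preserve integrality. Each of the four terms of `z` is a
    -- quarter of a signed sum of conjugates of `z`, hence integral.
    have hσ (σ : K →ₐ[k] K) (hσ : σ h.t = h.t) {z : K} (hz : φ.IsIntegralElem z) :
        φ.IsIntegralElem (σ z) := by
      obtain ⟨m, hm, hmz⟩ := hz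
      refine ⟨m, hm, ?_⟩
      have hc : (σ : K →+* K).comp φ = φ := by
        refine Polynomial.ringHom_ext (fun r ↦ ?_) ?_
        · simp [φ]
        · simp [φ, hσ]
      have := congrArg σ hmz
      rw [map_zero] at this
      rw [← this]
      nth_rw 1 [← hc]
      exact (Polynomial.hom_eval₂ m φ (σ : K →+* K) z).symm
    have i₁ := hσ h.σ₁ h.σ₁_t hz
    have i₂ := hσ h.σ₂ h.σ₂_t hz
    have i₃ := hσ h.σ₁ h.σ₁_t i₂
    have h4 : φ.IsIntegralElem (4⁻¹ : K) := by
      have : (4⁻¹ : K) = aeval h.t (C (4⁻¹ : k)) := by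
        rw [aeval_C, map_inv₀, map_ofNat]
      rw [this]
      exact hφ _
    have key {w v : K} (hw : 4 * w = v) (hv : φ.IsIntegralElem v) : φ.IsIntegralElem w := by
      have : w = 4⁻¹ * v := by
        rw [← hw, inv_mul_cancel_left₀ (four_ne_zero_of_two_ne_zero K h2)]
      rw [this]
      exact h4.mul φ hv
    have j₁ := key h₁ (((hz.add φ i₁).add φ i₂).add φ i₃)
    have j₂ := key h₂ (((hz.sub φ i₁).add φ i₂).sub φ i₃)
    have j₃ := key h₃ (((hz.add φ i₁).sub φ i₂).sub φ i₃)
    have j₄ := key h₄ (((hz.sub φ i₁).sub φ i₂).add φ i₃)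
    -- The squares of the four integral terms are a², b² t p, c² t q and d² p q. The factors 1, t p,
    -- t q, p q are squarefree, so the coefficients have no denominators.
    obtain ⟨a, rfl⟩ := h.mem_range_aeval_of_isIntegralElem squarefree_one ha (by
      rw [map_one, mul_one, sq]
      exact j₁.mul φ j₁)
    obtain ⟨b, rfl⟩ := h.mem_range_aeval_of_isIntegralElem hp hb (by
      rw [map_mul, aeval_X, ← h.sq₁, ← mul_pow, sq]
      exact j₂.mul φ j₂)
    obtain ⟨c, rfl⟩ := h.mem_range_aeval_of_isIntegralElem hq hc (by
      rw [map_mul, aeval_X, ← h.sq₂, ← mul_pow, sq]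
      exact j₃.mul φ j₃)
    obtain ⟨d, rfl⟩ := h.mem_range_aeval_of_isIntegralElem hpq hd (by
      rw [map_mul, ← h.sq₃, ← mul_pow, sq]
      exact j₄.mul φ j₄)
    exact ⟨a, b, c, d, e⟩
  · rintro ⟨a, b, c, d, rfl⟩
    have i₁ := hsq h.e₁ (X * p) (by rw [h.sq₁, map_mul, aeval_X])
    have i₂ := hsq h.e₂ (X * q) (by rw [h.sq₂, map_mul, aeval_X])
    have i₃ := hsq h.e₃ (p * q) (by rw [h.sq₃, map_mul])
    exact (((hφ a).add φ ((hφ b).mul φ i₁)).add φ ((hφ c).mul φ i₂)).add φ ((hφ d).mul φ i₃)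

/-- The change of coordinate `t ↦ 1 / t`. -/
def flip (h : Biquadratic k K p q) (p' q' : k[X])
    (hp' : aeval h.t p = h.t ^ 2 * aeval h.t⁻¹ p') (hq' : aeval h.t q = h.t ^ 2 * aeval h.t⁻¹ q') :
    Biquadratic k K p' q' where
  t := h.t⁻¹
  -- From p(t) = t² p'(1/t) follows (e₁/t²)² = (1/t) p'(1/t). The element e₃ takes the same factor,
  -- since e₁e₂/t⁴ = (1/t)(e₃/t²).
  e₁ := h.e₁ / h.t ^ 2
  e₂ := h.e₂ / h.t ^ 2
  e₃ := h.e₃ / h.t ^ 2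
  transcendental := fun ha ↦ h.transcendental (by simpa using ha.inv)
  sq₁ := by
    have := h.t_ne_zero
    rw [div_pow, h.sq₁, hp']
    field_simp
  sq₂ := by
    have := h.t_ne_zero
    rw [div_pow, h.sq₂, hq']
    field_simp
  mul₁₂ := by
    have := h.t_ne_zero
    have := h.mul₁₂
    field_simp
    exact this
  σ₁ := h.σ₁
  σ₂ := h.σ₂
  σ₁_t := by rw [map_inv₀, h.σ₁_t]
  σ₁_e₁ := by rw [map_div₀, map_pow, h.σ₁_t, h.σ₁_e₁, neg_div]
  σ₁_e₂ := by rw [map_div₀, map_pow, h.σ₁_t, h.σ₁_e₂]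
  σ₂_t := by rw [map_inv₀, h.σ₂_t]
  σ₂_e₁ := by rw [map_div₀, map_pow, h.σ₂_t, h.σ₂_e₁]
  σ₂_e₂ := by rw [map_div₀, map_pow, h.σ₂_t, h.σ₂_e₂, neg_div]
  span z := by
    have ht := h.t_ne_zero
    obtain ⟨a, ha, b, hb, c, hc, d, hd, e⟩ := h.span z
    have hE : IntermediateField.adjoin k {h.t⁻¹} = IntermediateField.adjoin k {h.t} := by
      apply le_antisymm <;> rw [IntermediateField.adjoin_simple_le_iff]
      · exact inv_mem (IntermediateField.mem_adjoin_simple_self k _)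
      · simpa using inv_mem (IntermediateField.mem_adjoin_simple_self k h.t⁻¹)
    have htm := pow_mem (IntermediateField.mem_adjoin_simple_self k h.t) 2
    rw [hE]
    refine ⟨a, ha, b * h.t ^ 2, mul_mem hb htm, c * h.t ^ 2, mul_mem hc htm,
      d * h.t ^ 2, mul_mem hd htm, ?_⟩
    rw [e]
    field_simp

end Biquadratic

/-! ### Generic points of a scheme -/

section GenericPoints

lemma eq_of_specializes_genericPoint {X : Scheme.{u}} {x z : X}
    (hz : closure {z} ∈ irreducibleComponents X) (h : x ⤳ z) : x = z := by
  have h1 : closure {z} ⊆ closure {x} := h.closure_subset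
  have h2 : closure {x} ⊆ closure {z} := hz.2 isIrreducible_singleton.closure h1
  exact (inseparable_iff_closure_eq.mpr (h2.antisymm h1)).eq

/-- If a monomorphism `Spec K ⟶ X` hits every generic point of `X`, then it is the morphism from
the generic points. -/
theorem exists_genericPoints_iso {X : Scheme.{u}} [Nonempty X] {K : Type u} [Field K]
    (ψ : Spec (.of K) ⟶ X) [Mono ψ]
    (h : ∀ z : GenericPoints X, z.1 = ψ (IsLocalRing.closedPoint K)) :
    ∃ e : (∐ fun x : GenericPoints X => Spec (X.residueField x.1)) ≅ Spec (.of K),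
      e.hom ≫ ψ = fromGenericPoints X := by
  obtain ⟨z, hz⟩ : ∃ z : X, closure {z} ∈ irreducibleComponents X := by
    obtain ⟨x⟩ := ‹Nonempty X›
    have hx := irreducibleComponent_mem_irreducibleComponents x
    obtain ⟨z, hz⟩ := QuasiSober.sober (isIrreducible_irreducibleComponent (x := x))
      isClosed_irreducibleComponent
    exact ⟨z, by rw [hz.def]; exact hx⟩
  let z₀ : GenericPoints X := ⟨z, hz⟩
  have huniq (w : GenericPoints X) : w = z₀ := Subtype.ext ((h w).trans (h z₀).symm)
  have : Unique (GenericPoints X) := ⟨⟨z₀⟩, huniq⟩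
  obtain ⟨g, hg⟩ : ∃ g : X.residueField z ⟶ .of K,
      Spec.map g ≫ X.fromSpecResidueField z = ψ := by
    have hzψ : z = ψ (IsLocalRing.closedPoint K) := h z₀
    subst hzψ
    exact ⟨_, Scheme.descResidueField_stalkClosedPointTo_fromSpecResidueField K X ψ⟩
  -- `g` is an extension of fields whose map on spectra is a monomorphism. That map is also flat and
  -- surjective, so it is an isomorphism.
  have hm : Mono (Spec.map g) := by
    have : Mono (Spec.map g ≫ X.fromSpecResidueField z) := by rw [hg]; infer_instance
    exact mono_of_mono _ (X.fromSpecResidueField z)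
  have hs : Surjective (Spec.map g) := inferInstance
  have hf : Flat (Spec.map g) := inferInstance
  have hi : IsIso (Spec.map g) := Flat.isIso_of_surjective_of_mono _
  let s := Sigma.ι (fun x : GenericPoints X => Spec (X.residueField x.1)) z₀
  have hs : IsIso s := by
    refine ⟨Sigma.desc fun x ↦ Spec.map (X.residueFieldCongr
      (congrArg Subtype.val (huniq x).symm)).hom, ?_, ?_⟩
    · simp [s]
    · refine Sigma.hom_ext _ _ fun x ↦ ?_
      obtain rfl := huniq x
      simp [s]
  refine ⟨(asIso (Spec.map g ≫ s)).symm, ?_⟩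
  rw [Iso.symm_hom, Iso.inv_comp_eq, asIso_hom, Category.assoc, ← hg]
  congr 1
  exact (show s ≫ fromGenericPoints X = _ by simp [s, fromGenericPoints, z₀]).symm

end GenericPoints

/-! ### The fiber product over the first chart of the line -/

section FiberProduct

variable {k : Type u} [Field k]

instance (a b : k) : IsIntegralHom (E.toP1 a b) :=
  inferInstanceAs (IsIntegralHom (DoubleCover.toP1 1 (cubic a b) (natDegree_cubic_le a b)))

instance (a b : k) : Flat (E.toP1 a b) :=
  inferInstanceAs (Flat (DoubleCover.toP1 1 (cubic a b) (natDegree_cubic_le a b)))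

instance isIntegralHom_fiberProduct_toP1 (α₂ α₃ β₂ β₃ : k) :
    IsIntegralHom (FiberProduct.toP1 α₂ α₃ β₂ β₃) :=
  inferInstanceAs (IsIntegralHom (pullback.fst (E.toP1 α₂ α₃) (E.toP1 β₂ β₃) ≫ E.toP1 α₂ α₃))

instance flat_fiberProduct_toP1 (α₂ α₃ β₂ β₃ : k) :
    Flat (FiberProduct.toP1 α₂ α₃ β₂ β₃) :=
  inferInstanceAs (Flat (pullback.fst (E.toP1 α₂ α₃) (E.toP1 β₂ β₃) ≫ E.toP1 α₂ α₃))

/-- The projection `(x, y) ↦ x` of the affine curve `y² = f(x)`. -/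
abbrev chartProj (f : k[X]) : Spec (.of (ChartRing f)) ⟶ Spec (.of k[X]) :=
  Spec.map (CommRingCat.ofHom (algebraMap k[X] (ChartRing f)))

/-- The affine chart `y² = x (x - a) (x - b)`. -/
def E.ι₀ (a b : k) : Spec (.of (ChartRing (cubic a b))) ⟶ E a b :=
  DoubleCover.ι₀ 1 (cubic a b) (natDegree_cubic_le a b)

instance (a b : k) : IsOpenImmersion (E.ι₀ a b) :=
  inferInstanceAs (IsOpenImmersion (DoubleCover.ι₀ 1 (cubic a b) (natDegree_cubic_le a b)))

/-- The part of the fiber product over the first chart of the projective line. -/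
def FiberProduct.chart (α₂ α₃ β₂ β₃ : k) :
    pullback (chartProj (cubic α₂ α₃)) (chartProj (cubic β₂ β₃)) ⟶ FiberProduct α₂ α₃ β₂ β₃ :=
  pullback.map _ _ _ _ (E.ι₀ α₂ α₃)
    (E.ι₀ β₂ β₃) (P1.ι₀ k)
    (DoubleCover.ι₀_toP1 ..).symm (DoubleCover.ι₀_toP1 ..).symm

instance (α₂ α₃ β₂ β₃ : k) : IsOpenImmersion (FiberProduct.chart α₂ α₃ β₂ β₃) :=
  Scheme.pullback_map_isOpenImmersion (chartProj _) (chartProj _) (E.toP1 α₂ α₃) (E.toP1 β₂ β₃)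
    (E.ι₀ α₂ α₃) (E.ι₀ β₂ β₃) (P1.ι₀ k)
    (DoubleCover.ι₀_toP1 ..).symm (DoubleCover.ι₀_toP1 ..).symm

/-- The fiber product of the affine charts is the locus where both projections lie in these charts,
and each chart is the full preimage of the first chart of the line. -/
lemma FiberProduct.mem_range_chart (α₂ α₃ β₂ β₃ : k) (z : FiberProduct α₂ α₃ β₂ β₃)
    (hz : ∃ a, P1.ι₀ k a = FiberProduct.toP1 α₂ α₃ β₂ β₃ z) :
    ∃ b, FiberProduct.chart α₂ α₃ β₂ β₃ b = z := by
  have h := Scheme.Pullback.range_map (chartProj (cubic α₂ α₃)) (chartProj (cubic β₂ β₃))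
    (E.toP1 α₂ α₃) (E.toP1 β₂ β₃) (E.ι₀ α₂ α₃)
    (E.ι₀ β₂ β₃) (P1.ι₀ k)
    (DoubleCover.ι₀_toP1 ..).symm (DoubleCover.ι₀_toP1 ..).symm
  change z ∈ Set.range (FiberProduct.chart α₂ α₃ β₂ β₃)
  refine h.ge ⟨?_, ?_⟩
  · have h1 := DoubleCover.preimage_opensRange_ι₀ 1 (cubic α₂ α₃) (natDegree_cubic_le α₂ α₃)
    exact h1.le (x := pullback.fst (E.toP1 α₂ α₃) (E.toP1 β₂ β₃) z) hz
  · have h1 := DoubleCover.preimage_opensRange_ι₀ 1 (cubic β₂ β₃) (natDegree_cubic_le β₂ β₃)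
    refine h1.le (x := pullback.snd (E.toP1 α₂ α₃) (E.toP1 β₂ β₃) z) ?_
    obtain ⟨a, ha⟩ := hz
    refine ⟨a, ha.trans ?_⟩
    change (pullback.fst (E.toP1 α₂ α₃) (E.toP1 β₂ β₃) ≫ E.toP1 α₂ α₃) z = _
    rw [pullback.condition]
    rfl

/-- The generic points of the fiber product lie over the first chart of the projective line. -/
lemma FiberProduct.genericPoints_mem_range_chart (α₂ α₃ β₂ β₃ : k)
    (z : GenericPoints (FiberProduct α₂ α₃ β₂ β₃)) :
    ∃ b, FiberProduct.chart α₂ α₃ β₂ β₃ b = z.1 := by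
  apply FiberProduct.mem_range_chart
  obtain h | ⟨b, hb⟩ := P1.jointly_surjective k (FiberProduct.toP1 α₂ α₃ β₂ β₃ z.1)
  · exact h
  -- Going down along the flat map lifts the generic point of the line to a generization of `z`,
  -- which can only be `z`. So `z` lies over the generic point, which belongs to both charts.
  · let η : Spec (.of k[X]) := (⊥ : PrimeSpectrum k[X])
    have hη : η ⤳ b := (PrimeSpectrum.le_iff_specializes _ _).mp bot_le
    have hs : P1.ι₁ k η ⤳ FiberProduct.toP1 α₂ α₃ β₂ β₃ z.1 := by
      rw [← hb]
      exact hη.map (P1.ι₁ k).continuous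
    obtain ⟨w, hw, hw'⟩ := (Flat.generalizingMap (FiberProduct.toP1 α₂ α₃ β₂ β₃)) hs
    obtain rfl := eq_of_specializes_genericPoint z.2 hw
    rw [hw']
    refine P1.exists_ι₀_eq_ι₁ k ?_
    change X ∉ (⊥ : Ideal k[X])
    simp

end FiberProduct

/-! ### The coordinate ring of the fiber product and its field of fractions -/

section Charts

open scoped TensorProduct

variable {k : Type u} [Field k]

lemma cubic_eq (a b : k) : cubic a b = X * ((X - C a) * (X - C b)) := mul_assoc _ _ _

/-- The elements of `R[y] / (y² - a)` have the form `r + s y`. -/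
lemma exists_eq_of_add_of_mul_root {R : Type*} [CommRing R] [Nontrivial R] (a : R)
    (z : AdjoinRoot (X ^ 2 - C a : R[X])) :
    ∃ r s : R, z = AdjoinRoot.of _ r + AdjoinRoot.of _ s * AdjoinRoot.root _ := by
  obtain ⟨g, rfl⟩ := AdjoinRoot.mk_surjective z
  have hd : (g %ₘ (X ^ 2 - C a)).natDegree ≤ 1 := by
    have := natDegree_modByMonic_lt g (monic_X_sq_sub_C a) (by
      intro h
      have := congrArg natDegree h
      simp at this)
    rw [natDegree_X_pow_sub_C] at this
    omega
  obtain ⟨s, r, h⟩ := exists_eq_X_add_C_of_natDegree_le_one hd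
  refine ⟨r, s, ?_⟩
  conv_lhs => rw [← modByMonic_add_div g (X ^ 2 - C a), h]
  rw [map_add, map_mul (AdjoinRoot.mk _) (X ^ 2 - C a), AdjoinRoot.mk_self, zero_mul, add_zero,
    map_add, map_mul, AdjoinRoot.mk_C, AdjoinRoot.mk_C, AdjoinRoot.mk_X, add_comm]

lemma exists_tensor_eq {R : Type*} [CommRing R] [Nontrivial R] (a b : R)
    (z : AdjoinRoot (X ^ 2 - C a : R[X]) ⊗[R] AdjoinRoot (X ^ 2 - C b : R[X])) :
    ∃ c₀ c₁ c₂ c₃ : R, z = c₀ • (1 ⊗ₜ 1) + c₁ • (AdjoinRoot.root _ ⊗ₜ 1) +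
      c₂ • (1 ⊗ₜ AdjoinRoot.root _) + c₃ • (AdjoinRoot.root _ ⊗ₜ AdjoinRoot.root _) := by
  induction z using TensorProduct.induction_on with
  | zero => exact ⟨0, 0, 0, 0, by simp⟩
  | add x y hx hy =>
    obtain ⟨c₀, c₁, c₂, c₃, rfl⟩ := hx
    obtain ⟨d₀, d₁, d₂, d₃, rfl⟩ := hy
    refine ⟨c₀ + d₀, c₁ + d₁, c₂ + d₂, c₃ + d₃, ?_⟩
    simp only [add_smul]
    abel
  | tmul x y =>
    obtain ⟨r, s, rfl⟩ := exists_eq_of_add_of_mul_root a x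
    obtain ⟨r', s', rfl⟩ := exists_eq_of_add_of_mul_root b y
    have h₁ (r : R) : AdjoinRoot.of (X ^ 2 - C a : R[X]) r = r • 1 := Algebra.algebraMap_eq_smul_one r
    have h₂ (r : R) : AdjoinRoot.of (X ^ 2 - C b : R[X]) r = r • 1 := Algebra.algebraMap_eq_smul_one r
    refine ⟨r * r', s * r', r * s', s * s', ?_⟩
    rw [h₁, h₁, h₂, h₂, smul_one_mul, smul_one_mul]
    simp only [TensorProduct.add_tmul, TensorProduct.tmul_add, TensorProduct.smul_tmul_smul]
    abel

namespace Biquadratic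

variable {K : Type u} [Field K] [Algebra k K] {p q : k[X]} (h : Biquadratic k K p q)

lemma exists_common_div (z : K) : ∃ a b c d s : k[X], s ≠ 0 ∧
    z * aeval h.t s = aeval h.t a + aeval h.t b * h.e₁ + aeval h.t c * h.e₂ +
      aeval h.t d * (h.e₁ * h.e₂) := by
  obtain ⟨a, ha, b, hb, c, hc, d, hd, rfl⟩ := h.span z
  obtain ⟨a, a', ha', rfl⟩ := h.exists_div ha
  obtain ⟨b, b', hb', rfl⟩ := h.exists_div hb
  obtain ⟨c, c', hc', rfl⟩ := h.exists_div hc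
  obtain ⟨d, d', hd', rfl⟩ := h.exists_div hd
  -- The common denominator has an extra factor t, which turns e₃ into e₁e₂; this is why the last
  -- numerator carries no `X`.
  refine ⟨a * b' * c' * d' * X, b * a' * c' * d' * X, c * a' * b' * d' * X, d * a' * b' * c',
    a' * b' * c' * d' * X, by simp [ha', hb', hc', hd'], ?_⟩
  have ha'' := h.aeval_ne_zero ha'
  have hb'' := h.aeval_ne_zero hb'
  have hc'' := h.aeval_ne_zero hc'
  have hd'' := h.aeval_ne_zero hd'
  rw [h.mul₁₂]
  simp only [map_mul, aeval_X]
  field_simp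

variable (P Q : k[X]) (hP : P = X * p) (hQ : Q = X * q)

/-- The evaluation of the functions on `y² = x p(x)`. -/
def chartHom₁ : ChartRing P →+* K :=
  chartLift P h.t h.e₁ (by rw [h.sq₁, hP, ← aeval_def, map_mul, aeval_X])

/-- The evaluation of the functions on `y² = x q(x)`. -/
def chartHom₂ : ChartRing Q →+* K :=
  chartLift Q h.t h.e₂ (by rw [h.sq₂, hQ, ← aeval_def, map_mul, aeval_X])

lemma chartHom₁_comp_of : (h.chartHom₁ P hP).comp (AdjoinRoot.of _) =
    (aeval h.t : k[X] →ₐ[k] K).toRingHom :=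
  RingHom.ext fun r ↦ by simp [chartHom₁, chartLift, aeval_def]

lemma chartHom₂_comp_of : (h.chartHom₂ Q hQ).comp (AdjoinRoot.of _) =
    (aeval h.t : k[X] →ₐ[k] K).toRingHom :=
  RingHom.ext fun r ↦ by simp [chartHom₂, chartLift, aeval_def]

/-- The functions on the fiber product of the affine curves `y² = x p(x)` and `y² = x q(x)` over
the affine line form a domain with field of fractions `K`. -/
lemma exists_tensorHom (h2 : (2 : k) ≠ 0) (hp : p ≠ 0) (hq : q ≠ 0) :
    ∃ φ : ChartRing P ⊗[k[X]] ChartRing Q →+* K,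
      φ.comp Algebra.TensorProduct.includeLeftRingHom = h.chartHom₁ P hP ∧
      φ.comp (Algebra.TensorProduct.includeRight : ChartRing Q →ₐ[k[X]] _).toRingHom =
        h.chartHom₂ Q hQ ∧
      Function.Injective φ ∧ ∀ z, ∃ u v, z = φ u / φ v := by
  let _ : Algebra k[X] K := (aeval h.t : k[X] →ₐ[k] K).toRingHom.toAlgebra
  let f₁ : ChartRing P →ₐ[k[X]] K :=
    { h.chartHom₁ P hP with commutes' := fun r ↦ congr($(h.chartHom₁_comp_of P hP) r) }
  let f₂ : ChartRing Q →ₐ[k[X]] K :=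
    { h.chartHom₂ Q hQ with commutes' := fun r ↦ congr($(h.chartHom₂_comp_of Q hQ) r) }
  let φ := Algebra.TensorProduct.productMap f₁ f₂
  have hφ₁ (s) : φ (s ⊗ₜ 1) = h.chartHom₁ P hP s := Algebra.TensorProduct.productMap_left_apply ..
  have hφ₂ (s) : φ (1 ⊗ₜ s) = h.chartHom₂ Q hQ s := Algebra.TensorProduct.productMap_right_apply ..
  have hy₁ : h.chartHom₁ P hP (AdjoinRoot.root _) = h.e₁ := chartLift_y ..
  have hy₂ : h.chartHom₂ Q hQ (AdjoinRoot.root _) = h.e₂ := chartLift_y ..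
  have hφ (c₀ c₁ c₂ c₃ : k[X]) : φ (c₀ • (1 ⊗ₜ 1) + c₁ • (AdjoinRoot.root _ ⊗ₜ 1) +
      c₂ • (1 ⊗ₜ AdjoinRoot.root _) + c₃ • (AdjoinRoot.root _ ⊗ₜ AdjoinRoot.root _)) =
      aeval h.t c₀ + aeval h.t c₁ * h.e₁ + aeval h.t c₂ * h.e₂ +
        aeval h.t c₃ * (h.e₁ * h.e₂) := by
    have h3 : φ (AdjoinRoot.root _ ⊗ₜ AdjoinRoot.root _) = h.e₁ * h.e₂ := by
      rw [← hy₁, ← hy₂]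
      exact Algebra.TensorProduct.productMap_apply_tmul ..
    have h4 (c : k[X]) (w : K) : c • w = aeval h.t c * w := rfl
    simp only [map_add, map_smul, hφ₁, hφ₂, hy₁, hy₂, map_one, h3, h4, mul_one]
  refine ⟨φ.toRingHom, RingHom.ext hφ₁, RingHom.ext hφ₂, ?_, fun z ↦ ?_⟩
  -- As e₁e₂ = t e₃, the coefficients in the basis 1, e₁, e₂, e₃ are c₀, c₁, c₂ and c₃ t;
  -- independence over k(t) makes them vanish.
  · rw [injective_iff_map_eq_zero]
    intro z hz
    obtain ⟨c₀, c₁, c₂, c₃, rfl⟩ := exists_tensor_eq P Q z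
    have hz' := (hφ c₀ c₁ c₂ c₃).symm.trans hz
    rw [h.mul₁₂, ← mul_assoc] at hz'
    obtain ⟨e₀, e₁, e₂, e₃⟩ := h.eq_zero_of_combination h2 hp hq (h.aeval_mem c₀) (h.aeval_mem c₁)
      (h.aeval_mem c₂) (mul_mem (h.aeval_mem c₃) (IntermediateField.mem_adjoin_simple_self k h.t)) hz'
    have hi (r : k[X]) (hr : aeval h.t r = 0) : r = 0 := by
      by_contra h0
      exact h.aeval_ne_zero h0 hr
    have h3 := (mul_eq_zero.mp e₃).resolve_right h.t_ne_zero
    simp [hi _ e₀, hi _ e₁, hi _ e₂, hi _ h3]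
  · obtain ⟨a, b, c, d, s, hs, e⟩ := h.exists_common_div z
    refine ⟨_, algebraMap k[X] _ s, eq_div_of_mul_eq ?_ (Eq.trans ?_ (e.trans (hφ a b c d).symm))⟩
    · exact (φ.commutes s).trans_ne (h.aeval_ne_zero hs)
    · congr 1
      exact φ.commutes s

end Biquadratic

section Point

variable {k : Type u} [Field k] {K : Type u} [Field K] [Algebra k K] {α₂ α₃ β₂ β₃ : k}
  (h : Biquadratic k K ((X - C α₂) * (X - C α₃)) ((X - C β₂) * (X - C β₃)))

/-- The generic point of the fiber product. -/
def FiberProduct.point : Spec (.of K) ⟶ FiberProduct α₂ α₃ β₂ β₃ :=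
  pullback.lift (f := chartProj (cubic α₂ α₃)) (g := chartProj (cubic β₂ β₃))
    (Spec.map (CommRingCat.ofHom (h.chartHom₁ (cubic α₂ α₃) (cubic_eq _ _))))
    (Spec.map (CommRingCat.ofHom (h.chartHom₂ (cubic β₂ β₃) (cubic_eq _ _)))) (by
      rw [← Spec.map_comp, ← Spec.map_comp, ← CommRingCat.ofHom_comp, ← CommRingCat.ofHom_comp,
        AdjoinRoot.algebraMap_eq, AdjoinRoot.algebraMap_eq, h.chartHom₁_comp_of,
        h.chartHom₂_comp_of]) ≫
  FiberProduct.chart α₂ α₃ β₂ β₃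

lemma FiberProduct.point_toP1 : FiberProduct.point h ≫ FiberProduct.toP1 α₂ α₃ β₂ β₃ =
    Spec.map (CommRingCat.ofHom (aeval h.t : k[X] →ₐ[k] K).toRingHom) ≫ P1.ι₀ k := by
  have e : FiberProduct.chart α₂ α₃ β₂ β₃ ≫ FiberProduct.toP1 α₂ α₃ β₂ β₃ =
      pullback.fst _ _ ≫ chartProj (cubic α₂ α₃) ≫ P1.ι₀ k := by
    refine (pullback.lift_fst_assoc _ _ _ _).trans ?_
    rw [Category.assoc]
    exact congrArg _ (DoubleCover.ι₀_toP1 ..)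
  rw [FiberProduct.point, Category.assoc, e, pullback.lift_fst_assoc,
    ← Spec.map_comp_assoc, ← CommRingCat.ofHom_comp, AdjoinRoot.algebraMap_eq,
    h.chartHom₁_comp_of]

/-- The spectrum of the function field is the disjoint union of the generic points. -/
theorem FiberProduct.exists_genericPoints_iso (h2 : (2 : k) ≠ 0) :
    ∃ e : (∐ fun x : GenericPoints (FiberProduct α₂ α₃ β₂ β₃) =>
        Spec ((FiberProduct α₂ α₃ β₂ β₃).residueField x.1)) ≅ Spec (.of K),
      e.hom ≫ FiberProduct.point h = fromGenericPoints (FiberProduct α₂ α₃ β₂ β₃) := by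
  have hne (a b : k) : (X - C a) * (X - C b) ≠ 0 := mul_ne_zero (X_sub_C_ne_zero a) (X_sub_C_ne_zero b)
  obtain ⟨φ, hφ₁, hφ₂, hφi, hφs⟩ := h.exists_tensorHom (cubic α₂ α₃) (cubic β₂ β₃) (cubic_eq _ _)
    (cubic_eq _ _) h2 (hne _ _) (hne _ _)
  let i : pullback (chartProj (cubic α₂ α₃)) (chartProj (cubic β₂ β₃)) ≅
      Spec (.of (ChartRing (cubic α₂ α₃) ⊗[k[X]] ChartRing (cubic β₂ β₃))) :=
    pullbackSpecIso k[X] (ChartRing (cubic α₂ α₃)) (ChartRing (cubic β₂ β₃))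
  let c : Spec (.of (ChartRing (cubic α₂ α₃) ⊗[k[X]] ChartRing (cubic β₂ β₃))) ⟶
    FiberProduct α₂ α₃ β₂ β₃ := i.inv ≫ FiberProduct.chart α₂ α₃ β₂ β₃
  have hpt : FiberProduct.point h = Spec.map (CommRingCat.ofHom φ) ≫ c := by
    refine Eq.trans ?_ (Category.assoc _ _ _)
    refine congrArg (· ≫ FiberProduct.chart α₂ α₃ β₂ β₃) ?_
    apply pullback.hom_ext
    · rw [pullback.lift_fst, ← hφ₁, CommRingCat.ofHom_comp, Spec.map_comp, Category.assoc]
      exact congrArg _ (pullbackSpecIso_inv_fst ..).symm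
    · rw [pullback.lift_snd, ← hφ₂, CommRingCat.ofHom_comp, Spec.map_comp, Category.assoc]
      exact congrArg _ (pullbackSpecIso_inv_snd ..).symm
  -- `K` is the field of fractions of the coordinate ring, and localizations are monomorphisms on
  -- spectra.
  have hm : Mono (Spec.map (CommRingCat.ofHom φ)) := by
    let _ := φ.toAlgebra
    have := (faithfulSMul_iff_algebraMap_injective (ChartRing (cubic α₂ α₃) ⊗[k[X]]
      ChartRing (cubic β₂ β₃)) K).mpr hφi
    have := IsFractionRing.of_field (ChartRing (cubic α₂ α₃) ⊗[k[X]] ChartRing (cubic β₂ β₃)) K hφs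
    have := IsPreimmersion.of_isLocalization (S := K) (nonZeroDivisors
      (ChartRing (cubic α₂ α₃) ⊗[k[X]] ChartRing (cubic β₂ β₃)))
    exact inferInstanceAs (Mono (Spec.map (CommRingCat.ofHom (algebraMap _ K))))
  have : Mono (FiberProduct.point h) := by
    rw [hpt]
    have : Mono c := mono_comp _ _
    exact mono_comp _ _
  have : Nonempty (FiberProduct α₂ α₃ β₂ β₃) :=
    ⟨FiberProduct.point h (IsLocalRing.closedPoint K)⟩
  refine HoweCurve.exists_genericPoints_iso _ fun z ↦ ?_
  obtain ⟨b, hb⟩ := FiberProduct.genericPoints_mem_range_chart α₂ α₃ β₂ β₃ z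
  -- Since `φ` is injective, the point is the zero ideal of the chart and specializes to all its
  -- points, whereas the generic point of a component has no generization but itself.
  refine (eq_of_specializes_genericPoint z.2 ?_).symm
  have hb' : c (i.hom b) = z.1 := by
    rw [← hb]
    exact congr(FiberProduct.chart α₂ α₃ β₂ β₃ ($(i.hom_inv_id) b))
  rw [← hb', hpt]
  refine Specializes.map (x := Spec.map (CommRingCat.ofHom φ) (IsLocalRing.closedPoint K)) ?_
    c.continuous
  refine (PrimeSpectrum.le_iff_specializes _ _).mp ?_
  intro x hx
  have : φ x = 0 := by
    by_contra h0
    exact (IsLocalRing.mem_maximalIdeal _).mp hx (isUnit_iff_ne_zero.mpr h0)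
  rw [(injective_iff_map_eq_zero φ).mp hφi x this]
  exact zero_mem _

end Point

end Charts

/-! ### Gluing morphisms to the projective line -/

section Gluing

/-- Two morphisms on a pair of charts that agree on the overlap glue. -/
lemma exists_glue_of_charts {T Y U₀ U₁ : Scheme.{u}} (i₀ : U₀ ⟶ T) (i₁ : U₁ ⟶ T)
    [IsOpenImmersion i₀] [IsOpenImmersion i₁] (hcov : ∀ z, (∃ x, i₀ x = z) ∨ ∃ x, i₁ x = z)
    (f₀ : U₀ ⟶ Y) (f₁ : U₁ ⟶ Y) (h : pullback.fst i₀ i₁ ≫ f₀ = pullback.snd i₀ i₁ ≫ f₁) :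
    ∃ f : T ⟶ Y, i₀ ≫ f = f₀ ∧ i₁ ≫ f = f₁ := by
  let U (b : Bool) : Scheme.{u} := b.rec U₀ U₁
  let i (b : Bool) : U b ⟶ T := b.rec i₀ i₁
  let f (b : Bool) : U b ⟶ Y := b.rec f₀ f₁
  have hi (b : Bool) : IsOpenImmersion (i b) := by
    cases b <;> assumption
  let 𝒰 : T.OpenCover := Scheme.Cover.mkOfCovers Bool U i (by
    intro z
    rcases hcov z with h | h
    · exact ⟨false, h⟩
    · exact ⟨true, h⟩) hi
  have hself {U : Scheme.{u}} (i : U ⟶ T) [Mono i] (f : U ⟶ Y) :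
      pullback.fst i i ≫ f = pullback.snd i i ≫ f := by
    congr 1
    rw [← cancel_mono i, pullback.condition]
  have hc : ∀ x y : 𝒰.I₀, pullback.fst (𝒰.f x) (𝒰.f y) ≫ f x =
      pullback.snd (𝒰.f x) (𝒰.f y) ≫ f y := by
    rintro (_ | _) (_ | _)
    · exact hself i₀ f₀
    · exact h
    · change pullback.fst i₁ i₀ ≫ f₁ = pullback.snd i₁ i₀ ≫ f₀
      rw [← pullbackSymmetry_hom_comp_snd i₁ i₀, ← pullbackSymmetry_hom_comp_fst i₁ i₀,
        Category.assoc, Category.assoc, h]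
    · exact hself i₁ f₁
  exact ⟨𝒰.glueMorphisms f hc, 𝒰.ι_glueMorphisms f hc false, 𝒰.ι_glueMorphisms f hc true⟩

lemma hom_ext_of_charts {T Y U₀ U₁ : Scheme.{u}} (i₀ : U₀ ⟶ T) (i₁ : U₁ ⟶ T)
    [IsOpenImmersion i₀] [IsOpenImmersion i₁] (hcov : ∀ z, (∃ x, i₀ x = z) ∨ ∃ x, i₁ x = z)
    {f g : T ⟶ Y} (h₀ : i₀ ≫ f = i₀ ≫ g) (h₁ : i₁ ≫ f = i₁ ≫ g) : f = g := by
  let U (b : Bool) : Scheme.{u} := b.rec U₀ U₁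
  let i (b : Bool) : U b ⟶ T := b.rec i₀ i₁
  have hi (b : Bool) : IsOpenImmersion (i b) := by
    cases b <;> assumption
  let 𝒰 : T.OpenCover := Scheme.Cover.mkOfCovers Bool U i (by
    intro z
    rcases hcov z with h | h
    · exact ⟨false, h⟩
    · exact ⟨true, h⟩) hi
  refine 𝒰.hom_ext _ _ ?_
  rintro (_ | _)
  · exact h₀
  · exact h₁

lemma eq_toSpecΓ_comp {Q : Scheme.{u}} {R : CommRingCat.{u}} (f : Q ⟶ Spec R) :
    f = Q.toSpecΓ ≫ Spec.map ((Scheme.ΓSpecIso R).inv ≫ f.appTop) := by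
  rw [Spec.map_comp, ← Scheme.toSpecΓ_naturality_assoc, ← SpecMap_ΓSpecIso_hom, ← Spec.map_comp,
    Iso.inv_hom_id, Spec.map_id, Category.comp_id]

/-- A morphism to the projective line is given by two functions, inverse to each other, on two
charts. It is enough to compare them at a generic point. -/
theorem P1.exists_of_charts {k : Type u} [Field k] {T : Scheme.{u}} {R₀ R₁ K : Type u}
    [CommRing R₀] [CommRing R₁] [Field K] (i₀ : Spec (.of R₀) ⟶ T) (i₁ : Spec (.of R₁) ⟶ T)
    [IsOpenImmersion i₀] [IsOpenImmersion i₁] (hcov : ∀ z, (∃ x, i₀ x = z) ∨ ∃ x, i₁ x = z)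
    (m₀ : R₀ →+* K) (m₁ : R₁ →+* K) (hm₀ : Function.Injective m₀)
    (hm : Spec.map (CommRingCat.ofHom m₀) ≫ i₀ = Spec.map (CommRingCat.ofHom m₁) ≫ i₁)
    (κ₀ : k[X] →+* R₀) (κ₁ : k[X] →+* R₁) (hC : ∀ a, m₀ (κ₀ (C a)) = m₁ (κ₁ (C a)))
    (hX : m₀ (κ₀ X) * m₁ (κ₁ X) = 1) :
    ∃ π : T ⟶ P1 k, i₀ ≫ π = Spec.map (CommRingCat.ofHom κ₀) ≫ P1.ι₀ k ∧
      i₁ ≫ π = Spec.map (CommRingCat.ofHom κ₁) ≫ P1.ι₁ k := by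
  apply exists_glue_of_charts i₀ i₁ hcov
  let Q := pullback i₀ i₁
  let l : Spec (.of K) ⟶ Q := pullback.lift _ _ hm
  have : IsDomain R₀ := hm₀.isDomain
  have : IsReduced Q := isReduced_of_isOpenImmersion (pullback.fst i₀ i₁)
  -- The point Spec K is dense in the first chart, hence in the overlap `Q`, which is open in it. As
  -- `Q` is reduced, functions on `Q` can be compared in `K`.
  have hdom : IsDominant l := by
    have h₀ : IsDominant (l ≫ pullback.fst i₀ i₁) := by
      rw [pullback.lift_fst]
      refine ⟨?_⟩
      exact PrimeSpectrum.denseRange_comap_iff_ker_le_nilRadical _ |>.mpr (by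
        exact ((RingHom.injective_iff_ker_eq_bot m₀).mp hm₀).trans_le bot_le)
    refine ⟨?_⟩
    rw [DenseRange, dense_iff_inter_open]
    rintro O hO ⟨z, hz⟩
    have hO' := (pullback.fst i₀ i₁).isOpenEmbedding.isOpenMap _ hO
    obtain ⟨w, ⟨z', hz', e⟩, p, rfl⟩ := dense_iff_inter_open.mp h₀.denseRange _ hO' ⟨_, z, hz, rfl⟩
    refine ⟨l p, ?_, p, rfl⟩
    have : z' = l p := (pullback.fst i₀ i₁).isOpenEmbedding.injective e
    exact this ▸ hz'
  have hsd := IsSchemeTheoreticallyDominant.of_isDominant l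
  have hinj : Function.Injective l.appTop := l.app_injective ⊤
  let φ₀ : k[X] →+* Γ(Q, ⊤) :=
    ((Scheme.ΓSpecIso (.of R₀)).inv ≫ (pullback.fst i₀ i₁).appTop).hom.comp κ₀
  let φ₁ : k[X] →+* Γ(Q, ⊤) :=
    ((Scheme.ΓSpecIso (.of R₁)).inv ≫ (pullback.snd i₀ i₁).appTop).hom.comp κ₁
  have hφ₀ (r) : l.appTop (φ₀ r) = (Scheme.ΓSpecIso (.of K)).inv (m₀ (κ₀ r)) := by
    have h1 : (pullback.fst i₀ i₁).appTop ≫ l.appTop = (Spec.map (CommRingCat.ofHom m₀)).appTop := by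
      rw [← Scheme.Hom.comp_appTop, pullback.lift_fst]
    have h2 : (Scheme.ΓSpecIso (.of R₀)).inv ≫ (pullback.fst i₀ i₁).appTop ≫ l.appTop =
        CommRingCat.ofHom m₀ ≫ (Scheme.ΓSpecIso (.of K)).inv := by
      rw [h1, Scheme.ΓSpecIso_inv_naturality]
    exact congr($h2 (κ₀ r))
  have hφ₁ (r) : l.appTop (φ₁ r) = (Scheme.ΓSpecIso (.of K)).inv (m₁ (κ₁ r)) := by
    have h1 : (pullback.snd i₀ i₁).appTop ≫ l.appTop = (Spec.map (CommRingCat.ofHom m₁)).appTop := by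
      rw [← Scheme.Hom.comp_appTop, pullback.lift_snd]
    have h2 : (Scheme.ΓSpecIso (.of R₁)).inv ≫ (pullback.snd i₀ i₁).appTop ≫ l.appTop =
        CommRingCat.ofHom m₁ ≫ (Scheme.ΓSpecIso (.of K)).inv := by
      rw [h1, Scheme.ΓSpecIso_inv_naturality]
    exact congr($h2 (κ₁ r))
  have hφC (a) : φ₀ (C a) = φ₁ (C a) := hinj (by rw [hφ₀, hφ₁, hC])
  have hφX : φ₀ X * φ₁ X = 1 := hinj (by
    rw [map_mul, hφ₀, hφ₁, ← map_mul, hX, map_one, map_one])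
  -- The two coordinate functions are inverse to each other on `Q`, so both restrictions factor
  -- through k[x, 1/x], along which the line is glued.
  let ψ : LaurentPolynomial k →+* Γ(Q, ⊤) :=
    IsLocalization.Away.lift (X : k[X]) (g := φ₀) (IsUnit.of_mul_eq_one _ hφX)
  have hψ₀ : ψ.comp (lineGlue₀ k) = φ₀ := IsLocalization.Away.lift_comp _ _
  have hψ₁ : ψ.comp (lineGlue₁ k) = φ₁ := by
    refine Polynomial.ringHom_ext (fun a ↦ ?_) ?_
    · rw [← hφC, ← hψ₀, RingHom.comp_apply, RingHom.comp_apply, lineGlue₁_C, lineGlue₀_C]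
    · refine (IsUnit.of_mul_eq_one _ hφX).mul_left_cancel (Eq.trans ?_ hφX.symm)
      conv_lhs => rw [← hψ₀]
      rw [RingHom.comp_apply, RingHom.comp_apply, ← map_mul, lineGlue₀_X, lineGlue₁_X,
        ← LaurentPolynomial.T_add, add_neg_cancel, LaurentPolynomial.T_zero, map_one]
  have e₀ : pullback.fst i₀ i₁ ≫ Spec.map (CommRingCat.ofHom κ₀) =
      Q.toSpecΓ ≫ Spec.map (CommRingCat.ofHom ψ) ≫ Spec.map (CommRingCat.ofHom (lineGlue₀ k)) := by
    rw [eq_toSpecΓ_comp (pullback.fst i₀ i₁), Category.assoc, ← Spec.map_comp, ← Spec.map_comp,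
      ← CommRingCat.ofHom_comp, hψ₀]
    rfl
  have e₁ : pullback.snd i₀ i₁ ≫ Spec.map (CommRingCat.ofHom κ₁) =
      Q.toSpecΓ ≫ Spec.map (CommRingCat.ofHom ψ) ≫ Spec.map (CommRingCat.ofHom (lineGlue₁ k)) := by
    rw [eq_toSpecΓ_comp (pullback.snd i₀ i₁), Category.assoc, ← Spec.map_comp, ← Spec.map_comp,
      ← CommRingCat.ofHom_comp, hψ₁]
    rfl
  rw [← Category.assoc, ← Category.assoc, e₀, e₁, Category.assoc, Category.assoc, Category.assoc,
    Category.assoc]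
  exact congrArg (fun f ↦ Q.toSpecΓ ≫ Spec.map (CommRingCat.ofHom ψ) ≫ f) pushout.condition

end Gluing

/-! ### The scheme-theoretic image of a point, in a chart -/

section Image

/-- A factorization of a ring homomorphism into a surjective and an injective one is unique. -/
lemma exists_ringEquiv_range {A G K : Type*} [CommRing A] [CommRing G] [CommRing K]
    (s : A →+* G) (hs : Function.Surjective s) (b : G →+* K) (hb : Function.Injective b) :
    ∃ e : G ≃+* (b.comp s).range, (∀ x, (e x : K) = b x) ∧
      ∀ a, e (s a) = (b.comp s).rangeRestrict a := by
  let e : G →+* (b.comp s).range := b.codRestrict _ fun x ↦ by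
    obtain ⟨a, rfl⟩ := hs x
    exact ⟨a, rfl⟩
  refine ⟨RingEquiv.ofBijective e ⟨fun x y h ↦ hb congr(($h : K)), ?_⟩, fun x ↦ rfl, fun a ↦ rfl⟩
  rintro ⟨_, a, rfl⟩
  exact ⟨s a, rfl⟩

/-- The image of a morphism from the spectrum of a field, in a chart. -/
theorem exists_image_chart {P : Scheme.{u}} {A K : Type u} [CommRing A] [Field K]
    (g : Spec (.of K) ⟶ P) [QuasiCompact g] (c : Spec (.of A) ⟶ P) [IsOpenImmersion c]
    (θ : A →+* K) (hg : Spec.map (CommRingCat.ofHom θ) ≫ c = g) :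
    ∃ (i : Spec (.of θ.range) ⟶ g.image) (_ : IsOpenImmersion i),
      i.opensRange = g.imageι ⁻¹ᵁ c.opensRange ∧
      Spec.map (CommRingCat.ofHom θ.range.subtype) ≫ i = g.toImage ∧
      i ≫ g.imageι = Spec.map (CommRingCat.ofHom θ.rangeRestrict) ≫ c := by
  have hU : IsAffineOpen c.opensRange := isAffineOpen_opensRange c
  have hV : IsAffineOpen (g.imageι ⁻¹ᵁ c.opensRange) := hU.preimage _
  have hgV : (⊤ : (Spec (.of K)).Opens) ≤ g.toImage ⁻¹ᵁ g.imageι ⁻¹ᵁ c.opensRange := by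
    intro z _
    change g.imageι (g.toImage z) ∈ c.opensRange
    rw [← Scheme.Hom.comp_apply, g.toImage_imageι, ← hg]
    exact ⟨Spec.map (CommRingCat.ofHom θ) z, rfl⟩
  let ι := IsOpenImmersion.isoOfRangeEq c hU.fromSpec hU.range_fromSpec.symm
  have hι : ι.hom ≫ hU.fromSpec = c := IsOpenImmersion.isoOfRangeEq_hom_fac ..
  let ε : Γ(P, c.opensRange) ⟶ .of A := Spec.preimage ι.hom
  have hε : Spec.map ε ≫ hU.fromSpec = c := by rw [Spec.map_preimage, hι]
  have : IsIso ε := by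
    have : IsIso (Spec.map ε) := by
      rw [Spec.map_preimage]
      infer_instance
    exact (ConcreteCategory.isIso_iff_bijective _).mpr (isIso_SpecMap_iff.mp this)
  let s : Γ(P, c.opensRange) ⟶ Γ(g.image, g.imageι ⁻¹ᵁ c.opensRange) := g.imageι.app c.opensRange
  have h₁ : Spec.map s ≫ hU.fromSpec = hV.fromSpec ≫ g.imageι := by
    rw [← IsAffineOpen.SpecMap_appLE_fromSpec g.imageι hU hV le_rfl, ← Scheme.Hom.app_eq_appLE]
  -- The sections of the image inject into `K`, and they are a quotient of the sections of `P`
  -- because the image is a closed subscheme. Hence they form the range of `θ`.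
  obtain ⟨b, h₂, hb⟩ : ∃ b : Γ(g.image, g.imageι ⁻¹ᵁ c.opensRange) ⟶ .of K,
      Spec.map b ≫ hV.fromSpec = g.toImage ∧ Function.Injective b := by
    refine ⟨g.toImage.appLE _ ⊤ hgV ≫ (Scheme.ΓSpecIso (.of K)).hom, ?_, ?_⟩
    · rw [Spec.map_comp, Category.assoc,
        IsAffineOpen.SpecMap_appLE_fromSpec g.toImage hV (isAffineOpen_top _) hgV,
        IsAffineOpen.fromSpec_top, ← Scheme.isoSpec_Spec_hom, Iso.hom_inv_id_assoc]
    · have : IsIso (homOfLE hgV) := ⟨homOfLE le_top, rfl, rfl⟩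
      exact ((ConcreteCategory.bijective_of_isIso (Scheme.ΓSpecIso (.of K)).hom).injective).comp
        (((ConcreteCategory.bijective_of_isIso
        ((Spec (.of K)).presheaf.map (homOfLE hgV).op)).injective).comp
        (g.toImage_app_injective ⟨_, hU⟩))
  have h₃ : s ≫ b = ε ≫ CommRingCat.ofHom θ := by
    apply Spec.map_injective
    rw [← cancel_mono hU.fromSpec, Spec.map_comp, Spec.map_comp, Category.assoc, Category.assoc, h₁,
      reassoc_of% h₂, g.toImage_imageι]
    exact hg.symm.trans (congrArg (Spec.map (CommRingCat.ofHom θ) ≫ ·) hε.symm)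
  have hs : Function.Surjective s := g.ker.subschemeι_app_surjective ⟨_, hU⟩
  obtain rfl : b.hom.comp ((inv ε ≫ s).hom) = θ := by
    rw [← CommRingCat.hom_comp, Category.assoc, h₃, IsIso.inv_hom_id_assoc, CommRingCat.hom_ofHom]
  obtain ⟨e, he, he'⟩ := exists_ringEquiv_range (inv ε ≫ s).hom (by
    rw [CommRingCat.hom_comp]
    exact hs.comp (ConcreteCategory.bijective_of_isIso (inv ε)).surjective) b.hom hb
  refine ⟨Spec.map e.toCommRingCatIso.hom ≫ hV.fromSpec, inferInstance, ?_, ?_, ?_⟩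
  · rw [Scheme.Hom.opensRange_comp_of_isIso, hV.opensRange_fromSpec]
  · rw [← Spec.map_comp_assoc, ← h₂]
    congr 2
    exact CommRingCat.hom_ext (RingHom.ext he)
  · refine Eq.trans ?_ (congrArg (Spec.map _ ≫ ·) hε)
    rw [Category.assoc, ← h₁, ← Spec.map_comp_assoc, ← Spec.map_comp_assoc]
    congr 2
    refine CommRingCat.hom_ext (RingHom.ext fun a ↦ Eq.trans ?_ (he' (ε a)))
    change e (s a) = e (s (inv ε (ε a)))
    rw [← CommRingCat.comp_apply ε, IsIso.hom_inv_id]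
    rfl

end Image

/-! ### Morphisms to Proj in the chart D₊(d) -/

section ProjCharts

variable {σ A : Type u} [CommRing A] [SetLike σ A] [AddSubgroupClass σ A] (𝒜 : ℕ → σ)
  [GradedRing 𝒜]

/-- Let `f : A →+* B` be a ring homomorphism that defines a morphism to `Proj A`, and let
`ρ : B →+* B'` be such that `ρ (f d)` is a unit. Then the restriction to `Spec B'` is the expected
morphism to the chart `D₊(d)`. -/
theorem Proj.specMap_fromOfGlobalSections {B B' : Type u} [CommRing B] [CommRing B']
    (f : A →+* Γ(Spec (.of B), ⊤)) (hf : (HomogeneousIdeal.irrelevant 𝒜).toIdeal.map f = ⊤)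
    {d : A} {n : ℕ} (hd : d ∈ 𝒜 n) (hn : 0 < n) (ρ : B →+* B')
    (hu : IsUnit ((ρ.comp (Scheme.ΓSpecIso (.of B)).hom.hom).comp f d)) :
    Spec.map (CommRingCat.ofHom ρ) ≫ Proj.fromOfGlobalSections 𝒜 f hf =
      Spec.map (CommRingCat.ofHom ((IsLocalization.Away.lift (S := Localization.Away d) d hu).comp
        (algebraMap (HomogeneousLocalization.Away 𝒜 d) (Localization.Away d)))) ≫
      Proj.awayι 𝒜 d hd hn := by
  let X : Scheme.{u} := Spec (.of B)
  let τ : Γ(X, ⊤) →+* B' := ρ.comp (Scheme.ΓSpecIso (.of B)).hom.hom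
  have hτ : Spec.map (CommRingCat.ofHom τ) = Spec.map (CommRingCat.ofHom ρ) ≫ X.toSpecΓ := by
    rw [← SpecMap_ΓSpecIso_hom, ← Spec.map_comp]
    rfl
  -- `f d` becomes invertible in `B'`, so Spec B' lands in the open set where it does not vanish;
  -- there the morphism to Proj is given by fractions with powers of `d` as denominators.
  have hr : Set.range (Spec.map (CommRingCat.ofHom ρ)) ⊆ Set.range (X.basicOpen (f d)).ι := by
    rw [Scheme.Opens.range_ι, ← X.toSpecΓ_preimage_basicOpen]
    rintro _ ⟨z, rfl⟩
    change X.toSpecΓ (Spec.map (CommRingCat.ofHom ρ) z) ∈ PrimeSpectrum.basicOpen (f d)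
    rw [← Scheme.Hom.comp_apply, ← hτ]
    exact fun h ↦ z.isPrime.ne_top (Ideal.eq_top_of_isUnit_mem _ h hu)
  let l := IsOpenImmersion.lift (X.basicOpen (f d)).ι (Spec.map (CommRingCat.ofHom ρ)) hr
  have hl : l ≫ (X.basicOpen (f d)).ι = Spec.map (CommRingCat.ofHom ρ) :=
    IsOpenImmersion.lift_fac ..
  have h1 : (X.basicOpen (f d)).ι ≫ Proj.fromOfGlobalSections 𝒜 f hf =
      Proj.toBasicOpenOfGlobalSections 𝒜 f rfl hn hd ≫ (Proj.basicOpen 𝒜 d).ι := by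
    rw [← Proj.fromOfGlobalSections_resLE 𝒜 f hf hn hd, Scheme.Hom.resLE_comp_ι]
  let ξ : Localization.Away (f d) →+* B' := IsLocalization.Away.lift (f d) (g := τ) hu
  have h2 : l ≫ (X.isoOfEq (X.toSpecΓ_preimage_basicOpen (f d))).inv ≫
      X.toSpecΓ ∣_ (PrimeSpectrum.basicOpen (f d)) ≫ (basicOpenIsoSpecAway (f d)).hom =
      Spec.map (CommRingCat.ofHom ξ) := by
    rw [← cancel_mono (Spec.map (CommRingCat.ofHom
      (algebraMap Γ(X, ⊤) (Localization.Away (f d)))))]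
    simp only [Category.assoc]
    rw [basicOpenIsoSpecAway_hom_SpecMap]
    refine (congrArg (fun m ↦ l ≫ (X.isoOfEq (X.toSpecΓ_preimage_basicOpen (f d))).inv ≫ m)
      (morphismRestrict_ι X.toSpecΓ _)).trans ?_
    rw [Scheme.isoOfEq_inv_ι_assoc, reassoc_of% hl, ← hτ, ← Spec.map_comp, ← CommRingCat.ofHom_comp]
    congr 2
    exact (IsLocalization.Away.lift_comp _ _).symm
  rw [← hl, Category.assoc, h1, Proj.toBasicOpenOfGlobalSections]
  simp only [Category.assoc]
  rw [reassoc_of% h2, Proj.basicOpenIsoSpec_inv_ι, ← Spec.map_comp_assoc]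
  congr 2
  rw [← CommRingCat.ofHom_comp]
  congr 1
  rw [← RingHom.comp_assoc]
  congr 1
  refine IsLocalization.ringHom_ext (Submonoid.powers d) (RingHom.ext fun a ↦ ?_)
  simp [ξ, τ]

end ProjCharts

/-! ### The closure of the point (e₁/t : e₂/t : 1) -/

section PlaneModel

attribute [local instance] MvPolynomial.gradedAlgebra

namespace Biquadratic

variable {k : Type u} {K : Type u} [Field k] [Field K] [Algebra k K] {p q : k[X]}
  (h : Biquadratic k K p q)

/-- The integral closure of `k[t]`. -/
def order : Subring K :=
  letI : Algebra k[X] K := (aeval h.t : k[X] →ₐ[k] K).toRingHom.toAlgebra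
  (integralClosure k[X] K).toSubring

lemma mem_order {z : K} :
    z ∈ h.order ↔ (aeval h.t : k[X] →ₐ[k] K).toRingHom.IsIntegralElem z := Iff.rfl

lemma aeval_mem_order (r : k[X]) : aeval h.t r ∈ h.order :=
  (aeval h.t : k[X] →ₐ[k] K).toRingHom.isIntegralElem_map

lemma t_mem_order : h.t ∈ h.order := by simpa using h.aeval_mem_order X

lemma algebraMap_mem_order (a : k) : algebraMap k K a ∈ h.order := by
  simpa using h.aeval_mem_order (C a)

lemma mem_order_of_sq {z : K} (hz : z ^ 2 ∈ h.order) : z ∈ h.order :=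
  letI : Algebra k[X] K := (aeval h.t : k[X] →ₐ[k] K).toRingHom.toAlgebra
  IsIntegral.of_pow (R := k[X]) two_pos hz

lemma e₁_mem_order : h.e₁ ∈ h.order := h.mem_order_of_sq (by
  rw [h.sq₁]
  exact mul_mem h.t_mem_order (h.aeval_mem_order _))

lemma e₂_mem_order : h.e₂ ∈ h.order := h.mem_order_of_sq (by
  rw [h.sq₂]
  exact mul_mem h.t_mem_order (h.aeval_mem_order _))

lemma e₃_mem_order : h.e₃ ∈ h.order := h.mem_order_of_sq (by
  rw [h.sq₃]
  exact mul_mem (h.aeval_mem_order _) (h.aeval_mem_order _))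

/-- A subring that contains `k`, `t`, `e₁`, `e₂`, `e₃` contains the integral closure of `k[t]`. -/
lemma order_le (h2 : (2 : k) ≠ 0) (hp : Squarefree (X * p)) (hq : Squarefree (X * q))
    (hpq : Squarefree (p * q)) {S : Subring K} (hk : ∀ a, algebraMap k K a ∈ S) (ht : h.t ∈ S)
    (h₁ : h.e₁ ∈ S) (h₂ : h.e₂ ∈ S) (h₃ : h.e₃ ∈ S) : h.order ≤ S := by
  have ha (r : k[X]) : aeval h.t r ∈ S := by
    rw [aeval_eq_sum_range]
    exact sum_mem fun i _ ↦ by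
      rw [Algebra.smul_def]
      exact mul_mem (hk _) (pow_mem ht _)
  intro z hz
  obtain ⟨a, b, c, d, rfl⟩ := (h.isIntegralElem_iff h2 hp hq hpq z).mp hz
  exact add_mem (add_mem (add_mem (ha _) (mul_mem (ha _) h₁)) (mul_mem (ha _) h₂))
    (mul_mem (ha _) h₃)

/-- The homogeneous coordinates `(e₁ / t : e₂ / t : 1)`. -/
def coords : Fin 3 → K := ![h.e₁ / h.t, h.e₂ / h.t, 1]

/-- Evaluation at the coordinates. -/
def evalCoords : MvPolynomial (Fin 3) k →+* K := (MvPolynomial.aeval h.coords).toRingHom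

/-- The three values are p(t), q(t) and t: each coordinate is an integral element divided by a
square root of t. -/
lemma coords_sq_mem (i : Fin 3) : h.coords i ^ 2 * h.t ∈ h.order := by
  have ht := h.t_ne_zero
  have e (r : K) (x : K) (hx : x ^ 2 = h.t * r) : (x / h.t) ^ 2 * h.t = r := by
    rw [div_pow, hx]
    field_simp
  fin_cases i
  · change (h.e₁ / h.t) ^ 2 * h.t ∈ h.order
    rw [e _ _ h.sq₁]
    exact h.aeval_mem_order _
  · change (h.e₂ / h.t) ^ 2 * h.t ∈ h.order
    rw [e _ _ h.sq₂]
    exact h.aeval_mem_order _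
  · change 1 ^ 2 * h.t ∈ h.order
    rw [one_pow, one_mul]
    exact h.t_mem_order

/-- For a monomial of degree 2n, the square of its value times tⁿ is a product of squares of
coordinates, each times t. So the square is integral, and with it the element. -/
lemma evalCoords_mul_pow_mem {n : ℕ} {a : MvPolynomial (Fin 3) k}
    (ha : a ∈ MvPolynomial.homogeneousSubmodule (Fin 3) k (n • 2)) :
    h.evalCoords a * h.t ^ n ∈ h.order := by
  have e : h.evalCoords a = ∑ d ∈ a.support, algebraMap k K (a.coeff d) *
      ∏ i, h.coords i ^ d i := MvPolynomial.eval₂_eq' _ _ a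
  rw [e, Finset.sum_mul]
  refine sum_mem fun d hd ↦ ?_
  rw [mul_assoc]
  refine mul_mem (h.algebraMap_mem_order _) (h.mem_order_of_sq ?_)
  have hdeg : ∑ i, d i = 2 * n := by
    have := (MvPolynomial.mem_homogeneousSubmodule _ _).mp ha (MvPolynomial.mem_support_iff.mp hd)
    rw [Finsupp.weight_apply, Finsupp.sum_fintype _ _ (by simp)] at this
    simpa [mul_comm] using this
  have e2 : (∏ i, h.coords i ^ d i * h.t ^ (0 * d i)) = ∏ i, h.coords i ^ d i := by simp
  have : ((∏ i, h.coords i ^ d i) * h.t ^ n) ^ 2 = ∏ i, (h.coords i ^ 2 * h.t) ^ d i := by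
    simp only [mul_pow, Finset.prod_mul_distrib, Finset.prod_pow_eq_pow_sum, hdeg]
    rw [← Finset.prod_pow, ← pow_mul, mul_comm n 2]
    congr 1
    exact Finset.prod_congr rfl fun i _ ↦ by rw [← pow_mul, ← pow_mul, mul_comm]
  rw [this]
  exact prod_mem fun i _ ↦ pow_mem (h.coords_sq_mem i) _

section Away

variable {d : MvPolynomial (Fin 3) k} (hu : IsUnit (h.evalCoords d))

/-- Evaluation of homogeneous fractions at the coordinates. -/
def evalAway : HomogeneousLocalization.Away (MvPolynomial.homogeneousSubmodule (Fin 3) k) d →+* K :=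
  (IsLocalization.Away.lift (S := Localization.Away d) d hu).comp
    (algebraMap (HomogeneousLocalization.Away (MvPolynomial.homogeneousSubmodule (Fin 3) k) d)
      (Localization.Away d))

lemma evalAway_mk (hd : d ∈ MvPolynomial.homogeneousSubmodule (Fin 3) k 2) (n : ℕ)
    (a : MvPolynomial (Fin 3) k)
    (ha : a ∈ MvPolynomial.homogeneousSubmodule (Fin 3) k (n • 2)) :
    h.evalAway hu (HomogeneousLocalization.Away.mk _ hd n a ha) =
      h.evalCoords a / h.evalCoords d ^ n := by
  rw [evalAway, RingHom.comp_apply, HomogeneousLocalization.algebraMap_apply,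
    HomogeneousLocalization.Away.val_mk, Localization.mk_eq_mk', IsLocalization.Away.lift,
    IsLocalization.lift_mk'_spec, map_pow, mul_div_cancel₀]
  exact pow_ne_zero _ hu.ne_zero

lemma evalAway_fromZero (a : k) :
    h.evalAway hu (HomogeneousLocalization.fromZeroRingHom _ _
      (algebraMap k (MvPolynomial.homogeneousSubmodule (Fin 3) k 0) a)) = algebraMap k K a := by
  rw [evalAway, RingHom.comp_apply, HomogeneousLocalization.algebraMap_apply]
  have e : (HomogeneousLocalization.fromZeroRingHom
      (MvPolynomial.homogeneousSubmodule (Fin 3) k) (Submonoid.powers d)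
      (algebraMap k (MvPolynomial.homogeneousSubmodule (Fin 3) k 0) a)).val =
      algebraMap (MvPolynomial (Fin 3) k) (Localization.Away d) (MvPolynomial.C a) := by
    rw [HomogeneousLocalization.fromZeroRingHom]
    exact Localization.mk_one_eq_algebraMap _
  rw [e, IsLocalization.Away.lift_eq]
  exact MvPolynomial.aeval_C _ _

/-- The values of the fractions with denominator `d`. -/
theorem range_evalAway (hd : d ∈ MvPolynomial.homogeneousSubmodule (Fin 3) k 2)
    (h2 : (2 : k) ≠ 0) (hp : Squarefree (X * p)) (hq : Squarefree (X * q))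
    (hpq : Squarefree (p * q)) {c : k} (hc : h.evalCoords d = algebraMap k K c / h.t) :
    (h.evalAway hu).range = h.order := by
  have ht := h.t_ne_zero
  have hc0 : algebraMap k K c ≠ 0 := by
    intro h0
    rw [hc, h0, zero_div] at hu
    exact not_isUnit_zero hu
  apply le_antisymm
  -- Up to a constant, division by dⁿ is multiplication by tⁿ, which is what a numerator of degree
  -- 2n needs to become integral.
  · rintro _ ⟨z, rfl⟩
    obtain ⟨n, a, ha, rfl⟩ := HomogeneousLocalization.Away.mk_surjective _ hd z
    have e : h.evalCoords a / h.evalCoords d ^ n =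
        h.evalCoords a * h.t ^ n * algebraMap k K (c⁻¹ ^ n) := by
      rw [hc, div_pow, map_pow, map_inv₀, inv_pow]
      field_simp
    rw [evalAway_mk, e]
    exact mul_mem (h.evalCoords_mul_pow_mem ha) (h.algebraMap_mem_order _)
  -- This is the value of c Xᵢ Xⱼ / d. The pairs (2, 2), (0, 2), (1, 2), (0, 1) give t, e₁, e₂, e₃,
  -- which generate the integral closure.
  · have hX (i j : Fin 3) : h.coords i * h.coords j * h.t ∈ (h.evalAway hu).range := by
      have ha : MvPolynomial.C c * (MvPolynomial.X i * MvPolynomial.X j) ∈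
          MvPolynomial.homogeneousSubmodule (Fin 3) k (1 • 2) :=
        (MvPolynomial.isHomogeneous_C _ c).mul
          ((MvPolynomial.isHomogeneous_X k i).mul (MvPolynomial.isHomogeneous_X k j))
      refine ⟨HomogeneousLocalization.Away.mk _ hd 1 _ ha, ?_⟩
      rw [evalAway_mk, hc]
      simp only [evalCoords, AlgHom.toRingHom_eq_coe, RingHom.coe_coe, map_mul,
        MvPolynomial.aeval_X, MvPolynomial.algHom_C, pow_one]
      field_simp
    refine h.order_le h2 hp hq hpq (fun a ↦ ⟨_, h.evalAway_fromZero hu a⟩) ?_ ?_ ?_ ?_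
    · simpa [coords] using hX 2 2
    · simpa [coords, ht] using hX 0 2
    · simpa [coords, ht] using hX 1 2
    · have := hX 0 1
      have e : h.coords 0 * h.coords 1 * h.t = h.e₃ := by
        change h.e₁ / h.t * (h.e₂ / h.t) * h.t = _
        rw [div_mul_div_comm, h.mul₁₂]
        field_simp
      rwa [e] at this

end Away

/-- Evaluation at the point `(e₁ / t, e₂ / t)` of the affine plane. -/
def evalPlane : MvPolynomial (Fin 2) k →+* K :=
  (MvPolynomial.aeval ![h.e₁ / h.t, h.e₂ / h.t]).toRingHom

/-- The point `(e₁ / t : e₂ / t : 1)` of the projective plane. -/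
def planePoint : Spec (.of K) ⟶ P2 k :=
  Spec.map (CommRingCat.ofHom h.evalPlane) ≫ planeInclusion k

lemma evalPlane_comp_planeCoordinates :
    (h.evalPlane.comp (Scheme.ΓSpecIso (.of (MvPolynomial (Fin 2) k))).hom.hom).comp
      (planeCoordinates k) = h.evalCoords := by
  have e : (Scheme.ΓSpecIso (.of (MvPolynomial (Fin 2) k))).hom.hom.comp (planeCoordinates k) =
      (MvPolynomial.aeval (R := k) ![MvPolynomial.X 0, MvPolynomial.X 1,
        (1 : MvPolynomial (Fin 2) k)]).toRingHom := by
    rw [planeCoordinates, ← RingHom.comp_assoc, ← CommRingCat.hom_comp, Iso.inv_hom_id]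
    rfl
  rw [RingHom.comp_assoc, e]
  refine MvPolynomial.ringHom_ext (fun a ↦ ?_) fun i ↦ ?_
  · simp [evalPlane, evalCoords]
  · fin_cases i <;> simp [evalPlane, evalCoords, coords]

lemma specMap_evalAway {d : MvPolynomial (Fin 3) k} (hu : IsUnit (h.evalCoords d))
    (hd : d ∈ MvPolynomial.homogeneousSubmodule (Fin 3) k 2) :
    Spec.map (CommRingCat.ofHom (h.evalAway hu)) ≫
      Proj.awayι (MvPolynomial.homogeneousSubmodule (Fin 3) k) d hd two_pos = h.planePoint := by
  have hu' := hu
  rw [← h.evalPlane_comp_planeCoordinates] at hu'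
  refine Eq.trans ?_ (Proj.specMap_fromOfGlobalSections _ (planeCoordinates k)
    (map_irrelevant_planeCoordinates k) hd two_pos h.evalPlane hu').symm
  congr 3
  rw [evalAway]
  congr 1
  exact IsLocalization.ringHom_ext (Submonoid.powers d) (by
    rw [IsLocalization.Away.lift_comp, IsLocalization.Away.lift_comp,
      h.evalPlane_comp_planeCoordinates])

instance : QuasiCompact h.planePoint :=
  have : QuasiSeparatedSpace (P2 k) :=
    inferInstanceAs (QuasiSeparatedSpace (Proj (MvPolynomial.homogeneousSubmodule (Fin 3) k)))
  inferInstance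

/-- The constants in the integral closure of `k[t]`. -/
def orderConst : k →+* h.order := (algebraMap k K).codRestrict _ h.algebraMap_mem_order

/-- The chart of the closure of the point on which `d` does not vanish. -/
theorem exists_order_chart (h2 : (2 : k) ≠ 0) (hp : Squarefree (X * p)) (hq : Squarefree (X * q))
    (hpq : Squarefree (p * q)) {d : MvPolynomial (Fin 3) k}
    (hd : d ∈ MvPolynomial.homogeneousSubmodule (Fin 3) k 2) {c : k} (hc0 : c ≠ 0)
    (hc : h.evalCoords d = algebraMap k K c / h.t) :
    ∃ (i : Spec (.of h.order) ⟶ h.planePoint.image) (_ : IsOpenImmersion i),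
      i.opensRange = h.planePoint.imageι ⁻¹ᵁ
        Proj.basicOpen (MvPolynomial.homogeneousSubmodule (Fin 3) k) d ∧
      Spec.map (CommRingCat.ofHom h.order.subtype) ≫ i = h.planePoint.toImage ∧
      i ≫ h.planePoint.imageι ≫ P2.toSpec k = Spec.map (CommRingCat.ofHom h.orderConst) := by
  have hu : IsUnit (h.evalCoords d) := by
    rw [hc, isUnit_iff_ne_zero]
    exact div_ne_zero ((_root_.map_ne_zero _).mpr hc0) h.t_ne_zero
  have hR := h.range_evalAway hu hd h2 hp hq hpq hc
  let w : Spec (.of (HomogeneousLocalization.Away (MvPolynomial.homogeneousSubmodule (Fin 3) k) d)) ⟶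
    P2 k := Proj.awayι (MvPolynomial.homogeneousSubmodule (Fin 3) k) d hd two_pos
  have hw : IsOpenImmersion w := inferInstanceAs (IsOpenImmersion
    (Proj.awayι (MvPolynomial.homogeneousSubmodule (Fin 3) k) d hd two_pos))
  obtain ⟨i, hi, h₁, h₂, h₃⟩ := exists_image_chart h.planePoint w (h.evalAway hu)
    (h.specMap_evalAway hu hd)
  have hwr : w.opensRange = Proj.basicOpen (MvPolynomial.homogeneousSubmodule (Fin 3) k) d :=
    Proj.opensRange_awayι _ _ _ _
  have hwt : w ≫ P2.toSpec k = Spec.map (CommRingCat.ofHom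
      (HomogeneousLocalization.fromZeroRingHom
        (MvPolynomial.homogeneousSubmodule (Fin 3) k) (Submonoid.powers d))) ≫
      Spec.map (CommRingCat.ofHom (algebraMap k
        (MvPolynomial.homogeneousSubmodule (Fin 3) k 0))) :=
    Proj.awayι_toSpecZero_assoc _ _ _ _ _
  have h₄ : i ≫ h.planePoint.imageι ≫ P2.toSpec k =
      Spec.map (CommRingCat.ofHom ((algebraMap k K).codRestrict (h.evalAway hu).range
        fun a ↦ hR ▸ h.algebraMap_mem_order a)) := by
    rw [reassoc_of% h₃, hwt, ← Spec.map_comp, ← Spec.map_comp]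
    congr 1
    refine CommRingCat.hom_ext (RingHom.ext fun a ↦ Subtype.ext ?_)
    exact h.evalAway_fromZero hu a
  rw [hwr] at h₁
  -- The range and the order are equal, but not by definition; generalizing over the subring
  -- transports the chart from one to the other.
  have key (S : Subring K) (hS : (h.evalAway hu).range = S) (pf : ∀ a, algebraMap k K a ∈ S) :
      ∃ (i : Spec (.of S) ⟶ h.planePoint.image) (_ : IsOpenImmersion i),
        i.opensRange = h.planePoint.imageι ⁻¹ᵁ
          Proj.basicOpen (MvPolynomial.homogeneousSubmodule (Fin 3) k) d ∧
        Spec.map (CommRingCat.ofHom S.subtype) ≫ i = h.planePoint.toImage ∧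
        i ≫ h.planePoint.imageι ≫ P2.toSpec k =
          Spec.map (CommRingCat.ofHom ((algebraMap k K).codRestrict S pf)) := by
    subst hS
    exact ⟨i, hi, h₁, h₂, h₄⟩
  exact key _ hR _

end Biquadratic

end PlaneModel

/-! ### Squarefreeness of the polynomials under the roots -/

section Quartic

variable {k : Type u} [Field k]

/-- `(x - a) (x - b)`. -/
abbrev quad (a b : k) : k[X] := (X - C a) * (X - C b)

/-- `(1 - a x) (1 - b x)`, for nonzero `a`, `b`. -/
abbrev flipQuad (a b : k) : k[X] := C (a * b) * quad a⁻¹ b⁻¹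

lemma squarefree_C_mul {c : k} (hc : c ≠ 0) {f : k[X]} (hf : Squarefree f) :
    Squarefree (C c * f) := by
  have hu : IsUnit (C c : k[X]) := isUnit_C.mpr (isUnit_iff_ne_zero.mpr hc)
  intro x hx
  exact hf x ((hu.dvd_mul_left).mp hx)

lemma separable_quad {a b : k} (h : a ≠ b) : (quad a b).Separable :=
  (separable_X_sub_C).mul separable_X_sub_C
    (isCoprime_X_sub_C_of_isUnit_sub (isUnit_iff_ne_zero.mpr (sub_ne_zero.mpr h)))

lemma isCoprime_X_sub_C {a b : k} (h : a ≠ b) : IsCoprime (X - C a) (X - C b) :=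
  isCoprime_X_sub_C_of_isUnit_sub (isUnit_iff_ne_zero.mpr (sub_ne_zero.mpr h))

lemma squarefree_X_mul_quad {a b : k} (ha : a ≠ 0) (hb : b ≠ 0) (h : a ≠ b) :
    Squarefree (X * quad a b) := by
  refine (Separable.mul separable_X (separable_quad h) ?_).squarefree
  have e : (X : k[X]) = X - C 0 := by simp
  rw [e]
  exact (isCoprime_X_sub_C ha.symm).mul_right (isCoprime_X_sub_C hb.symm)

lemma squarefree_quad_mul_quad {a b c d : k} (h : a ≠ b) (h' : c ≠ d) (h₁ : a ≠ c) (h₂ : a ≠ d)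
    (h₃ : b ≠ c) (h₄ : b ≠ d) : Squarefree (quad a b * quad c d) := by
  refine ((separable_quad h).mul (separable_quad h') ?_).squarefree
  exact ((isCoprime_X_sub_C h₁).mul_right (isCoprime_X_sub_C h₂)).mul_left
    ((isCoprime_X_sub_C h₃).mul_right (isCoprime_X_sub_C h₄))

lemma squarefree_X_mul_flipQuad {a b : k} (ha : a ≠ 0) (hb : b ≠ 0) (h : a ≠ b) :
    Squarefree (X * flipQuad a b) := by
  rw [flipQuad, mul_left_comm]
  exact squarefree_C_mul (mul_ne_zero ha hb)
    (squarefree_X_mul_quad (inv_ne_zero ha) (inv_ne_zero hb) (inv_injective.ne h))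

lemma squarefree_flipQuad_mul_flipQuad {a b c d : k} (ha : a ≠ 0) (hb : b ≠ 0) (hc : c ≠ 0)
    (hd : d ≠ 0) (h : a ≠ b) (h' : c ≠ d) (h₁ : a ≠ c) (h₂ : a ≠ d) (h₃ : b ≠ c) (h₄ : b ≠ d) :
    Squarefree (flipQuad a b * flipQuad c d) := by
  rw [flipQuad, flipQuad, mul_mul_mul_comm, ← C_mul]
  exact squarefree_C_mul (mul_ne_zero (mul_ne_zero ha hb) (mul_ne_zero hc hd))
    (squarefree_quad_mul_quad (inv_injective.ne h) (inv_injective.ne h') (inv_injective.ne h₁)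
      (inv_injective.ne h₂) (inv_injective.ne h₃) (inv_injective.ne h₄))

lemma aeval_quad {K : Type*} [Field K] [Algebra k K] (a b : k) (t : K) :
    aeval t (quad a b) = (t - algebraMap k K a) * (t - algebraMap k K b) := by
  simp [quad]

lemma aeval_quad_eq_flip {K : Type*} [Field K] [Algebra k K] {a b : k} (ha : a ≠ 0) (hb : b ≠ 0)
    {t : K} (ht : t ≠ 0) : aeval t (quad a b) = t ^ 2 * aeval t⁻¹ (flipQuad a b) := by
  have ha' : algebraMap k K a ≠ 0 := (_root_.map_ne_zero _).mpr ha
  have hb' : algebraMap k K b ≠ 0 := (_root_.map_ne_zero _).mpr hb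
  rw [aeval_quad, flipQuad, map_mul, aeval_quad, aeval_C, map_mul, map_inv₀, map_inv₀]
  field_simp
  ring

end Quartic

/-! ### The two conics that express x and 1/x -/

section

variable {k : Type u} [Field k] {α₂ α₃ β₂ β₃ : k}

/-- `1 / x` is `conicD / (ρ₂ - τ₂)` on the curve. -/
def conicD (α₂ α₃ β₂ β₃ : k) : MvPolynomial (Fin 3) k :=
  MvPolynomial.X 1 ^ 2 - MvPolynomial.X 0 ^ 2 + MvPolynomial.C (β₂ + β₃ - (α₂ + α₃)) * MvPolynomial.X 2 ^ 2

/-- `x` is `conicN / (ρ₂ - τ₂)` on the curve. -/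
def conicN (α₂ α₃ β₂ β₃ : k) : MvPolynomial (Fin 3) k :=
  MvPolynomial.C (β₂ * β₃) * MvPolynomial.X 0 ^ 2 - MvPolynomial.C (α₂ * α₃) * MvPolynomial.X 1 ^ 2 +
    MvPolynomial.C (β₂ * β₃ * (α₂ + α₃) - α₂ * α₃ * (β₂ + β₃)) * MvPolynomial.X 2 ^ 2

lemma conicD_mem : conicD α₂ α₃ β₂ β₃ ∈ MvPolynomial.homogeneousSubmodule (Fin 3) k 2 :=
  have hX (i : Fin 3) := MvPolynomial.isHomogeneous_X_pow (R := k) i 2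
  add_mem (sub_mem (hX 1) (hX 0)) ((MvPolynomial.isHomogeneous_C _ _).mul (hX 2))

lemma conicN_mem : conicN α₂ α₃ β₂ β₃ ∈ MvPolynomial.homogeneousSubmodule (Fin 3) k 2 :=
  have hX (i : Fin 3) (c : k) : MvPolynomial.C c * MvPolynomial.X i ^ 2 ∈
    MvPolynomial.homogeneousSubmodule (Fin 3) k 2 :=
    (MvPolynomial.isHomogeneous_C _ _).mul (MvPolynomial.isHomogeneous_X_pow (R := k) i 2)
  add_mem (sub_mem (hX 0 _) (hX 1 _)) (hX 2 _)

namespace Biquadratic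

variable {K : Type u} [Field K] [Algebra k K] (h : Biquadratic k K (quad α₂ α₃) (quad β₂ β₃))

lemma coords_zero_sq : (h.e₁ / h.t) ^ 2 =
    (h.t - algebraMap k K α₂) * (h.t - algebraMap k K α₃) / h.t := by
  have ht := h.t_ne_zero
  rw [div_pow, h.sq₁, aeval_quad]
  field_simp

lemma coords_one_sq : (h.e₂ / h.t) ^ 2 =
    (h.t - algebraMap k K β₂) * (h.t - algebraMap k K β₃) / h.t := by
  have ht := h.t_ne_zero
  rw [div_pow, h.sq₂, aeval_quad]
  field_simp

/-- In Y² = t - τ₁ + τ₂/t and Z² = t - ρ₁ + ρ₂/t the term t cancels from the difference. -/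
lemma evalCoords_conicD : h.evalCoords (conicD α₂ α₃ β₂ β₃) =
    algebraMap k K (β₂ * β₃ - α₂ * α₃) / h.t := by
  have ht := h.t_ne_zero
  simp only [evalCoords, coords, conicD, AlgHom.toRingHom_eq_coe, RingHom.coe_coe, map_add, map_sub,
    map_mul, map_pow, MvPolynomial.aeval_X, MvPolynomial.algHom_C, Matrix.cons_val_zero,
    Matrix.cons_val_one, Matrix.cons_val, h.coords_zero_sq, h.coords_one_sq]
  field_simp
  ring

/-- Here the term 1/t cancels from ρ₂Y² - τ₂Z². -/
lemma evalCoords_conicN : h.evalCoords (conicN α₂ α₃ β₂ β₃) =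
    algebraMap k K (β₂ * β₃ - α₂ * α₃) * h.t := by
  have ht := h.t_ne_zero
  simp only [evalCoords, coords, conicN, AlgHom.toRingHom_eq_coe, RingHom.coe_coe, map_add, map_sub,
    map_mul, map_pow, MvPolynomial.aeval_X, MvPolynomial.algHom_C, Matrix.cons_val_zero,
    Matrix.cons_val_one, Matrix.cons_val, h.coords_zero_sq, h.coords_one_sq]
  field_simp
  ring

/-- The structure with `1 / t` in place of `t`. -/
def flipQuad (hα₂ : α₂ ≠ 0) (hα₃ : α₃ ≠ 0) (hβ₂ : β₂ ≠ 0) (hβ₃ : β₃ ≠ 0) :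
    Biquadratic k K (flipQuad α₂ α₃) (flipQuad β₂ β₃) :=
  h.flip _ _ (aeval_quad_eq_flip hα₂ hα₃ h.t_ne_zero) (aeval_quad_eq_flip hβ₂ hβ₃ h.t_ne_zero)

section Flip

variable (hα₂ : α₂ ≠ 0) (hα₃ : α₃ ≠ 0) (hβ₂ : β₂ ≠ 0) (hβ₃ : β₃ ≠ 0)

lemma flipQuad_e₁_div : (h.flipQuad hα₂ hα₃ hβ₂ hβ₃).e₁ / (h.flipQuad hα₂ hα₃ hβ₂ hβ₃).t =
    h.e₁ / h.t := by
  have ht := h.t_ne_zero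
  change h.e₁ / h.t ^ 2 / h.t⁻¹ = _
  field_simp

lemma flipQuad_e₂_div : (h.flipQuad hα₂ hα₃ hβ₂ hβ₃).e₂ / (h.flipQuad hα₂ hα₃ hβ₂ hβ₃).t =
    h.e₂ / h.t := by
  have ht := h.t_ne_zero
  change h.e₂ / h.t ^ 2 / h.t⁻¹ = _
  field_simp

/-- Since (e₁/t²)/(1/t) = e₁/t, and likewise for e₂, exchanging t and 1/t leaves the point of the
plane alone; so both charts live on the same closure. -/
lemma flipQuad_evalCoords : (h.flipQuad hα₂ hα₃ hβ₂ hβ₃).evalCoords = h.evalCoords := by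
  rw [evalCoords, coords, flipQuad_e₁_div, flipQuad_e₂_div, evalCoords, coords]

lemma flipQuad_planePoint : (h.flipQuad hα₂ hα₃ hβ₂ hβ₃).planePoint = h.planePoint := by
  rw [planePoint, evalPlane, flipQuad_e₁_div, flipQuad_e₂_div, planePoint, evalPlane]

end Flip

/-- The equation of the curve vanishes at the point. -/
lemma evalCoords_conic : h.evalCoords (MvPolynomial.C ((β₂ * β₃ - α₂ * α₃) ^ 2) * MvPolynomial.X 2 ^ 4 -
    conicN α₂ α₃ β₂ β₃ * conicD α₂ α₃ β₂ β₃) = 0 := by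
  have ht := h.t_ne_zero
  rw [map_sub, map_mul, map_mul, h.evalCoords_conicD, h.evalCoords_conicN]
  simp only [evalCoords, coords, AlgHom.toRingHom_eq_coe, RingHom.coe_coe, map_pow,
    MvPolynomial.aeval_X, MvPolynomial.algHom_C, Matrix.cons_val]
  field_simp
  ring

attribute [local instance] MvPolynomial.gradedAlgebra

/-- If a homogeneous polynomial vanishes at the point, then it vanishes on its closure. -/
lemma mem_of_evalCoords_eq_zero {F : MvPolynomial (Fin 3) k} {n : ℕ} (hn : 0 < n)
    (hF : F ∈ MvPolynomial.homogeneousSubmodule (Fin 3) k n) (h0 : h.evalCoords F = 0)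
    (z : h.planePoint.image) : h.planePoint.imageι z ∉
      Proj.basicOpen (MvPolynomial.homogeneousSubmodule (Fin 3) k) F := by
  intro hz
  -- The point is dense in its closure, so if F ≠ 0 somewhere on the closure then F ≠ 0 at the
  -- point.
  have hdom : IsDominant h.planePoint.toImage := inferInstance
  let O := h.planePoint.imageι ⁻¹ᵁ Proj.basicOpen (MvPolynomial.homogeneousSubmodule (Fin 3) k) F
  obtain ⟨_, hw, w, rfl⟩ := dense_iff_inter_open.mp hdom.denseRange O O.isOpen ⟨z, hz⟩
  have hw' : w ∈ h.planePoint ⁻¹ᵁ Proj.basicOpen (MvPolynomial.homogeneousSubmodule (Fin 3) k) F := by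
    rw [← h.planePoint.toImage_imageι]
    exact hw
  have e : h.planePoint ⁻¹ᵁ Proj.basicOpen (MvPolynomial.homogeneousSubmodule (Fin 3) k) F = ⊥ := by
    have e₁ : planeInclusion k ⁻¹ᵁ Proj.basicOpen (MvPolynomial.homogeneousSubmodule (Fin 3) k) F =
        (Spec (.of (MvPolynomial (Fin 2) k))).basicOpen (planeCoordinates k F) :=
      Proj.fromOfGlobalSections_preimage_basicOpen _ _ _ hn hF
    refine (congrArg (Spec.map (CommRingCat.ofHom h.evalPlane) ⁻¹ᵁ ·) e₁).trans ?_
    refine (Scheme.preimage_basicOpen _ _).trans ?_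
    have e₂ : (Spec.map (CommRingCat.ofHom h.evalPlane)).app ⊤ (planeCoordinates k F) = 0 := by
      have e₃ := congr($(Scheme.ΓSpecIso_naturality (CommRingCat.ofHom h.evalPlane))
        (planeCoordinates k F))
      refine (ConcreteCategory.bijective_of_isIso (Scheme.ΓSpecIso (.of K)).hom).injective ?_
      refine e₃.trans (Eq.trans ?_ (map_zero (Scheme.ΓSpecIso (.of K)).hom.hom).symm)
      exact congr($(h.evalPlane_comp_planeCoordinates) F).trans h0
    exact (congrArg _ e₂).trans (Scheme.basicOpen_zero _ _)
  rw [e] at hw'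
  exact hw'

/-- Suppose that both conics vanish at a point of the closure. The equation (ρ₂ - τ₂)² X₂⁴ = N D
gives X₂ = 0. From τ₂D + N = (ρ₂ - τ₂)(X₀² + τ₁X₂²) and ρ₂D + N = (ρ₂ - τ₂)(X₁² + ρ₁X₂²) follows X₀
= X₁ = 0, which is impossible in the projective plane. -/
lemma mem_or_mem (hc : α₂ * α₃ ≠ β₂ * β₃) (z : h.planePoint.image) :
    h.planePoint.imageι z ∈ Proj.basicOpen (MvPolynomial.homogeneousSubmodule (Fin 3) k)
        (conicD α₂ α₃ β₂ β₃) ∨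
      h.planePoint.imageι z ∈ Proj.basicOpen (MvPolynomial.homogeneousSubmodule (Fin 3) k)
        (conicN α₂ α₃ β₂ β₃) := by
  by_contra! hz
  let P : ProjectiveSpectrum (MvPolynomial.homogeneousSubmodule (Fin 3) k) := h.planePoint.imageι z
  let I : Ideal (MvPolynomial (Fin 3) k) := P.asHomogeneousIdeal.toIdeal
  have hI : I.IsPrime := P.isPrime
  have hc' : IsUnit (MvPolynomial.C (β₂ * β₃ - α₂ * α₃) : MvPolynomial (Fin 3) k) :=
    (isUnit_iff_ne_zero.mpr (sub_ne_zero.mpr hc.symm)).map _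
  have hD : conicD α₂ α₃ β₂ β₃ ∈ I := by
    by_contra hD
    exact hz.1 hD
  have hN : conicN α₂ α₃ β₂ β₃ ∈ I := by
    by_contra hN
    exact hz.2 hN
  have hF : MvPolynomial.C ((β₂ * β₃ - α₂ * α₃) ^ 2) * MvPolynomial.X 2 ^ 4 -
      conicN α₂ α₃ β₂ β₃ * conicD α₂ α₃ β₂ β₃ ∈ I := by
    by_contra hF
    refine h.mem_of_evalCoords_eq_zero (n := 4) (by norm_num) ?_ h.evalCoords_conic z hF
    refine sub_mem ?_ ?_
    · exact (MvPolynomial.isHomogeneous_C _ _).mul (MvPolynomial.isHomogeneous_X_pow 2 4)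
    · exact SetLike.mul_mem_graded (A := MvPolynomial.homogeneousSubmodule (Fin 3) k)
        (i := 2) (j := 2) conicN_mem conicD_mem
  have hX2 : MvPolynomial.X 2 ∈ I := by
    refine hI.mem_of_pow_mem 4 ?_
    have h1 := add_mem hF (I.mul_mem_left (conicN α₂ α₃ β₂ β₃) hD)
    rw [sub_add_cancel, map_pow] at h1
    exact (hI.mem_or_mem h1).resolve_left fun h2 ↦ hI.ne_top
      (Ideal.eq_top_of_isUnit_mem _ h2 (hc'.pow 2))
  have hX0 : MvPolynomial.X 0 ∈ I := by
    refine hI.mem_of_pow_mem 2 ?_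
    have h1 : MvPolynomial.C (β₂ * β₃ - α₂ * α₃) * MvPolynomial.X 0 ^ 2 ∈ I := by
      have h2 := sub_mem (add_mem (I.mul_mem_left (MvPolynomial.C (α₂ * α₃)) hD) hN)
        (I.mul_mem_left (MvPolynomial.C (β₂ * β₃ - α₂ * α₃) * MvPolynomial.C (α₂ + α₃) *
          MvPolynomial.X 2) hX2)
      convert! h2 using 1
      simp only [conicD, conicN, map_sub, map_add, map_mul]
      ring
    exact (hI.mem_or_mem h1).resolve_left fun h2 ↦ hI.ne_top (Ideal.eq_top_of_isUnit_mem _ h2 hc')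
  have hX1 : MvPolynomial.X 1 ∈ I := by
    refine hI.mem_of_pow_mem 2 ?_
    have h1 : MvPolynomial.C (β₂ * β₃ - α₂ * α₃) * MvPolynomial.X 1 ^ 2 ∈ I := by
      have h2 := sub_mem (add_mem (I.mul_mem_left (MvPolynomial.C (β₂ * β₃)) hD) hN)
        (I.mul_mem_left (MvPolynomial.C (β₂ * β₃ - α₂ * α₃) * MvPolynomial.C (β₂ + β₃) *
          MvPolynomial.X 2) hX2)
      convert! h2 using 1
      simp only [conicD, conicN, map_sub, map_add, map_mul]
      ring
    exact (hI.mem_or_mem h1).resolve_left fun h2 ↦ hI.ne_top (Ideal.eq_top_of_isUnit_mem _ h2 hc')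
  have hXi (i : Fin 3) : MvPolynomial.X i ∈ I := by
    fin_cases i <;> assumption
  refine P.not_irrelevant_le fun x hx ↦ ?_
  change x ∈ I
  -- An element of the irrelevant ideal has no constant term, so each of its monomials is divisible
  -- by a variable.
  have hx0 : MvPolynomial.coeff 0 x = 0 := by
    have h1 : GradedRing.proj (MvPolynomial.homogeneousSubmodule (Fin 3) k) 0 x = 0 :=
      (HomogeneousIdeal.mem_irrelevant_iff _ _).mp hx
    have h2 := (MvPolynomial.decomposition.decompose'_apply x 0).symm.trans h1
    rw [MvPolynomial.homogeneousComponent_zero] at h2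
    exact MvPolynomial.C_injective _ _ (h2.trans (map_zero _).symm)
  rw [MvPolynomial.as_sum x]
  refine sum_mem fun d hd ↦ ?_
  obtain ⟨i, hi⟩ : ∃ i, d i ≠ 0 := by
    by_contra! h0
    obtain rfl : d = 0 := Finsupp.ext h0
    exact MvPolynomial.mem_support_iff.mp hd hx0
  exact I.mem_of_dvd (MvPolynomial.X_dvd_monomial.mpr (.inr hi)) (hXi i)

end Biquadratic

end

/-! ### Rings that are integrally closed in another ring -/

section IntegrallyClosed

/-- The ring homomorphisms `f : A → B` that identify `A` with its integral closure in `B`. -/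
def IsIntegrallyClosedHom {A B : Type*} [CommRing A] [CommRing B] (f : A →+* B) : Prop :=
  Function.Injective f ∧ ∀ z, f.IsIntegralElem z → z ∈ f.range

lemma IsIntegrallyClosedHom.comp_ringEquiv {A B A' : Type*} [CommRing A] [CommRing B] [CommRing A']
    {f : A →+* B} (hf : IsIntegrallyClosedHom f) (e : A' →+* A) (he : Function.Bijective e) :
    IsIntegrallyClosedHom (f.comp e) := by
  refine ⟨hf.1.comp he.1, fun z ⟨P, hP, hz⟩ ↦ ?_⟩
  obtain ⟨a, rfl⟩ := hf.2 z ⟨P.map e, hP.map e, by rwa [eval₂_map]⟩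
  obtain ⟨b, rfl⟩ := he.2 a
  exact ⟨b, rfl⟩

lemma IsIntegrallyClosedHom.ringEquiv_comp {A B B' : Type*} [CommRing A] [CommRing B] [CommRing B']
    {f : A →+* B} (hf : IsIntegrallyClosedHom f) (e : B →+* B') (he : Function.Bijective e) :
    IsIntegrallyClosedHom (e.comp f) := by
  refine ⟨he.1.comp hf.1, fun z ⟨P, hP, hz⟩ ↦ ?_⟩
  obtain ⟨z, rfl⟩ := he.2 z
  obtain ⟨a, rfl⟩ := hf.2 z ⟨P, hP, he.1 (by rw [map_zero, ← hz, hom_eval₂])⟩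
  exact ⟨a, rfl⟩

lemma isIntegrallyClosedHom_of_isIso {A B A' B' : CommRingCat.{u}} (f : A ⟶ B) (a : A' ⟶ A)
    (b : B ⟶ B') (_ : IsIso a) (_ : IsIso b) (hf : IsIntegrallyClosedHom f.hom) :
    IsIntegrallyClosedHom (a ≫ f ≫ b).hom :=
  (hf.ringEquiv_comp b.hom (ConcreteCategory.bijective_of_isIso b)).comp_ringEquiv a.hom
    (ConcreteCategory.bijective_of_isIso a)

lemma isIntegrallyClosedHom_app_top {R S : CommRingCat.{u}} (m : R ⟶ S)
    (hm : IsIntegrallyClosedHom m.hom) (V : (Spec R).Opens) (hV : V = ⊤) :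
    IsIntegrallyClosedHom ((Spec.map m).app V).hom := by
  subst hV
  have e : (Spec.map m).app ⊤ = (Scheme.ΓSpecIso R).hom ≫ m ≫ (Scheme.ΓSpecIso S).inv := by
    rw [Scheme.ΓSpecIso_inv_naturality, Iso.hom_inv_id_assoc]
  rw [e]
  exact isIntegrallyClosedHom_of_isIso m _ _ (Iso.isIso_hom _) (Iso.isIso_inv _) hm

lemma isIntegrallyClosedHom_app_opensRange {R S : CommRingCat.{u}} {T Y : Scheme.{u}} (m : R ⟶ S)
    (hm : IsIntegrallyClosedHom m.hom) (i : Spec R ⟶ T) [IsOpenImmersion i] (g : Y ⟶ T)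
    (e : Y ≅ Spec S) (he : g = e.hom ≫ Spec.map m ≫ i) :
    IsIntegrallyClosedHom (g.app i.opensRange).hom := by
  subst he
  have hi : IsIso (i.app i.opensRange) := i.isIso_app i.opensRange le_rfl
  have h1 : i ⁻¹ᵁ i.opensRange = ⊤ := by
    ext x
    simp
  have h2 : (e.hom ≫ Spec.map m ≫ i).app i.opensRange = i.app i.opensRange ≫
      (Spec.map m).app (i ⁻¹ᵁ i.opensRange) ≫ e.hom.app (Spec.map m ⁻¹ᵁ i ⁻¹ᵁ i.opensRange) := by
    rw [Scheme.Hom.comp_app, Scheme.Hom.comp_app]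
    exact Category.assoc _ _ _
  have he (U) : IsIso (e.hom.app U) := inferInstance
  rw [h2]
  exact isIntegrallyClosedHom_of_isIso _ _ _ hi (he _) (isIntegrallyClosedHom_app_top m hm _ h1)

end IntegrallyClosed

/-! ### The closure of the point as an integral scheme over the line -/

namespace Biquadratic

variable {k : Type u} {K : Type u} [Field k] [Field K] [Algebra k K]

section

variable {p q : k[X]} (h : Biquadratic k K p q)

/-- The inclusion of `k[t]` into its integral closure. -/
def orderMap : k[X] →+* h.order :=
  (aeval h.t : k[X] →ₐ[k] K).toRingHom.codRestrict _ h.aeval_mem_order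

lemma isIntegral_orderMap : h.orderMap.IsIntegral := by
  rintro ⟨z, hz⟩
  obtain ⟨P, hP, e⟩ := h.mem_order.mp hz
  refine ⟨P, hP, Subtype.val_injective ?_⟩
  change h.order.subtype _ = 0
  rw [hom_eval₂]
  exact e

/-- Transitivity of integrality: what is integral over the integral closure of k[t] is integral over
k[t]. -/
lemma isIntegrallyClosedHom_order : IsIntegrallyClosedHom h.order.subtype := by
  refine ⟨Subtype.val_injective, fun z hz ↦ ?_⟩
  refine ⟨⟨z, ?_⟩, rfl⟩
  let := h.orderMap.toAlgebra
  let : Algebra k[X] K := (aeval h.t : k[X] →ₐ[k] K).toRingHom.toAlgebra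
  have : IsScalarTower k[X] h.order K := .of_algebraMap_eq fun _ ↦ rfl
  have : Algebra.IsIntegral k[X] h.order := ⟨h.isIntegral_orderMap⟩
  have hz' : IsIntegral h.order z := hz
  exact isIntegral_trans z hz'

variable {p' q' : k[X]} (h' : Biquadratic k K p' q')

/-- The charts of `t` and of `1 / t` overlap where `1 / t` does not vanish. -/
theorem exists_chart_eq (h2 : (2 : k) ≠ 0) (hp : Squarefree (X * p)) (hq : Squarefree (X * q))
    (hpq : Squarefree (p * q)) (ht : h.t = h'.t⁻¹) (h₁ : h.e₁ = h'.e₁ / h'.t ^ 2)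
    (h₂ : h.e₂ = h'.e₂ / h'.t ^ 2) (h₃ : h.e₃ = h'.e₃ / h'.t ^ 2) {T : Scheme.{u}} [T.IsSeparated]
    (i : Spec (.of h.order) ⟶ T) (i' : Spec (.of h'.order) ⟶ T)
    (hi : Spec.map (CommRingCat.ofHom h.order.subtype) ≫ i =
      Spec.map (CommRingCat.ofHom h'.order.subtype) ≫ i')
    (y : Spec (.of h'.order)) (hy : h'.orderMap X ∉ y.asIdeal) : ∃ x, i x = i' y := by
  let s : h'.order := h'.orderMap X
  have hs : (s : K) = h'.t := by
    change aeval h'.t X = _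
    simp
  have hs0 : s ≠ 0 := fun h0 ↦ h'.t_ne_zero (by rw [← hs, h0]; rfl)
  let L := Localization.Away s
  let j : L →+* K := IsLocalization.Away.lift s (g := h'.order.subtype)
    (isUnit_iff_ne_zero.mpr (hs.trans_ne h'.t_ne_zero))
  have hj (a : h'.order) : j (algebraMap _ L a) = a := IsLocalization.Away.lift_eq _ _ _
  have hji : Function.Injective j := by
    refine IsLocalization.lift_injective_iff _ |>.mpr fun x z ↦ ?_
    rw [(IsLocalization.injective L (powers_le_nonZeroDivisors_of_noZeroDivisors hs0)).eq_iff]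
    exact Subtype.ext_iff
  have hinv : h'.t⁻¹ ∈ j.range := ⟨IsLocalization.Away.invSelf s, by
    refine eq_inv_of_mul_eq_one_right ?_
    rw [← hs, ← hj s, ← map_mul, IsLocalization.Away.mul_invSelf, map_one]⟩
  have hmem (a : K) (ha : a ∈ h'.order) : a / h'.t ^ 2 ∈ j.range := by
    rw [div_eq_mul_inv, ← inv_pow]
    exact mul_mem ⟨_, hj ⟨a, ha⟩⟩ (pow_mem hinv 2)
  -- The first order lies in the second one with its variable t' inverted, because its generators
  -- are 1/t' and the eᵢ'/t'².
  have hle : h.order ≤ j.range := h.order_le h2 hp hq hpq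
    (fun a ↦ ⟨_, hj ⟨_, h'.algebraMap_mem_order a⟩⟩) (ht ▸ hinv) (h₁ ▸ hmem _ h'.e₁_mem_order)
    (h₂ ▸ hmem _ h'.e₂_mem_order) (h₃ ▸ hmem _ h'.e₃_mem_order)
  let ε : L ≃+* j.range := RingEquiv.ofBijective j.rangeRestrict
    ⟨fun a b hab ↦ hji congr(($hab : K)), j.rangeRestrict_surjective⟩
  let m : h.order →+* L := ε.symm.toRingHom.comp (Subring.inclusion hle)
  have hm : j.comp m = h.order.subtype := RingHom.ext fun a ↦
    congr(($(ε.apply_symm_apply (Subring.inclusion hle a)) : K))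
  have hl : j.comp (algebraMap _ L) = h'.order.subtype := RingHom.ext hj
  have hdom : IsDominant (Spec.map (CommRingCat.ofHom j)) := by
    refine ⟨?_⟩
    exact PrimeSpectrum.denseRange_comap_iff_ker_le_nilRadical _ |>.mpr
      (((RingHom.injective_iff_ker_eq_bot j).mp hji).trans_le bot_le)
  have : IsDomain L := hji.isDomain
  -- The two morphisms agree on the dense point Spec K of the integral scheme Spec L, and `T` is
  -- separated, so they agree. The points at which t' does not vanish all come from Spec L.
  have heq : Spec.map (CommRingCat.ofHom m) ≫ i =
      Spec.map (CommRingCat.ofHom (algebraMap h'.order L)) ≫ i' := by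
    refine ext_of_isDominant (Spec.map (CommRingCat.ofHom j)) ?_
    rw [← Spec.map_comp_assoc, ← Spec.map_comp_assoc, ← CommRingCat.ofHom_comp,
      ← CommRingCat.ofHom_comp, hm, hl, hi]
  obtain ⟨w, rfl⟩ : y ∈ Set.range (PrimeSpectrum.comap (algebraMap h'.order L)) := by
    rw [PrimeSpectrum.localization_away_comap_range L s]
    exact hy
  refine ⟨Spec.map (CommRingCat.ofHom m) w, ?_⟩
  exact congr($heq w)

end

variable {α₂ α₃ β₂ β₃ : k} (h : Biquadratic k K (quad α₂ α₃) (quad β₂ β₃))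

attribute [local instance] MvPolynomial.gradedAlgebra

/-- Both charts of the closure of the point. -/
theorem exists_charts (h2 : (2 : k) ≠ 0)
    (hα₂ : α₂ ≠ 0) (hα₃ : α₃ ≠ 0) (hβ₂ : β₂ ≠ 0) (hβ₃ : β₃ ≠ 0)
    (hα : α₂ ≠ α₃) (hβ : β₂ ≠ β₃) (h₂₂ : α₂ ≠ β₂) (h₂₃ : α₂ ≠ β₃) (h₃₂ : α₃ ≠ β₂) (h₃₃ : α₃ ≠ β₃)
    (hc : α₂ * α₃ ≠ β₂ * β₃) :
    ∃ (i₀ : Spec (.of h.order) ⟶ h.planePoint.image)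
      (i₁ : Spec (.of (h.flipQuad hα₂ hα₃ hβ₂ hβ₃).order) ⟶ h.planePoint.image)
      (_ : IsOpenImmersion i₀) (_ : IsOpenImmersion i₁),
      (∀ z, (∃ x, i₀ x = z) ∨ ∃ x, i₁ x = z) ∧
      Spec.map (CommRingCat.ofHom h.order.subtype) ≫ i₀ = h.planePoint.toImage ∧
      Spec.map (CommRingCat.ofHom (h.flipQuad hα₂ hα₃ hβ₂ hβ₃).order.subtype) ≫ i₁ =
        h.planePoint.toImage ∧
      i₀ ≫ h.planePoint.imageι ≫ P2.toSpec k = Spec.map (CommRingCat.ofHom h.orderConst) ∧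
      i₁ ≫ h.planePoint.imageι ≫ P2.toSpec k =
        Spec.map (CommRingCat.ofHom (h.flipQuad hα₂ hα₃ hβ₂ hβ₃).orderConst) ∧
      (∃ π : h.planePoint.image ⟶ P1 k, IsIntegralHom π ∧
        i₀ ≫ π = Spec.map (CommRingCat.ofHom h.orderMap) ≫ P1.ι₀ k ∧
        π ≫ P1.toSpec k = h.planePoint.imageι ≫ P2.toSpec k) := by
  have hc0 : β₂ * β₃ - α₂ * α₃ ≠ 0 := sub_ne_zero.mpr hc.symm
  have hp := squarefree_X_mul_quad hα₂ hα₃ hα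
  have hq := squarefree_X_mul_quad hβ₂ hβ₃ hβ
  have hpq := squarefree_quad_mul_quad hα hβ h₂₂ h₂₃ h₃₂ h₃₃
  have hp' := squarefree_X_mul_flipQuad hα₂ hα₃ hα
  have hq' := squarefree_X_mul_flipQuad hβ₂ hβ₃ hβ
  have hpq' := squarefree_flipQuad_mul_flipQuad hα₂ hα₃ hβ₂ hβ₃ hα hβ h₂₂ h₂₃ h₃₂ h₃₃
  let h' := h.flipQuad hα₂ hα₃ hβ₂ hβ₃
  have ht' : h'.t = h.t⁻¹ := rfl
  obtain ⟨i₀, hi₀, r₀, g₀, s₀⟩ := h.exists_order_chart h2 hp hq hpq conicD_mem hc0 h.evalCoords_conicD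
  have hN : h'.evalCoords (conicN α₂ α₃ β₂ β₃) = algebraMap k K (β₂ * β₃ - α₂ * α₃) / h'.t := by
    rw [h.flipQuad_evalCoords, h.evalCoords_conicN, ht', div_inv_eq_mul]
  -- Generalizing over the point moves the chart for 1/t, which is built on the image of
  -- `h'.planePoint`, to the image of the equal morphism `h.planePoint`.
  have key (g : Spec (.of K) ⟶ P2 k) [QuasiCompact g] (hg : h'.planePoint = g) :
      ∃ (i : Spec (.of h'.order) ⟶ g.image) (_ : IsOpenImmersion i),
      i.opensRange = g.imageι ⁻¹ᵁ
        Proj.basicOpen (MvPolynomial.homogeneousSubmodule (Fin 3) k) (conicN α₂ α₃ β₂ β₃) ∧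
      Spec.map (CommRingCat.ofHom h'.order.subtype) ≫ i = g.toImage ∧
      i ≫ g.imageι ≫ P2.toSpec k = Spec.map (CommRingCat.ofHom h'.orderConst) := by
    subst hg
    exact h'.exists_order_chart h2 hp' hq' hpq' conicN_mem hc0 hN
  obtain ⟨i₁, hi₁, r₁, g₁, s₁⟩ := key h.planePoint (h.flipQuad_planePoint hα₂ hα₃ hβ₂ hβ₃)
  have hcov (z : h.planePoint.image) : (∃ x, i₀ x = z) ∨ ∃ x, i₁ x = z := by
    rcases h.mem_or_mem hc z with hz | hz
    · left
      change z ∈ i₀.opensRange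
      rw [r₀]
      exact hz
    · right
      change z ∈ i₁.opensRange
      rw [r₁]
      exact hz
  refine ⟨i₀, i₁, hi₀, hi₁, hcov, g₀, g₁, s₀, s₁, ?_⟩
  obtain ⟨π, hπ₀, hπ₁⟩ := P1.exists_of_charts i₀ i₁ hcov h.order.subtype h'.order.subtype
    Subtype.val_injective (g₀.trans g₁.symm) h.orderMap h'.orderMap
    (fun a ↦ by
      change aeval h.t (C a) = aeval h'.t (C a)
      simp)
    (by
      change aeval h.t X * aeval h.t⁻¹ X = 1
      simp [h.t_ne_zero])
  have : Scheme.IsSeparated (P2 k) :=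
    inferInstanceAs (Scheme.IsSeparated (Proj (MvPolynomial.homogeneousSubmodule (Fin 3) k)))
  have : h.planePoint.image.IsSeparated := by
    rw [Scheme.isSeparated_iff, ← terminal.comp_from h.planePoint.imageι]
    infer_instance
  refine ⟨π, ?_, hπ₀, hom_ext_of_charts i₀ i₁ hcov ?_ ?_⟩
  -- Over the two charts of the line, `π` is the inclusion of k[t] and of k[1/t] into its integral
  -- closure. For this the preimage of each chart of the line must be a single chart of the closure,
  -- which is what `exists_chart_eq` provides.
  · have := isZariskiLocalAtTarget_isIntegralHom.{u}
    have ht := h.t_ne_zero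
    refine of_charts @IsIntegralHom.{u} i₀ i₁ π _ _ _ _ hπ₀ hπ₁ (P1.jointly_surjective k)
      (preimage_opensRange_of_charts _ _ _ _ _ _ _ hπ₀ hπ₁ hcov fun y a e ↦ ?_)
      (preimage_opensRange_of_charts _ _ _ _ _ _ _ hπ₁ hπ₀ (fun z ↦ (hcov z).symm) fun y a e ↦ ?_)
      (IsIntegralHom.SpecMap_iff.mpr h.isIntegral_orderMap)
      (IsIntegralHom.SpecMap_iff.mpr h'.isIntegral_orderMap)
    · refine h.exists_chart_eq h' h2 hp hq hpq (inv_inv _).symm ?_ ?_ ?_ _ _ (g₀.trans g₁.symm) _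
        (P1.X_notMem_of_ι₀_eq_ι₁ k e.symm).2
      · change h.e₁ = h.e₁ / h.t ^ 2 / h.t⁻¹ ^ 2
        field_simp
      · change h.e₂ = h.e₂ / h.t ^ 2 / h.t⁻¹ ^ 2
        field_simp
      · change h.e₃ = h.e₃ / h.t ^ 2 / h.t⁻¹ ^ 2
        field_simp
    · exact h'.exists_chart_eq h h2 hp' hq' hpq' rfl rfl rfl rfl _ _ (g₁.trans g₀.symm) _
        (P1.X_notMem_of_ι₀_eq_ι₁ k e).1
  · rw [s₀, reassoc_of% hπ₀, P1.ι₀_toSpec, ← Spec.map_comp]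
    congr 1
    refine CommRingCat.hom_ext (RingHom.ext fun a ↦ Subtype.ext ?_)
    exact aeval_C _ _
  · rw [s₁, reassoc_of% hπ₁, P1.ι₁_toSpec, ← Spec.map_comp]
    congr 1
    refine CommRingCat.hom_ext (RingHom.ext fun a ↦ Subtype.ext ?_)
    exact aeval_C _ _

end Biquadratic

/-! ### Comparison of the Howe curve with the closure of the point -/

/-- A scheme is its relative normalization in a point if two charts are integrally closed in it. -/
theorem isIso_fromNormalization_of_charts {R₀ R₁ S : CommRingCat.{u}} {T Y : Scheme.{u}}
    (m₀ : R₀ ⟶ S) (m₁ : R₁ ⟶ S) (hm₀ : IsIntegrallyClosedHom m₀.hom)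
    (hm₁ : IsIntegrallyClosedHom m₁.hom) (i₀ : Spec R₀ ⟶ T) (i₁ : Spec R₁ ⟶ T)
    [IsOpenImmersion i₀] [IsOpenImmersion i₁] (hcov : ∀ z, (∃ x, i₀ x = z) ∨ ∃ x, i₁ x = z)
    (ψ : Y ⟶ T) [QuasiCompact ψ] [QuasiSeparated ψ] (e : Y ≅ Spec S)
    (h₀ : ψ = e.hom ≫ Spec.map m₀ ≫ i₀) (h₁ : ψ = e.hom ≫ Spec.map m₁ ≫ i₁) :
    IsIso ψ.fromNormalization := by
  let U (b : Bool) : T.Opens := b.rec i₀.opensRange i₁.opensRange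
  have key (b : Bool) : IsIntegrallyClosedHom (ψ.app (U b)).hom := by
    cases b
    · exact isIntegrallyClosedHom_app_opensRange m₀ hm₀ i₀ ψ e h₀
    · exact isIntegrallyClosedHom_app_opensRange m₁ hm₁ i₁ ψ e h₁
  refine isIso_fromNormalization ψ U ?_ ?_ (fun b ↦ (key b).1) fun b ↦ (key b).2
  · rintro (_ | _)
    · exact isAffineOpen_opensRange i₀
    · exact isAffineOpen_opensRange i₁
  · rw [eq_top_iff]
    intro z _
    obtain hz | hz := hcov z
    · exact TopologicalSpace.Opens.mem_iSup.mpr ⟨false, hz⟩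
    · exact TopologicalSpace.Opens.mem_iSup.mpr ⟨true, hz⟩

attribute [local instance] MvPolynomial.gradedAlgebra in
/-- The Howe curve is the closure of the point in the projective plane. -/
theorem Biquadratic.exists_curve_iso {k : Type u} {K : Type u} [Field k] [Field K] [Algebra k K]
    {α₂ α₃ β₂ β₃ : k} (h : Biquadratic k K (quad α₂ α₃) (quad β₂ β₃)) (h2 : (2 : k) ≠ 0)
    (hα₂ : α₂ ≠ 0) (hα₃ : α₃ ≠ 0) (hβ₂ : β₂ ≠ 0) (hβ₃ : β₃ ≠ 0)
    (hα : α₂ ≠ α₃) (hβ : β₂ ≠ β₃) (h₂₂ : α₂ ≠ β₂) (h₂₃ : α₂ ≠ β₃) (h₃₂ : α₃ ≠ β₂) (h₃₃ : α₃ ≠ β₃)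
    (hc : α₂ * α₃ ≠ β₂ * β₃) :
    ∃ e : Curve α₂ α₃ β₂ β₃ ≅ h.planePoint.image,
      e.hom ≫ h.planePoint.imageι ≫ P2.toSpec k = Curve.toSpec α₂ α₃ β₂ β₃ := by
  obtain ⟨i₀, i₁, _, _, hcov, g₀, g₁, -, -, π, hπ, hπ₀, hπs⟩ :=
    h.exists_charts h2 hα₂ hα₃ hβ₂ hβ₃ hα hβ h₂₂ h₂₃ h₃₂ h₃₃ hc
  obtain ⟨e₀, he₀⟩ := FiberProduct.exists_genericPoints_iso h h2
  have : Scheme.IsSeparated (P2 k) :=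
    inferInstanceAs (Scheme.IsSeparated (Proj (MvPolynomial.homogeneousSubmodule (Fin 3) k)))
  have : h.planePoint.image.IsSeparated := by
    rw [Scheme.isSeparated_iff, ← terminal.comp_from h.planePoint.imageι]
    infer_instance
  let φ := fromGenericPoints (FiberProduct α₂ α₃ β₂ β₃)
  let ψ := e₀.hom ≫ h.planePoint.toImage
  have hφψ : ψ ≫ π = φ ≫ FiberProduct.toP1 α₂ α₃ β₂ β₃ := by
    simp only [φ, ψ, ← he₀, Category.assoc, ← g₀, hπ₀]
    rw [FiberProduct.point_toP1, ← Spec.map_comp_assoc]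
    rfl
  -- The fiber product and the closure of the point are both integral over the line, with the same
  -- composite from the generic points. So both normalizations are that of the line, and the closure
  -- is its own normalization.
  obtain ⟨a, ha⟩ := exists_normalization_comp_iso φ (FiberProduct.toP1 α₂ α₃ β₂ β₃)
  obtain ⟨b, hb⟩ : ∃ b : ψ.normalization ≅ (φ ≫ FiberProduct.toP1 α₂ α₃ β₂ β₃).normalization,
      b.hom ≫ (φ ≫ FiberProduct.toP1 α₂ α₃ β₂ β₃).fromNormalization =
        ψ.fromNormalization ≫ π := by
    have key (χ) (hχ : ψ ≫ π = χ) [QuasiCompact χ] [QuasiSeparated χ] :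
        ∃ b : ψ.normalization ≅ χ.normalization,
          b.hom ≫ χ.fromNormalization = ψ.fromNormalization ≫ π := by
      subst hχ
      exact exists_normalization_comp_iso ψ π
    exact key _ hφψ
  have hψ : IsIso ψ.fromNormalization :=
    isIso_fromNormalization_of_charts (CommRingCat.ofHom h.order.subtype)
      (CommRingCat.ofHom (h.flipQuad hα₂ hα₃ hβ₂ hβ₃).order.subtype) h.isIntegrallyClosedHom_order
      (h.flipQuad hα₂ hα₃ hβ₂ hβ₃).isIntegrallyClosedHom_order i₀ i₁ hcov ψ e₀
      (congrArg (e₀.hom ≫ ·) g₀.symm) (congrArg (e₀.hom ≫ ·) g₁.symm)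
  have hb' : b.inv ≫ ψ.fromNormalization ≫ π =
      (φ ≫ FiberProduct.toP1 α₂ α₃ β₂ β₃).fromNormalization := by
    rw [← hb, Iso.inv_hom_id_assoc]
  let E : φ.normalization ≅ h.planePoint.image := a ≪≫ b.symm ≪≫ asIso ψ.fromNormalization
  have hE : E.hom ≫ h.planePoint.imageι ≫ P2.toSpec k =
      φ.fromNormalization ≫ FiberProduct.toP1 α₂ α₃ β₂ β₃ ≫ P1.toSpec k := by
    simp only [E, Iso.trans_hom, Iso.symm_hom, asIso_hom, Category.assoc]
    rw [← hπs, reassoc_of% hb', reassoc_of% ha]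
  exact ⟨E, hE⟩

/-- The relations y² x = p(x) and z² x = q(x) lower the degree in y and z at the cost of factors x.
The elements 1, yx, zx, yzx correspond to 1, e₁, e₂, e₃ in the function field. -/
lemma exists_combination {k A : Type*} [CommRing k] [CommRing A] [Algebra k A] {y z x : A}
    {p q : k[X]}
    (hy : y ^ 2 * x = aeval x p) (hz : z ^ 2 * x = aeval x q) (a : MvPolynomial (Fin 2) k) :
    ∃ (n : ℕ) (b c d e : k[X]), MvPolynomial.aeval ![y, z] a * x ^ n =
      aeval x b + aeval x c * (y * x) + aeval x d * (z * x) + aeval x e * (y * z * x) := by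
  induction a using MvPolynomial.induction_on with
  | C r => exact ⟨0, C r, 0, 0, 0, by simp⟩
  | add a a' ha ha' =>
    obtain ⟨n, b, c, d, e, h⟩ := ha
    obtain ⟨n', b', c', d', e', h'⟩ := ha'
    refine ⟨n + n', X ^ n' * b + X ^ n * b', X ^ n' * c + X ^ n * c', X ^ n' * d + X ^ n * d',
      X ^ n' * e + X ^ n * e', ?_⟩
    simp only [map_add, map_mul, map_pow, aeval_X]
    linear_combination x ^ n' * h + x ^ n * h'
  | mul_X a i ha =>
    obtain ⟨n, b, c, d, e, h⟩ := ha
    fin_cases i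
    · refine ⟨n + 1, X * c * p, b, e * p, X * d, ?_⟩
      have hi : MvPolynomial.aeval ![y, z] (MvPolynomial.X (R := k) 0) = y := by simp
      simp only [map_mul, aeval_X, Fin.zero_eta, hi]
      linear_combination y * x * h + (x * aeval x c + aeval x e * z * x) * hy
    · refine ⟨n + 1, X * d * q, e * q, b, X * c, ?_⟩
      have hi : MvPolynomial.aeval ![y, z] (MvPolynomial.X (R := k) 1) = z := by simp
      simp only [map_mul, aeval_X, Fin.mk_one, hi]
      linear_combination z * x * h + (x * aeval x d + aeval x e * y * x) * hz

/-! ### The equation of the affine curve -/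

namespace Biquadratic

variable {k : Type u} {K : Type u} [Field k] [Field K] [Algebra k K]

/-- If `θ` kills an element, then the coefficients of its product with a power of `x`, in terms of
1, yx, zx, yzx, vanish by independence over k(t). As `x` is a unit, the element itself is 0. -/
lemma injective_of_combination {p q : k[X]} (h : Biquadratic k K p q) (h2 : (2 : k) ≠ 0)
    (hp : p ≠ 0) (hq : q ≠ 0) {A : Type*} [CommRing A] [Algebra k A] {y z x : A} (hx : IsUnit x)
    (hy : y ^ 2 * x = aeval x p) (hz : z ^ 2 * x = aeval x q)
    (hs : Function.Surjective (MvPolynomial.aeval (R := k) ![y, z])) (θ : A →ₐ[k] K)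
    (hθx : θ x = h.t) (hθy : θ y = h.e₁ / h.t) (hθz : θ z = h.e₂ / h.t) : Function.Injective θ := by
  have ht := h.t_ne_zero
  rw [injective_iff_map_eq_zero]
  intro a ha
  obtain ⟨a, rfl⟩ := hs a
  obtain ⟨n, b, c, d, e, he⟩ := exists_combination hy hz a
  have hK := congrArg θ he
  have h3 : h.e₁ / h.t * (h.e₂ / h.t) * h.t = h.e₃ := by
    rw [div_mul_div_comm, h.mul₁₂]
    field_simp
  simp only [map_mul, map_add, ha, zero_mul, ← aeval_algHom_apply, hθx, hθy, hθz, h3,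
    div_mul_cancel₀ _ ht] at hK
  obtain ⟨hb, hc, hd, he'⟩ := h.eq_zero_of_combination h2 hp hq (h.aeval_mem b) (h.aeval_mem c)
    (h.aeval_mem d) (h.aeval_mem e) hK.symm
  have key {r : k[X]} (hr : aeval h.t r = 0) : r = 0 := h.injective_aeval (by rw [hr, map_zero])
  rw [key hb, key hc, key hd, key he'] at he
  simp only [map_zero, zero_mul, add_zero] at he
  exact ((hx.pow n).mul_left_eq_zero).mp he

variable {α₂ α₃ β₂ β₃ : k} (h : Biquadratic k K (quad α₂ α₃) (quad β₂ β₃))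

/-- The equation of the affine curve generates the relations of the point. -/
theorem exists_injective (h2 : (2 : k) ≠ 0) (hc : α₂ * α₃ ≠ β₂ * β₃) :
    ∃ θ : (MvPolynomial (Fin 2) k ⧸ Ideal.span
        {explicitQuartic (α₂ + α₃) (α₂ * α₃) (β₂ + β₃) (β₂ * β₃)}) →+* K,
      Function.Injective θ ∧ θ.comp (Ideal.Quotient.mk _) = h.evalPlane := by
  let f := explicitQuartic (α₂ + α₃) (α₂ * α₃) (β₂ + β₃) (β₂ * β₃)
  let A := MvPolynomial (Fin 2) k ⧸ Ideal.span {f}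
  have ht := h.t_ne_zero
  have hc0 : β₂ * β₃ - α₂ * α₃ ≠ 0 := sub_ne_zero.mpr hc.symm
  let ev : MvPolynomial (Fin 2) k →ₐ[k] K := MvPolynomial.aeval ![h.e₁ / h.t, h.e₂ / h.t]
  have hf : ev f = 0 := by
    simp only [ev, f, explicitQuartic, map_add, map_mul, map_pow, MvPolynomial.aeval_X,
      MvPolynomial.algHom_C, Matrix.cons_val_zero, Matrix.cons_val_one, Matrix.cons_val_fin_one]
    have e1 : (h.e₁ / h.t) ^ 4 = ((h.e₁ / h.t) ^ 2) ^ 2 := by ring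
    have e2 : (h.e₂ / h.t) ^ 4 = ((h.e₂ / h.t) ^ 2) ^ 2 := by ring
    rw [e1, e2, h.coords_zero_sq, h.coords_one_sq]
    simp only [map_add, map_sub, map_neg, map_mul, map_pow, map_ofNat]
    field_simp
    ring
  let θ : A →ₐ[k] K := Ideal.Quotient.liftₐ _ ev fun a ha ↦ by
    obtain ⟨b, rfl⟩ := Ideal.mem_span_singleton'.mp ha
    rw [map_mul, hf, mul_zero]
  have hθ (a) : θ (Ideal.Quotient.mk _ a) = ev a := rfl
  refine ⟨θ.toRingHom, ?_, rfl⟩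
  let Y : MvPolynomial (Fin 2) k := MvPolynomial.X 0
  let Z : MvPolynomial (Fin 2) k := MvPolynomial.X 1
  let N := MvPolynomial.C (β₂ * β₃) * Y ^ 2 - MvPolynomial.C (α₂ * α₃) * Z ^ 2 +
    MvPolynomial.C (β₂ * β₃ * (α₂ + α₃) - α₂ * α₃ * (β₂ + β₃))
  let D := Z ^ 2 - Y ^ 2 + MvPolynomial.C (β₂ + β₃ - (α₂ + α₃))
  let μ : MvPolynomial (Fin 2) k →+* A := Ideal.Quotient.mk _
  let γ : k →+* A := μ.comp MvPolynomial.C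
  have hcu : γ (β₂ * β₃ - α₂ * α₃)⁻¹ * γ (β₂ * β₃ - α₂ * α₃) = 1 := by
    rw [← map_mul, inv_mul_cancel₀ hc0, map_one]
  have hND : μ N * μ D = γ (β₂ * β₃ - α₂ * α₃) ^ 2 := by
    -- The factored form of the resultant: modulo `f`, the conics N and D are units, inverse to each
    -- other up to a constant.
    have h1 : f = MvPolynomial.C (β₂ * β₃ - α₂ * α₃) ^ 2 - N * D := by
      simp only [f, explicitQuartic, N, D, Y, Z, map_add, map_sub, map_neg, map_mul, map_pow,
        map_ofNat]
      ring
    have hf0 : μ f = 0 := Ideal.Quotient.eq_zero_iff_mem.mpr (Ideal.mem_span_singleton_self f)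
    have h2 := (congrArg μ h1).symm.trans hf0
    rw [map_sub, map_mul, map_pow] at h2
    exact (sub_eq_zero.mp h2).symm
  have hY : μ N + γ (α₂ * α₃) * μ D = γ (β₂ * β₃ - α₂ * α₃) * (μ Y ^ 2 + γ (α₂ + α₃)) := by
    simp only [γ, RingHom.comp_apply, ← map_mul, ← map_add, ← map_pow]
    congr 1
    simp only [N, D, map_add, map_sub, map_mul]
    ring
  have hZ : μ N + γ (β₂ * β₃) * μ D = γ (β₂ * β₃ - α₂ * α₃) * (μ Z ^ 2 + γ (β₂ + β₃)) := by
    simp only [γ, RingHom.comp_apply, ← map_mul, ← map_add, ← map_pow]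
    congr 1
    simp only [N, D, map_add, map_sub, map_mul]
    ring
  -- `x` and `x'` are the functions x and 1/x of the fiber product, recovered from Y and Z.
  let x : A := γ (β₂ * β₃ - α₂ * α₃)⁻¹ * μ N
  let x' : A := γ (β₂ * β₃ - α₂ * α₃)⁻¹ * μ D
  have hxx' : x * x' = 1 := by
    linear_combination γ (β₂ * β₃ - α₂ * α₃)⁻¹ ^ 2 * hND +
      (γ (β₂ * β₃ - α₂ * α₃)⁻¹ * γ (β₂ * β₃ - α₂ * α₃) + 1) * hcu
  have hquad (a b : k) (w : A) (hw : μ N + γ (a * b) * μ D =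
      γ (β₂ * β₃ - α₂ * α₃) * (w ^ 2 + γ (a + b))) : w ^ 2 * x = aeval x (quad a b) := by
    have h1 : aeval x (quad a b) = (x - γ a) * (x - γ b) := by
      simp only [quad, map_mul, map_sub, aeval_X, aeval_C]
      rfl
    -- As `x'` is 1/x, multiplying this by x gives w² x = (x - a)(x - b).
    have h2 : w ^ 2 = x + γ (a * b) * x' - γ (a + b) := by
      linear_combination -γ (β₂ * β₃ - α₂ * α₃)⁻¹ * hw - (w ^ 2 + γ (a + b)) * hcu
    rw [h1, h2, map_add, map_mul]
    linear_combination γ a * γ b * hxx'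
  refine h.injective_of_combination (x := x) (y := μ Y) (z := μ Z) h2
    (mul_ne_zero (X_sub_C_ne_zero _) (X_sub_C_ne_zero _))
    (mul_ne_zero (X_sub_C_ne_zero _) (X_sub_C_ne_zero _)) (IsUnit.of_mul_eq_one _ hxx')
    (hquad _ _ _ hY) (hquad _ _ _ hZ) ?_ θ ?_ ?_ ?_
  · intro a
    obtain ⟨a, rfl⟩ := Ideal.Quotient.mk_surjective a
    refine ⟨a, ?_⟩
    have : MvPolynomial.aeval ![μ Y, μ Z] = Ideal.Quotient.mkₐ k (Ideal.span {f}) :=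
      MvPolynomial.algHom_ext fun i ↦ by
        fin_cases i <;> simp [μ, Y, Z] <;> rfl
    rw [this]
    rfl
  · have hc' : algebraMap k K (β₂ * β₃ - α₂ * α₃) ≠ 0 := (_root_.map_ne_zero _).mpr hc0
    have hx : θ x = ev (MvPolynomial.C (β₂ * β₃ - α₂ * α₃)⁻¹ * N) := by
      rw [← hθ]
      exact congrArg θ (map_mul μ _ _).symm
    rw [hx]
    simp only [ev, N, Y, Z, map_add, map_mul, map_sub, map_pow, MvPolynomial.aeval_X,
      MvPolynomial.algHom_C, Matrix.cons_val_zero, Matrix.cons_val_one, Matrix.cons_val_fin_one,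
      h.coords_zero_sq, h.coords_one_sq, map_inv₀] at hc' ⊢
    field_simp
    ring
  · exact (hθ Y).trans ((MvPolynomial.aeval_X _ _).trans rfl)
  · exact (hθ Z).trans ((MvPolynomial.aeval_X _ _).trans rfl)

end Biquadratic

/-! ### The projective closure as the closure of a generic point -/

section Closure

variable {k : Type u} [Field k]

/-- The projective closure of an affine curve is the closure of a generic point. -/
theorem exists_projectiveClosure_iso {K : Type u} [Field K] (f : MvPolynomial (Fin 2) k)
    (θ : (MvPolynomial (Fin 2) k ⧸ Ideal.span {f}) →+* K) (hθ : Function.Injective θ)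
    (g : Spec (.of K) ⟶ P2 k) [QuasiCompact g]
    (hg : g = Spec.map (CommRingCat.ofHom (θ.comp (Ideal.Quotient.mk _))) ≫ planeInclusion k) :
    ∃ e : g.image ≅ ProjectiveClosure f,
      e.hom ≫ ProjectiveClosure.toSpec f = g.imageι ≫ P2.toSpec k := by
  have hg' : g = Spec.map (CommRingCat.ofHom θ) ≫ AffineCurve.toP2 f := by
    rw [hg, CommRingCat.ofHom_comp, Spec.map_comp, Category.assoc]
    rfl
  have : IsDomain (MvPolynomial (Fin 2) k ⧸ Ideal.span {f}) := hθ.isDomain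
  have hdom : IsDominant (Spec.map (CommRingCat.ofHom θ)) := by
    refine ⟨?_⟩
    exact PrimeSpectrum.denseRange_comap_iff_ker_le_nilRadical _ |>.mpr
      (((RingHom.injective_iff_ker_eq_bot θ).mp hθ).trans_le bot_le)
  have hsd := IsSchemeTheoreticallyDominant.of_isDominant (Spec.map (CommRingCat.ofHom θ))
  -- Spec K is scheme-theoretically dense in the affine curve, so both morphisms to the plane have
  -- the same ideal sheaf and hence the same image.
  have hker : g.ker = (AffineCurve.toP2 f).ker := by
    rw [hg']
    refine (Scheme.Hom.ker_comp _ _).trans ?_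
    rw [hsd.ker_eq_bot]
    exact Scheme.IdealSheafData.map_bot _
  have key (I J : (P2 k).IdealSheafData) (hIJ : I = J) :
      ∃ e : I.subscheme ≅ J.subscheme, e.hom ≫ J.subschemeι = I.subschemeι := by
    subst hIJ
    exact ⟨Iso.refl _, Category.id_comp _⟩
  obtain ⟨e, he⟩ := key _ _ hker
  refine ⟨e, ?_⟩
  exact (Category.assoc _ _ _).symm.trans (congrArg (· ≫ P2.toSpec k) he)

end Closure

/-! ### Smoothness of Dedekind domains over an algebraically closed field -/

section Smooth

/-- One generator and no relation: the Jacobian is the determinant of an empty matrix. -/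
instance isStandardSmoothOfRelativeDimension_polynomial (k : Type*) [CommRing k] :
    Algebra.IsStandardSmoothOfRelativeDimension 1 k k[X] := by
  let P : Algebra.SubmersivePresentation k (MvPolynomial Unit k) Unit Empty :=
    { toGenerators := Algebra.Generators.mvPolynomial k Unit
      relation := Empty.elim
      span_range_relation_eq_ker := by
        rw [Set.range_eq_empty, Ideal.span_empty, Algebra.Generators.ker_eq_ker_aeval_val]
        symm
        rw [← RingHom.ker_coe_toRingHom, ← RingHom.injective_iff_ker_eq_bot]
        intro a b hab
        exact (MvPolynomial.aeval_X_left_apply a).symm.trans (hab.trans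
          (MvPolynomial.aeval_X_left_apply b))
      map := Empty.elim
      map_inj := fun a ↦ a.elim
      jacobian_isUnit := by
        rw [Algebra.PreSubmersivePresentation.jacobian_eq_jacobiMatrix_det, Matrix.det_isEmpty,
          map_one]
        exact isUnit_one }
  have : Algebra.IsStandardSmoothOfRelativeDimension 1 k (MvPolynomial Unit k) :=
    P.isStandardSmoothOfRelativeDimension (by simp [Algebra.Presentation.dimension])
  exact .of_algEquiv 1 (MvPolynomial.uniqueAlgEquiv k Unit)

/-- A maximal ideal of a Dedekind domain is generated, locally, by an element. -/
lemma exists_map_span_singleton_eq {R : Type*} [CommRing R] [IsDedekindDomain R] (m : Ideal R)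
    [m.IsMaximal] (hm : m ≠ ⊥) : ∃ u ∈ m, u ≠ 0 ∧
      (Ideal.span {u}).map (algebraMap R (Localization.AtPrime m)) =
        IsLocalRing.maximalIdeal (Localization.AtPrime m) := by
  -- Choose u in m but not in m². No ideal lies strictly between m² and m, so (u) + m² = m, and
  -- Nakayama's lemma gives the claim in the localization.
  have hlt : m ^ 2 < m := by simpa using Ideal.pow_succ_lt_pow hm 1
  obtain ⟨u, hu, hu'⟩ := Set.exists_of_ssubset hlt
  refine ⟨u, hu, fun h0 ↦ hu' (h0 ▸ zero_mem _), ?_⟩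
  have hle : Ideal.span {u} ≤ m := (Ideal.span_singleton_le_iff_mem _).mpr hu
  have e : Ideal.span {u} ⊔ m ^ 2 = m := by
    have := Ideal.eq_prime_pow_of_succ_lt_of_le (P := m) (I := Ideal.span {u} ⊔ m ^ 2) hm (i := 1)
      (lt_of_le_of_ne le_sup_right fun h ↦ hu' (h ▸ Ideal.mem_sup_left
        (Ideal.mem_span_singleton_self u)))
      (by simpa using hlt.le.trans' le_rfl |> sup_le hle)
    simpa using this
  have hmax := IsLocalization.AtPrime.map_eq_maximalIdeal m (Localization.AtPrime m)
  refine le_antisymm ((Ideal.map_mono hle).trans hmax.le) ?_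
  refine Submodule.le_of_le_smul_of_le_jacobson_bot (I := IsLocalRing.maximalIdeal _)
    (IsNoetherian.noetherian _) (IsLocalRing.maximalIdeal_le_jacobson _) ?_
  rw [smul_eq_mul, ← sq, ← hmax, ← Ideal.map_pow]
  exact ((congrArg _ e).symm.trans (Ideal.map_sup _ _ _)).le

/-- A Dedekind domain of finite type over an algebraically closed field, not a field itself, is
smooth of relative dimension one. -/
theorem locally_isStandardSmooth_of_isDedekindDomain {k R : Type u} [Field k] [IsAlgClosed k]
    [CommRing R] [IsDedekindDomain R] [Algebra k R] [Algebra.FiniteType k R] (hR : ¬ IsField R) :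
    RingHom.Locally (RingHom.IsStandardSmoothOfRelativeDimension 1) (algebraMap k R) := by
  rw [RingHom.locally_iff_span_eq_top]
  -- Otherwise all elements with smooth localization lie in one maximal ideal `m`. The map k[X] → R
  -- that sends X to a local parameter at `m` is étale there, which yields such an element outside
  -- `m`.
  by_contra hne
  obtain ⟨m, hm, hle⟩ := Ideal.exists_le_maximal _ hne
  obtain ⟨u, hu, hu0, hmap⟩ := exists_map_span_singleton_eq m
    (Ring.ne_bot_of_isMaximal_of_not_isField hm hR)
  let : Algebra k[X] R := (aeval u : k[X] →ₐ[k] R).toAlgebra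
  have : IsScalarTower k k[X] R := .of_algHom (aeval u)
  -- A nonzero element algebraic over `k` would be a unit, but `u` lies in `m`.
  have htr : Transcendental k u := fun ha ↦ hm.ne_top
    (Ideal.eq_top_of_isUnit_mem _ hu (ha.isIntegral.isUnit hu0))
  have : Module.IsTorsionFree k[X] R := Module.isTorsionFree_iff_algebraMap_injective.mpr
    (transcendental_iff_injective.mp htr)
  have : Algebra.FiniteType k[X] R := .of_restrictScalars_finiteType k k[X] R
  have : Algebra.FinitePresentation k[X] R := Algebra.FinitePresentation.of_finiteType.mp this
  let p : Ideal k[X] := m.under k[X]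
  let := Localization.AtPrime.algebraOfLiesOver p m
  have hres (x : m.ResidueField) : ∃ c : k, algebraMap R _ (algebraMap k R c) = x := by
    let := Ideal.Quotient.field m
    have := finite_of_finite_type_of_isJacobsonRing k (R ⧸ m)
    obtain ⟨y, rfl⟩ := (Ideal.bijective_algebraMap_quotient_residueField m).2 x
    obtain ⟨c, rfl⟩ := (IsAlgClosed.algebraMap_bijective_of_isIntegral (k := k) (K := R ⧸ m)).2 y
    exact ⟨c, rfl⟩
  -- The residue field at `m` is `k` by the Nullstellensatz, so the residue extension is separable,
  -- and X maps to a generator of the maximal ideal. Flatness comes from torsion-freeness over k[X].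
  have hunr : Algebra.IsUnramifiedAt k[X] m := by
    refine (Algebra.isUnramifiedAt_iff_map_eq k[X] p m).mpr ⟨⟨fun x ↦ ?_⟩, ?_⟩
    · obtain ⟨c, rfl⟩ := hres x
      have : algebraMap R m.ResidueField (algebraMap k R c) =
          algebraMap p.ResidueField m.ResidueField (algebraMap k[X] p.ResidueField (C c)) := by
        rw [← IsScalarTower.algebraMap_apply k[X] p.ResidueField m.ResidueField,
          IsScalarTower.algebraMap_apply k[X] R m.ResidueField]
        congr 1
        exact (aeval_C u c).symm
      rw [this]
      exact isSeparable_algebraMap _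
    · refine le_antisymm ?_ ?_
      · rw [IsScalarTower.algebraMap_eq k[X] R, ← Ideal.map_map,
          ← IsLocalization.AtPrime.map_eq_maximalIdeal m (Localization.AtPrime m)]
        exact Ideal.map_mono Ideal.map_comap_le
      · rw [← hmap, Ideal.map_span, Ideal.span_le, Set.image_singleton, Set.singleton_subset_iff]
        have : algebraMap R (Localization.AtPrime m) u =
            algebraMap k[X] (Localization.AtPrime m) X := by
          rw [IsScalarTower.algebraMap_apply k[X] R]
          congr 1
          exact (aeval_X u).symm
        rw [this]
        refine Ideal.mem_map_of_mem _ ?_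
        change aeval u X ∈ m
        rwa [aeval_X]
  have := Algebra.IsEtaleAt.of_isUnramifiedAt_of_flat (R := k[X]) m
  obtain ⟨f, hf, hetale⟩ := Algebra.exists_etale_of_isEtaleAt (R := k[X]) m
  refine hf (hle (Ideal.subset_span ?_))
  have := Algebra.Etale.iff_isStandardSmoothOfRelativeDimension_zero.mp hetale
  have h1 : Algebra.IsStandardSmoothOfRelativeDimension (0 + 1) k (Localization.Away f) :=
    .trans 1 0 k k[X] _
  rw [Set.mem_ofPred_eq, ← IsScalarTower.algebraMap_eq]
  exact RingHom.isStandardSmoothOfRelativeDimension_algebraMap 1 |>.mpr h1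

end Smooth

/-! ### Smoothness of the plane model -/

namespace Biquadratic

variable {k : Type u} {K : Type u} [Field k] [Field K] [Algebra k K] {p q : k[X]}
  (h : Biquadratic k K p q)

lemma finite_orderMap (h2 : (2 : k) ≠ 0) (hp : Squarefree (X * p)) (hq : Squarefree (X * q))
    (hpq : Squarefree (p * q)) : h.orderMap.Finite := by
  let := h.orderMap.toAlgebra
  refine Module.finite_def.mpr (Submodule.fg_def.mpr ⟨({1, ⟨h.e₁, h.e₁_mem_order⟩,
    ⟨h.e₂, h.e₂_mem_order⟩, ⟨h.e₃, h.e₃_mem_order⟩} : Set h.order), by simp, ?_⟩)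
  rw [eq_top_iff]
  rintro ⟨z, hz⟩ -
  obtain ⟨a, b, c, d, rfl⟩ := (h.isIntegralElem_iff h2 hp hq hpq z).mp hz
  have e : (⟨_, hz⟩ : h.order) = a • 1 + b • ⟨h.e₁, h.e₁_mem_order⟩ + c • ⟨h.e₂, h.e₂_mem_order⟩ +
      d • ⟨h.e₃, h.e₃_mem_order⟩ := by
    ext
    simp only [Algebra.smul_def, mul_one]
    rfl
  rw [e]
  refine add_mem (add_mem (add_mem ?_ ?_) ?_) ?_ <;>
    exact Submodule.smul_mem _ _ (Submodule.subset_span (by simp))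

lemma injective_orderMap : Function.Injective h.orderMap := fun _ _ hab ↦
  h.injective_aeval congr(($hab : K))

lemma isFractionRing_order : IsFractionRing h.order K := by
  refine .of_field _ _ fun z ↦ ?_
  have key {a : K} (ha : a ∈ IntermediateField.adjoin k {h.t}) :
      ∃ s : k[X], s ≠ 0 ∧ a * aeval h.t s ∈ h.order := by
    obtain ⟨r, s, hs, rfl⟩ := h.exists_div ha
    exact ⟨s, hs, by rw [div_mul_cancel₀ _ (h.aeval_ne_zero hs)]; exact h.aeval_mem_order r⟩
  obtain ⟨a, ha, b, hb, c, hc, d, hd, rfl⟩ := h.span z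
  obtain ⟨s₀, h₀, ha⟩ := key ha
  obtain ⟨s₁, h₁, hb⟩ := key hb
  obtain ⟨s₂, h₂, hc⟩ := key hc
  obtain ⟨s₃, h₃, hd⟩ := key hd
  have hs : aeval h.t (s₀ * s₁ * s₂ * s₃) ≠ 0 := h.aeval_ne_zero (by positivity)
  refine ⟨⟨(a + b * h.e₁ + c * h.e₂ + d * h.e₃) * aeval h.t (s₀ * s₁ * s₂ * s₃), ?_⟩,
    ⟨_, h.aeval_mem_order (s₀ * s₁ * s₂ * s₃)⟩, (mul_div_cancel_right₀ _ hs).symm⟩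
  have hm := h.aeval_mem_order
  have e : (a + b * h.e₁ + c * h.e₂ + d * h.e₃) * aeval h.t (s₀ * s₁ * s₂ * s₃) =
      a * aeval h.t s₀ * aeval h.t (s₁ * s₂ * s₃) +
      b * aeval h.t s₁ * (aeval h.t (s₀ * s₂ * s₃) * h.e₁) +
      c * aeval h.t s₂ * (aeval h.t (s₀ * s₁ * s₃) * h.e₂) +
      d * aeval h.t s₃ * (aeval h.t (s₀ * s₁ * s₂) * h.e₃) := by
    simp only [map_mul]
    ring
  rw [e]
  exact add_mem (add_mem (add_mem (mul_mem ha (hm _)) (mul_mem hb (mul_mem (hm _) h.e₁_mem_order)))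
    (mul_mem hc (mul_mem (hm _) h.e₂_mem_order))) (mul_mem hd (mul_mem (hm _) h.e₃_mem_order))

/-- The order is a Dedekind domain: it is finite over k[t], so Noetherian of dimension at most one,
and it is integrally closed in its field of fractions `K`. It is not a field because k[t], over
which it is integral, is not. -/
lemma smooth_order [IsAlgClosed k] (h2 : (2 : k) ≠ 0) (hp : Squarefree (X * p))
    (hq : Squarefree (X * q)) (hpq : Squarefree (p * q)) :
    SmoothOfRelativeDimension 1 (Spec.map (CommRingCat.ofHom h.orderConst)) := by
  let := h.orderMap.toAlgebra
  let := h.orderConst.toAlgebra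
  have : Module.Finite k[X] h.order := h.finite_orderMap h2 hp hq hpq
  have : IsScalarTower k k[X] h.order := .of_algebraMap_eq fun a ↦ Subtype.ext (aeval_C h.t a).symm
  have : Algebra.FiniteType k h.order := .trans (S := k[X]) inferInstance inferInstance
  have : IsFractionRing h.order K := h.isFractionRing_order
  have : IsDedekindRing h.order := (isDedekindRing_iff h.order K).mpr
    ⟨IsNoetherianRing.of_finite k[X] h.order, .of_isIntegral k[X] h.order,
      fun {x} hx ↦ h.isIntegrallyClosedHom_order.2 x hx⟩
  refine (HasRingHomProperty.Spec_iff (P := @SmoothOfRelativeDimension 1)).mpr ?_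
  refine locally_isStandardSmooth_of_isDedekindDomain (k := k) (R := h.order) ?_
  rw [← Algebra.IsIntegral.isField_iff_isField (R := k[X]) h.injective_orderMap]
  exact Polynomial.not_isField k

end Biquadratic

instance isZariskiLocalAtSource_smoothOfRelativeDimension (n : ℕ) :
    IsZariskiLocalAtSource (@SmoothOfRelativeDimension.{u} n) :=
  HasRingHomProperty.instIsZariskiLocalAtSource
    (Q := RingHom.Locally (RingHom.IsStandardSmoothOfRelativeDimension n))

lemma smoothOfRelativeDimension_of_iso_hom_comp (n : ℕ) {S T Y : Scheme.{u}} (e : S ≅ T) (f : T ⟶ Y)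
    (h : SmoothOfRelativeDimension n (e.hom ≫ f)) : SmoothOfRelativeDimension n f := by
  rw [← e.inv_hom_id_assoc f]
  exact IsZariskiLocalAtSource.comp (P := @SmoothOfRelativeDimension n) h e.inv

/-- Smoothness can be checked on two charts that cover the source. -/
lemma smoothOfRelativeDimension_of_charts (n : ℕ) {T Y U₀ U₁ : Scheme.{u}} (i₀ : U₀ ⟶ T)
    (i₁ : U₁ ⟶ T) [IsOpenImmersion i₀] [IsOpenImmersion i₁]
    (hcov : ∀ z, (∃ x, i₀ x = z) ∨ ∃ x, i₁ x = z) (f : T ⟶ Y)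
    (h₀ : SmoothOfRelativeDimension n (i₀ ≫ f)) (h₁ : SmoothOfRelativeDimension n (i₁ ≫ f)) :
    SmoothOfRelativeDimension n f := by
  let U (b : Bool) : Scheme.{u} := b.rec U₀ U₁
  let i (b : Bool) : U b ⟶ T := b.rec i₀ i₁
  have hi (b : Bool) : IsOpenImmersion (i b) := by
    cases b <;> assumption
  let 𝒰 : T.OpenCover := Scheme.Cover.mkOfCovers Bool U i (by
    intro z
    rcases hcov z with h | h
    · exact ⟨false, h⟩
    · exact ⟨true, h⟩) hi
  refine (IsZariskiLocalAtSource.iff_of_openCover (P := @SmoothOfRelativeDimension n) 𝒰).mpr ?_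
  rintro (_ | _)
  · exact h₀
  · exact h₁

variable {k : Type u} {K : Type u} [Field k] [Field K] [Algebra k K]

/-- The closure of the point is smooth. -/
theorem Biquadratic.smooth_image [IsAlgClosed k] {α₂ α₃ β₂ β₃ : k}
    (h : Biquadratic k K (quad α₂ α₃) (quad β₂ β₃)) (h2 : (2 : k) ≠ 0)
    (hα₂ : α₂ ≠ 0) (hα₃ : α₃ ≠ 0) (hβ₂ : β₂ ≠ 0) (hβ₃ : β₃ ≠ 0)
    (hα : α₂ ≠ α₃) (hβ : β₂ ≠ β₃) (h₂₂ : α₂ ≠ β₂) (h₂₃ : α₂ ≠ β₃) (h₃₂ : α₃ ≠ β₂) (h₃₃ : α₃ ≠ β₃)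
    (hc : α₂ * α₃ ≠ β₂ * β₃) :
    SmoothOfRelativeDimension 1 (h.planePoint.imageι ≫ P2.toSpec k) := by
  obtain ⟨i₀, i₁, _, _, hcov, -, -, s₀, s₁, -⟩ :=
    h.exists_charts h2 hα₂ hα₃ hβ₂ hβ₃ hα hβ h₂₂ h₂₃ h₃₂ h₃₃ hc
  refine smoothOfRelativeDimension_of_charts 1 i₀ i₁ hcov _ ?_ ?_
  · rw [s₀]
    exact h.smooth_order h2 (squarefree_X_mul_quad hα₂ hα₃ hα) (squarefree_X_mul_quad hβ₂ hβ₃ hβ)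
      (squarefree_quad_mul_quad hα hβ h₂₂ h₂₃ h₃₂ h₃₃)
  · rw [s₁]
    exact (h.flipQuad hα₂ hα₃ hβ₂ hβ₃).smooth_order h2 (squarefree_X_mul_flipQuad hα₂ hα₃ hα)
      (squarefree_X_mul_flipQuad hβ₂ hβ₃ hβ)
      (squarefree_flipQuad_mul_flipQuad hα₂ hα₃ hβ₂ hβ₃ hα hβ h₂₂ h₂₃ h₃₂ h₃₃)

lemma not_isUnit_quad_mul_quad (a b c d : k) : ¬ IsUnit (quad a b * quad c d) := by
  intro h
  have h' := isUnit_of_mul_isUnit_left (isUnit_of_mul_isUnit_left h)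
  exact not_isUnit_X_sub_C a h'

end

end HoweCurve

/-! ### The theorem -/

theorem mainTheorem2 {k : Type*} [Field k] [IsAlgClosed k] (hchar : ringChar k ≠ 2)
    (α₂ α₃ β₂ β₃ : k) (hα₂ : α₂ ≠ 0) (hα₃ : α₃ ≠ 0) (hβ₂ : β₂ ≠ 0) (hβ₃ : β₃ ≠ 0)
    (hα : α₂ ≠ α₃) (hβ : β₂ ≠ β₃) (h₂₂ : α₂ ≠ β₂) (h₂₃ : α₂ ≠ β₃) (h₃₂ : α₃ ≠ β₂) (h₃₃ : α₃ ≠ β₃)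
    (hnonhyp : α₂ * α₃ ≠ β₂ * β₃)
    (f : MvPolynomial (Fin 2) k)
    (hf : f = HoweCurve.resultantQuartic (α₂ + α₃) (α₂ * α₃) (β₂ + β₃) (β₂ * β₃)) :
    f = HoweCurve.explicitQuartic (α₂ + α₃) (α₂ * α₃) (β₂ + β₃) (β₂ * β₃) ∧
    SmoothOfRelativeDimension 1 (HoweCurve.ProjectiveClosure.toSpec f) ∧
    ∃ e : HoweCurve.Curve α₂ α₃ β₂ β₃ ≅ HoweCurve.ProjectiveClosure f,
      e.hom ≫ HoweCurve.ProjectiveClosure.toSpec f = HoweCurve.Curve.toSpec α₂ α₃ β₂ β₃ := by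
  have h2 : (2 : k) ≠ 0 := Ring.two_ne_zero hchar
  rw [HoweCurve.resultantQuartic_eq] at hf
  subst hf
  obtain ⟨K, _, _, ⟨h⟩⟩ := HoweCurve.exists_biquadratic h2 (HoweCurve.quad α₂ α₃)
    (HoweCurve.quad β₂ β₃) (HoweCurve.squarefree_X_mul_quad hα₂ hα₃ hα)
    (HoweCurve.squarefree_X_mul_quad hβ₂ hβ₃ hβ)
    (HoweCurve.squarefree_quad_mul_quad hα hβ h₂₂ h₂₃ h₃₂ h₃₃)
    (HoweCurve.not_isUnit_quad_mul_quad α₂ α₃ β₂ β₃)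
  obtain ⟨θ, hθ, hθe⟩ := h.exists_injective h2 hnonhyp
  obtain ⟨e, he⟩ := HoweCurve.exists_projectiveClosure_iso _ θ hθ h.planePoint
    (by rw [hθe]; rfl)
  obtain ⟨e', he'⟩ := h.exists_curve_iso h2 hα₂ hα₃ hβ₂ hβ₃ hα hβ h₂₂ h₂₃ h₃₂ h₃₃ hnonhyp
  have hs := h.smooth_image h2 hα₂ hα₃ hβ₂ hβ₃ hα hβ h₂₂ h₂₃ h₃₂ h₃₃ hnonhyp
  refine ⟨rfl, ?_, e' ≪≫ e, ?_⟩
  · rw [← he] at hs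
    exact HoweCurve.smoothOfRelativeDimension_of_iso_hom_comp 1 e _ hs
  · rw [Iso.trans_hom, Category.assoc, he, he']
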